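/- Let $c:\mathbb R^d\times\mathbb R^d\to[0,\infty)$ be continuous with $c(x,y)=0$ if and only if $x=y$, and suppose that for some $p\ge 1$ and some constants $A,B>0$, $c(x,y)\le A+B(|x|^p+|y|^p)$ as $|x|,|y|\to\infty$. Let $\rho_0,\rho_1$ be probability densities on $\mathbb R^d$ with finite $p$-th moments, and let $\epsilon>0$. Let $a_\epsilon\in L^1(\rho_0)$ and $b_\epsilon\in L^1(\rho_1)$ be Schrödinger potentials, that is, measurable functions such that, with $$\xi(x,y)=\exp\Big(-\tfrac1\epsilon\big(c(x,y)-a_\epsilon(x)-b_\epsilon(y)\big)\Big),$$ the measure $\mu_\epsilon(dx\,dy)=\xi(x,y)\rho_0(x)\rho_1(y)\,dx\,dy$ is a coupling of $\rho_0$ and $\rho_1$ (the static Schrödinger bridge at temperature $\epsilon$). Assume moreover that $\xi\in L^2(\rho_0\otimes\rho_1)$. Let $(X_i,Y_i)_{i\ge1}$ be i.i.d. with law $\rho_0\otimes\rho_1$. For $N\ge1$ let $\mathcal S_N$ be the set of permutations of $\{1,\dots,N\}$ and define the random measure (the discrete Schrödinger bridge) $$\hat\mu^N_\epsilon=\sum_{\sigma\in\mathcal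 S_N}q^*_\epsilon(\sigma)\,\frac1N\sum_{i=1}^N\delta_{(X_i,Y_{\sigma_i})},\qquad q^*_\epsilon(\sigma)=\frac{\exp\big(-\frac1\epsilon\sum_{i=1}^N c(X_i,Y_{\sigma_i})\big)}{\sum_{\tau\in\mathcal S_N}\exp\big(-\frac1\epsilon\sum_{i=1}^N c(X_i,Y_{\tau_i})\big)}.$$ Then for every $\eta\in L^1(\mu_\epsilon)$, as $N\to\infty$, $$T_N=\int\eta\,d\hat\mu^N_\epsilon\ \longrightarrow\ \theta=\int\eta\,d\mu_\epsilon\quad\text{in probability.}$$ -/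

import Mathlib

open MeasureTheory ProbabilityTheory Filter Topology

noncomputable section

/-- A transport cost on `ℝ^d`: a continuous nonnegative function which vanishes exactly on the
diagonal and satisfies `c(x,y) ≤ A + B (|x|^p + |y|^p)` as `|x|, |y| → ∞`. -/
structure IsTransportCost {d : ℕ} (p : ℝ)
    (c : EuclideanSpace ℝ (Fin d) → EuclideanSpace ℝ (Fin d) → ℝ) : Prop where
  continuous : Continuous (Function.uncurry c)
  nonneg : ∀ x y, 0 ≤ c x y
  eq_zero_iff : ∀ x y, c x y = 0 ↔ x = y
  growth : ∃ A B R : ℝ, 0 < A ∧ 0 < B ∧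
    ∀ x y, R ≤ ‖x‖ → R ≤ ‖y‖ → c x y ≤ A + B * (‖x‖ ^ p + ‖y‖ ^ p)

/-- The set `Π(ρ₀, ρ₁)` of couplings of two measures. -/
def couplings {d : ℕ} (ρ₀ ρ₁ : Measure (EuclideanSpace ℝ (Fin d))) :
    Set (Measure (EuclideanSpace ℝ (Fin d) × EuclideanSpace ℝ (Fin d))) :=
  {ν | ν.map Prod.fst = ρ₀ ∧ ν.map Prod.snd = ρ₁}

/-- `ξ(x,y) = exp(-(c(x,y) - a(x) - b(y)) / ε)`. -/
def schrodingerXi {d : ℕ} (c : EuclideanSpace ℝ (Fin d) → EuclideanSpace ℝ (Fin d) → ℝ)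
    (ε : ℝ) (a b : EuclideanSpace ℝ (Fin d) → ℝ)
    (z : EuclideanSpace ℝ (Fin d) × EuclideanSpace ℝ (Fin d)) : ℝ :=
  Real.exp (-(1 / ε) * (c z.1 z.2 - a z.1 - b z.2))

/-- The measure `ξ(x,y) ρ₀(dx) ρ₁(dy)`. -/
def schrodingerMeasure {d : ℕ} (c : EuclideanSpace ℝ (Fin d) → EuclideanSpace ℝ (Fin d) → ℝ)
    (ε : ℝ) (ρ₀ ρ₁ : Measure (EuclideanSpace ℝ (Fin d)))
    (a b : EuclideanSpace ℝ (Fin d) → ℝ) :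
    Measure (EuclideanSpace ℝ (Fin d) × EuclideanSpace ℝ (Fin d)) :=
  (ρ₀.prod ρ₁).withDensity (fun z => ENNReal.ofReal (schrodingerXi c ε a b z))

/-- `a` and `b` are Schrödinger potentials for `(ρ₀, ρ₁)` at temperature `ε`: measurable functions
for which `ξ(x,y) ρ₀(dx) ρ₁(dy)` is a coupling of `ρ₀` and `ρ₁`. That coupling is then the static
Schrödinger bridge connecting `ρ₀` to `ρ₁`. -/
structure IsSchrodingerPotentials {d : ℕ}
    (c : EuclideanSpace ℝ (Fin d) → EuclideanSpace ℝ (Fin d) → ℝ)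
    (ε : ℝ) (ρ₀ ρ₁ : Measure (EuclideanSpace ℝ (Fin d)))
    (a b : EuclideanSpace ℝ (Fin d) → ℝ) : Prop where
  measurable_left : Measurable a
  measurable_right : Measurable b
  mem_couplings : schrodingerMeasure c ε ρ₀ ρ₁ a b ∈ couplings ρ₀ ρ₁

/-- The unnormalised weight `exp(-(1/ε) ∑ᵢ c(xᵢ, y_{σ(i)}))` of a permutation. -/
def permWeight {d N : ℕ} (c : EuclideanSpace ℝ (Fin d) → EuclideanSpace ℝ (Fin d) → ℝ)
    (ε : ℝ) (x y : Fin N → EuclideanSpace ℝ (Fin d)) (σ : Equiv.Perm (Fin N)) : ℝ :=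
  Real.exp (-(1 / ε) * ∑ i, c (x i) (y (σ i)))

/-- The Gibbs probability of a permutation. -/
def gibbsProb {d N : ℕ} (c : EuclideanSpace ℝ (Fin d) → EuclideanSpace ℝ (Fin d) → ℝ)
    (ε : ℝ) (x y : Fin N → EuclideanSpace ℝ (Fin d)) (σ : Equiv.Perm (Fin N)) : ℝ :=
  permWeight c ε x y σ / ∑ τ : Equiv.Perm (Fin N), permWeight c ε x y τ

/-- The discrete Schrödinger bridge `∑_σ q(σ) (1/N) ∑ᵢ δ_{(xᵢ, y_{σ(i)})}` of two point clouds,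
where `q` is the Gibbs probability. -/
def discreteBridge {d N : ℕ} (c : EuclideanSpace ℝ (Fin d) → EuclideanSpace ℝ (Fin d) → ℝ)
    (ε : ℝ) (x y : Fin N → EuclideanSpace ℝ (Fin d)) :
    Measure (EuclideanSpace ℝ (Fin d) × EuclideanSpace ℝ (Fin d)) :=
  ∑ σ : Equiv.Perm (Fin N), ENNReal.ofReal (gibbsProb c ε x y σ) •
    ((N : ENNReal)⁻¹ • ∑ i, Measure.dirac (x i, y (σ i)))

end

/-! ### Capacity of stable homogeneous polynomials -/

/-- A stability condition for polynomials in `n` variables: no zero has all its coordinates in the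
closed right half plane and one of them in the open right half plane. -/
def IsHalfPlaneStable {n : ℕ} (p : MvPolynomial (Fin n) ℂ) : Prop :=
  ∀ z : Fin n → ℂ, (∀ j, 0 ≤ (z j).re) → (n = 0 ∨ ∃ j, 0 < (z j).re) → MvPolynomial.eval z p ≠ 0

theorem MvPolynomial.IsHomogeneous.eval_const_mul {n m : ℕ} {p : MvPolynomial (Fin n) ℂ}
    (hp : p.IsHomogeneous m) (l : ℂ) (z : Fin n → ℂ) :
    MvPolynomial.eval (fun i => l * z i) p = l ^ m * MvPolynomial.eval z p := by
  rw [MvPolynomial.eval_eq', MvPolynomial.eval_eq', Finset.mul_sum]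
  refine Finset.sum_congr rfl fun d hd => ?_
  have h : d.degree = m := by
    by_contra hne
    exact (MvPolynomial.mem_support_iff.1 hd) (hp.coeff_eq_zero hne)
  have h2 : ∑ i, d i = m := by rw [← h, Finsupp.degree_eq_sum]
  simp_rw [mul_pow]
  rw [Finset.prod_mul_distrib, Finset.prod_pow_eq_pow_sum, h2]
  ring

theorem multiset_prod_one_sub_coeff (s : Multiset ℂ) :
    ((s.map fun w => 1 - Polynomial.C w⁻¹ * Polynomial.X).prod).coeff 0 = 1 ∧
    ((s.map fun w => 1 - Polynomial.C w⁻¹ * Polynomial.X).prod).coeff 1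
      = (s.map fun w => -w⁻¹).sum := by
  induction s using Multiset.induction with
  | empty => simp [Polynomial.coeff_one]
  | cons a s ih =>
    obtain ⟨h0, h1⟩ := ih
    simp only [Multiset.map_cons, Multiset.prod_cons, Multiset.sum_cons]
    refine ⟨?_, ?_⟩
    · rw [Polynomial.mul_coeff_zero, h0]; simp
    · rw [Polynomial.mul_coeff_one, h0, h1]
      simp [Polynomial.coeff_one]
      ring

theorem polynomial_eq_prod_one_sub (g : Polynomial ℂ) (h0 : g.eval 0 ≠ 0) :
    g = Polynomial.C (g.eval 0) *
      (g.roots.map fun w => 1 - Polynomial.C w⁻¹ * Polynomial.X).prod := by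
  have hs := (IsAlgClosed.splits g).eq_prod_roots
  have hne : ∀ w ∈ g.roots, w ≠ 0 := by
    intro w hw hw0
    rw [hw0] at hw
    exact h0 (Polynomial.isRoot_of_mem_roots hw)
  have key : ∀ s : Multiset ℂ, (∀ w ∈ s, w ≠ 0) →
      (s.map fun w => Polynomial.X - Polynomial.C w).prod =
      Polynomial.C ((s.map fun w => -w).prod) *
        (s.map fun w => 1 - Polynomial.C w⁻¹ * Polynomial.X).prod := by
    intro s
    induction s using Multiset.induction with
    | empty => simp
    | cons a s ih =>
      intro h
      have ha : a ≠ 0 := h a (by simp)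
      simp only [Multiset.map_cons, Multiset.prod_cons]
      rw [ih (fun w hw => h w (by simp [hw]))]
      have : (Polynomial.X - Polynomial.C a : Polynomial ℂ)
          = Polynomial.C (-a) * (1 - Polynomial.C a⁻¹ * Polynomial.X) := by
        rw [mul_sub, ← mul_assoc, ← Polynomial.C_mul]
        simp [ha]
        ring
      rw [this, Polynomial.C_mul]
      ring
  rw [key _ hne, ← mul_assoc, ← Polynomial.C_mul] at hs
  have h2 : g.eval 0 = g.leadingCoeff * (g.roots.map fun w => -w).prod := by
    conv_lhs => rw [hs]
    rw [Polynomial.eval_mul, ← Polynomial.coeff_zero_eq_eval_zero (Multiset.prod _),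
      (multiset_prod_one_sub_coeff _).1]
    simp
  rw [h2]
  exact hs

theorem multiset_prod_norm_le (s : Multiset ℂ) (hs : ∀ b ∈ s, b.im = 0 ∧ 0 < b.re) (t m : ℝ)
    (ht : 0 ≤ t) (hm : 0 < m) :
    ‖(s.map fun b => 1 + b * (t : ℂ)).prod‖ ≤
      m ^ s.card * Real.exp ((s.card + t * (s.map Complex.re).sum) / m - s.card) := by
  induction s using Multiset.induction with
  | empty => simp
  | cons a s ih =>
    have ih' := ih (fun b hb => hs b (by simp [hb]))
    obtain ⟨ha, ha'⟩ := hs a (by simp)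
    simp only [Multiset.map_cons, Multiset.prod_cons, Multiset.card_cons, Multiset.sum_cons]
    rw [norm_mul]
    have h1 : (1 + a * (t : ℂ)) = ((1 + a.re * t : ℝ) : ℂ) := by
      apply Complex.ext <;> simp [ha]
    have h2 : ‖1 + a * (t : ℂ)‖ = 1 + a.re * t := by
      rw [h1, Complex.norm_real, Real.norm_of_nonneg]
      positivity
    have h3 : 1 + a.re * t ≤ m * Real.exp ((1 + a.re * t) / m - 1) := by
      have := Real.add_one_le_exp ((1 + a.re * t) / m - 1)
      calc 1 + a.re * t = m * ((1 + a.re * t) / m - 1 + 1) := by field_simp; ring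
        _ ≤ _ := by gcongr
    rw [h2]
    calc _ ≤ (m * Real.exp ((1 + a.re * t) / m - 1)) *
          (m ^ s.card * Real.exp ((s.card + t * (s.map Complex.re).sum) / m - s.card)) := by
          gcongr
      _ = m ^ (s.card + 1) * (Real.exp ((1 + a.re * t) / m - 1) *
            Real.exp ((s.card + t * (s.map Complex.re).sum) / m - s.card)) := by ring
      _ = _ := by
          rw [← Real.exp_add]
          push_cast
          congr 2
          ring

theorem multiset_sum_re (s : Multiset ℂ) : s.sum.re = (s.map Complex.re).sum :=
  map_multiset_sum Complex.reAddGroupHom s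

/-- If a polynomial of degree `n + 2` with only negative roots is at least `c t` for `t > 0`, then
its linear coefficient is at least `((n + 1) / (n + 2)) ^ (n + 1) c`. -/
theorem le_norm_coeff_one (g : Polynomial ℂ) (n : ℕ) (hcard : g.roots.card = n + 2)
    (h0 : g.eval 0 ≠ 0) (hr : ∀ w ∈ g.roots, (-w⁻¹).im = 0 ∧ 0 < (-w⁻¹).re) (c : ℝ)
    (hc : ∀ t : ℝ, 0 < t → c * t ≤ ‖g.eval (t : ℂ)‖) :
    ((n + 1 : ℝ) / (n + 2)) ^ (n + 1) * c ≤ ‖g.coeff 1‖ := by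
  have hg := polynomial_eq_prod_one_sub g h0
  set s : Multiset ℂ := g.roots.map fun w => -w⁻¹ with hs
  have hs' : ∀ b ∈ s, b.im = 0 ∧ 0 < b.re := by
    intro b hb
    obtain ⟨w, hw, rfl⟩ := Multiset.mem_map.1 hb
    exact hr w hw
  have hcs : s.card = n + 2 := by simp [hs, hcard]
  have hco : g.coeff 1 = g.eval 0 * s.sum := by
    conv_lhs => rw [hg]
    rw [Polynomial.coeff_C_mul, (multiset_prod_one_sub_coeff _).2]
  have hev : ∀ t : ℂ, g.eval t = g.eval 0 * (s.map fun b => 1 + b * t).prod := by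
    intro t
    conv_lhs => rw [hg]
    rw [Polynomial.eval_mul, Polynomial.eval_C, Polynomial.eval_multiset_prod, hs,
      Multiset.map_map, Multiset.map_map]
    simp [sub_eq_add_neg]
  set β : ℝ := (s.map Complex.re).sum with hβ
  have hβpos : 0 < β := by
    obtain ⟨a, ha⟩ : ∃ a, a ∈ s := Multiset.card_pos_iff_exists_mem.1 (by omega)
    obtain ⟨u, hu⟩ := Multiset.exists_cons_of_mem ha
    have : 0 ≤ (u.map Complex.re).sum := by
      apply Multiset.sum_nonneg
      intro x hx
      obtain ⟨b, hb, rfl⟩ := Multiset.mem_map.1 hx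
      exact (hs' b (by rw [hu]; simp [hb])).2.le
    rw [hβ, hu, Multiset.map_cons, Multiset.sum_cons]
    have := (hs' a ha).2
    linarith
  have hnorm : ‖g.eval 0‖ * β ≤ ‖g.coeff 1‖ := by
    rw [hco, norm_mul]
    gcongr
    calc β = s.sum.re := (multiset_sum_re s).symm
      _ ≤ ‖s.sum‖ := Complex.re_le_norm _
  refine le_trans ?_ hnorm
  set m : ℝ := (n + 2) / (n + 1) with hm
  have hmpos : 0 < m := by positivity
  set t : ℝ := m / β with ht
  have htpos : 0 < t := by positivity
  have h1 := hc t htpos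
  rw [hev, norm_mul] at h1
  have h2 := multiset_prod_norm_le s hs' t m htpos.le hmpos
  have h3 : ((s.card : ℝ) + t * β) / m - s.card = 0 := by
    rw [hcs, ht, hm]
    field_simp
    push_cast
    ring
  rw [← hβ, h3, Real.exp_zero, mul_one, hcs] at h2
  have h4 : c * t ≤ ‖g.eval 0‖ * m ^ (n + 2) := h1.trans (by gcongr)
  have h5 : c * m ≤ ‖g.eval 0‖ * β * m ^ (n + 2) := by
    have : c * m = c * t * β := by rw [ht]; field_simp
    rw [this]
    calc _ ≤ ‖g.eval 0‖ * m ^ (n + 2) * β := by gcongr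
      _ = _ := by ring
  have h6 : ((n + 1 : ℝ) / (n + 2)) = m⁻¹ := by rw [hm, inv_div]
  rw [h6, inv_pow, inv_mul_le_iff₀ (by positivity)]
  have h7 : ‖g.eval 0‖ * β * m ^ (n + 2) = (m ^ (n + 1) * (‖g.eval 0‖ * β)) * m := by ring
  rw [h7] at h5
  exact le_of_mul_le_mul_right h5 hmpos

section Stable

variable {n : ℕ} {p : MvPolynomial (Fin (n + 1)) ℂ}

theorem eval_map_finSuccEquiv (z : Fin n → ℂ) (w : ℂ) :
    ((MvPolynomial.finSuccEquiv ℂ n p).map (MvPolynomial.eval z)).eval w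
      = MvPolynomial.eval (Fin.cons w z) p :=
  (MvPolynomial.eval_eq_eval_mv_eval' z w p).symm

theorem map_finSuccEquiv_natDegree_le (hp : p.IsHomogeneous (n + 1)) (z : Fin n → ℂ) :
    ((MvPolynomial.finSuccEquiv ℂ n p).map (MvPolynomial.eval z)).natDegree ≤ n + 1 := by
  refine Polynomial.natDegree_map_le.trans ?_
  rw [MvPolynomial.natDegree_finSuccEquiv]
  exact (MvPolynomial.degreeOf_le_totalDegree _ _).trans hp.totalDegree_le

theorem map_finSuccEquiv_coeff_top (hp : p.IsHomogeneous (n + 1)) (hs : IsHalfPlaneStable p)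
    (z : Fin n → ℂ) :
    ((MvPolynomial.finSuccEquiv ℂ n p).map (MvPolynomial.eval z)).coeff (n + 1) ≠ 0 := by
  have hc : ∀ z : Fin n → ℂ,
      ((MvPolynomial.finSuccEquiv ℂ n p).map (MvPolynomial.eval z)).coeff (n + 1)
      = ((MvPolynomial.finSuccEquiv ℂ n p).coeff (n + 1)).coeff 0 := by
    intro z
    have h := hp.finSuccEquiv_coeff_isHomogeneous (n + 1) 0 rfl
    have h2 := MvPolynomial.totalDegree_eq_zero_iff_eq_C.1
      ((MvPolynomial.totalDegree_zero_iff_isHomogeneous _).2 h)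
    rw [Polynomial.coeff_map, h2]
    simp
  rw [hc, ← hc 0]
  have h1 : MvPolynomial.eval (Fin.cons (1 : ℂ) (0 : Fin n → ℂ)) p ≠ 0 := by
    apply hs
    · intro j
      refine Fin.cases ?_ (fun i => ?_) j <;> simp
    · right
      exact ⟨0, by simp⟩
  rw [← eval_map_finSuccEquiv, Polynomial.eval_eq_sum_range' (n := n + 2)
    (Nat.lt_succ_of_le (map_finSuccEquiv_natDegree_le hp 0)), Finset.sum_range_succ,
    Finset.sum_eq_zero] at h1
  · simpa using h1
  · intro i hi
    have hi' := Finset.mem_range.1 hi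
    have h := hp.finSuccEquiv_coeff_isHomogeneous i (n + 1 - i) (by omega)
    rw [Polynomial.coeff_map]
    have h3 := h.coeff_eq_zero (d := 0) (by simp; omega)
    have h4 : MvPolynomial.eval (0 : Fin n → ℂ) ((MvPolynomial.finSuccEquiv ℂ n p).coeff i) = 0 := by
      have h5 : (0 : Fin n → ℂ) = fun _ => 0 := rfl
      rw [h5, MvPolynomial.eval_zero']
      simpa [MvPolynomial.constantCoeff_eq] using h3
    rw [h4]
    simp

theorem map_finSuccEquiv_card_roots (hp : p.IsHomogeneous (n + 1)) (hs : IsHalfPlaneStable p)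
    (z : Fin n → ℂ) :
    ((MvPolynomial.finSuccEquiv ℂ n p).map (MvPolynomial.eval z)).roots.card = n + 1 := by
  have h1 : ((MvPolynomial.finSuccEquiv ℂ n p).map (MvPolynomial.eval z)).natDegree = n + 1 :=
    le_antisymm (map_finSuccEquiv_natDegree_le hp z)
      (Polynomial.le_natDegree_of_ne_zero (map_finSuccEquiv_coeff_top hp hs z))
  exact ((IsAlgClosed.splits _).natDegree_eq_card_roots).symm.trans h1

theorem IsHalfPlaneStable.coeff_one (hp : p.IsHomogeneous (n + 1)) (hs : IsHalfPlaneStable p) :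
    IsHalfPlaneStable ((MvPolynomial.finSuccEquiv ℂ n p).coeff 1) := by
  intro z hz hz'
  rw [← Polynomial.coeff_map]
  rcases Nat.eq_zero_or_pos n with hn | hn
  · subst hn
    exact map_finSuccEquiv_coeff_top hp hs z
  obtain ⟨j, hj⟩ : ∃ j, 0 < (z j).re := hz'.resolve_left hn.ne'
  set g := (MvPolynomial.finSuccEquiv ℂ n p).map (MvPolynomial.eval z) with hg
  have hroot : ∀ w : ℂ, 0 ≤ w.re → g.eval w ≠ 0 := by
    intro w hw
    rw [hg, eval_map_finSuccEquiv]
    apply hs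
    · intro i
      refine Fin.cases ?_ (fun i => ?_) i
      · simpa using hw
      · simpa using hz i
    · exact Or.inr ⟨j.succ, by simpa using hj⟩
  have h0 : g.eval 0 ≠ 0 := hroot 0 (by simp)
  have hcard := map_finSuccEquiv_card_roots hp hs z
  rw [← hg] at hcard
  have hco : g.coeff 1 = g.eval 0 * (g.roots.map fun w => -w⁻¹).sum := by
    conv_lhs => rw [polynomial_eq_prod_one_sub g h0]
    rw [Polynomial.coeff_C_mul, (multiset_prod_one_sub_coeff _).2]
  rw [hco]
  refine mul_ne_zero h0 fun hsum => ?_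
  have hre : ((g.roots.map fun w => -w⁻¹).sum).re = 0 := by rw [hsum]; simp
  rw [multiset_sum_re, Multiset.map_map] at hre
  have hpos : ∀ w ∈ g.roots, 0 < (Complex.re ∘ fun w : ℂ => -w⁻¹) w := by
    intro w hw
    have hw1 : w.re < 0 := by
      by_contra hcon
      exact hroot w (not_lt.1 hcon) (Polynomial.isRoot_of_mem_roots hw)
    have hw2 : w ≠ 0 := by rintro rfl; simp at hw1
    simp only [Function.comp, Complex.neg_re, Complex.inv_re]
    rw [← neg_div]
    exact div_pos (by linarith) (Complex.normSq_pos.2 hw2)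
  obtain ⟨a, ha⟩ : ∃ a, a ∈ g.roots := Multiset.card_pos_iff_exists_mem.1 (by omega)
  obtain ⟨u, hu⟩ := Multiset.exists_cons_of_mem ha
  rw [hu, Multiset.map_cons, Multiset.sum_cons] at hre
  have h1 : 0 ≤ (u.map (Complex.re ∘ fun w : ℂ => -w⁻¹)).sum := by
    apply Multiset.sum_nonneg
    intro x hx
    obtain ⟨b, hb, rfl⟩ := Multiset.mem_map.1 hx
    exact (hpos b (by rw [hu]; simp [hb])).le
  linarith [hpos a ha]

theorem IsHalfPlaneStable.roots_neg (hp : p.IsHomogeneous (n + 1)) (hs : IsHalfPlaneStable p)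
    (hn : 0 < n) (x : Fin n → ℝ) (hx : ∀ i, 0 < x i) (w : ℂ)
    (hw : ((MvPolynomial.finSuccEquiv ℂ n p).map (MvPolynomial.eval fun i => (x i : ℂ))).eval w
      = 0) : w.im = 0 ∧ w.re < 0 := by
  by_contra hcon
  rw [eval_map_finSuccEquiv] at hw
  have hl : 0 < ‖w‖ + w.re ∨ w = 0 := by
    by_cases hw0 : w = 0
    · exact Or.inr hw0
    left
    have h1 := Complex.abs_re_le_norm w
    have h2 := neg_abs_le w.re
    rcases lt_or_eq_of_le (show 0 ≤ ‖w‖ + w.re by linarith) with h | h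
    · exact h
    exfalso
    apply hcon
    have h3 : ‖w‖ = -w.re := by linarith
    have h4 : ‖w‖ ^ 2 = w.re ^ 2 + w.im ^ 2 := by
      rw [← Complex.normSq_eq_norm_sq, Complex.normSq_apply]; ring
    rw [h3] at h4
    have h5 : w.im = 0 := by nlinarith
    refine ⟨h5, ?_⟩
    have : 0 < ‖w‖ := norm_pos_iff.2 hw0
    linarith
  have key : ∀ l : ℂ, 0 < l.re → 0 ≤ (l * w).re → False := by
    intro l hl1 hl2
    refine hs (fun i => l * (Fin.cons w (fun i => (x i : ℂ)) : Fin (n + 1) → ℂ) i) ?_ ?_ ?_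
    · intro j
      refine Fin.cases ?_ (fun i => ?_) j
      · simpa using hl2
      · simpa using mul_nonneg hl1.le (hx i).le
    · exact Or.inr ⟨Fin.succ ⟨0, hn⟩, by
        change 0 < (l * (x ⟨0, hn⟩ : ℂ)).re
        rw [Complex.re_mul_ofReal]
        exact mul_pos hl1 (hx _)⟩
    · rw [hp.eval_const_mul, hw, mul_zero]
  rcases hl with hl | hl
  · refine key (‖w‖ + (starRingEnd ℂ) w) (by simpa using hl) ?_
    have : ((‖w‖ : ℂ) + (starRingEnd ℂ) w) * w = ‖w‖ * w + (‖w‖ ^ 2 : ℝ) := by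
      rw [add_mul, mul_comm ((starRingEnd ℂ) w), Complex.mul_conj, Complex.normSq_eq_norm_sq]
    rw [this, Complex.add_re, Complex.re_ofReal_mul, Complex.ofReal_re]
    have : 0 ≤ ‖w‖ * (‖w‖ + w.re) := by positivity
    nlinarith
  · exact key 1 (by simp) (by simp [hl])

theorem IsHalfPlaneStable.le_norm_eval_coeff_one (hp : p.IsHomogeneous (n + 1))
    (hs : IsHalfPlaneStable p) (c : ℝ)
    (hc : ∀ x : Fin (n + 1) → ℝ, (∀ i, 0 < x i) →
      c * ∏ i, x i ≤ ‖MvPolynomial.eval (fun i => (x i : ℂ)) p‖)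
    (x : Fin n → ℝ) (hx : ∀ i, 0 < x i) :
    ((n : ℝ) / (n + 1)) ^ n * c * ∏ i, x i ≤
      ‖MvPolynomial.eval (fun i => (x i : ℂ)) ((MvPolynomial.finSuccEquiv ℂ n p).coeff 1)‖ := by
  set g := (MvPolynomial.finSuccEquiv ℂ n p).map (MvPolynomial.eval fun i => (x i : ℂ)) with hg
  have hco : MvPolynomial.eval (fun i => (x i : ℂ)) ((MvPolynomial.finSuccEquiv ℂ n p).coeff 1)
      = g.coeff 1 := by rw [hg, Polynomial.coeff_map]
  have hgc : ∀ t : ℝ, 0 < t → c * (∏ i, x i) * t ≤ ‖g.eval (t : ℂ)‖ := by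
    intro t ht
    rw [hg, eval_map_finSuccEquiv]
    have := hc (Fin.cons t x) (fun i => by refine Fin.cases ?_ (fun i => ?_) i <;> simp [ht, hx])
    rw [Fin.prod_univ_succ] at this
    simp only [Fin.cons_zero, Fin.cons_succ] at this
    have h2 : (fun i => ((Fin.cons t x : Fin (n + 1) → ℝ) i : ℂ))
        = Fin.cons (t : ℂ) (fun i => (x i : ℂ)) := by
      funext i
      refine Fin.cases ?_ (fun i => ?_) i <;> simp
    rw [h2] at this
    calc _ = c * (t * ∏ i, x i) := by ring
      _ ≤ _ := this
  rw [hco]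
  rcases n with _ | n
  · have h1 := hgc 1 one_pos
    have hdeg := map_finSuccEquiv_natDegree_le hp fun i => (x i : ℂ)
    rw [← hg] at hdeg
    have h0 : g.coeff 0 = 0 := by
      rw [hg, Polynomial.coeff_map]
      have h := hp.finSuccEquiv_coeff_isHomogeneous 0 1 rfl
      have h3 := h.coeff_eq_zero (d := 0) (by simp)
      rw [MvPolynomial.eq_C_of_isEmpty ((MvPolynomial.finSuccEquiv ℂ 0 p).coeff 0), h3]
      simp
    rw [Polynomial.eval_eq_sum_range' (n := 2) (by omega)] at h1
    simpa [Finset.sum_range_succ, h0] using h1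
  · have hrn : ∀ w : ℂ, g.eval w = 0 → w.im = 0 ∧ w.re < 0 :=
      fun w hw => hs.roots_neg hp (Nat.succ_pos n) x hx w hw
    have := le_norm_coeff_one g n (map_finSuccEquiv_card_roots hp hs _)
      (fun h => absurd (hrn 0 h).2 (by simp)) ?_ (c * ∏ i, x i) hgc
    · calc _ = ((n + 1 : ℝ) / (n + 2)) ^ (n + 1) * (c * ∏ i, x i) := by
            push_cast
            ring_nf
        _ ≤ _ := this
    · intro w hw
      obtain ⟨h1, h2⟩ := hrn w (Polynomial.isRoot_of_mem_roots hw)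
      have hw2 : w ≠ 0 := by rintro rfl; simp at h2
      refine ⟨by simp [Complex.inv_im, h1], ?_⟩
      rw [Complex.neg_re, Complex.inv_re, ← neg_div]
      exact div_pos (by linarith) (Complex.normSq_pos.2 hw2)

end Stable

/-- Gurvits' capacity inequality. -/
theorem IsHalfPlaneStable.le_norm_coeff {n : ℕ} (p : MvPolynomial (Fin n) ℂ)
    (hp : p.IsHomogeneous n) (hs : IsHalfPlaneStable p) (c : ℝ)
    (hc : ∀ x : Fin n → ℝ, (∀ i, 0 < x i) →
      c * ∏ i, x i ≤ ‖MvPolynomial.eval (fun i => (x i : ℂ)) p‖) :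
    (n.factorial : ℝ) / n ^ n * c ≤ ‖p.coeff (Finsupp.equivFunOnFinite.symm fun _ => 1)‖ := by
  induction n generalizing c with
  | zero =>
    have h := hc 0 (fun i => i.elim0)
    rw [MvPolynomial.eq_C_of_isEmpty p] at h
    have h2 : (Finsupp.equivFunOnFinite.symm fun _ => 1 : Fin 0 →₀ ℕ) = 0 := Subsingleton.elim _ _
    rw [h2]
    simpa using h
  | succ n ih =>
    have h := ih ((MvPolynomial.finSuccEquiv ℂ n p).coeff 1)
      (hp.finSuccEquiv_coeff_isHomogeneous 1 n (by omega)) (hs.coeff_one hp)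
      (((n : ℝ) / (n + 1)) ^ n * c) (hs.le_norm_eval_coeff_one hp c hc)
    rw [MvPolynomial.finSuccEquiv_coeff_coeff] at h
    have h2 : (Finsupp.cons 1 (Finsupp.equivFunOnFinite.symm fun _ => 1) : Fin (n + 1) →₀ ℕ)
        = Finsupp.equivFunOnFinite.symm fun _ => 1 := by
      ext i
      refine Fin.cases ?_ (fun i => ?_) i <;> simp
    rw [h2] at h
    refine le_trans (le_of_eq ?_) h
    rcases n with _ | n
    · simp
    · rw [Nat.factorial_succ]
      push_cast
      rw [div_pow]
      have h3 : ((n : ℝ) + 1) ≠ 0 := by positivity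
      have h4 : ((n : ℝ) + 1 + 1) ≠ 0 := by positivity
      field_simp
      ring

/-! ### A lower bound for permanents -/

theorem coeff_prod_linear {N : ℕ} (A : Fin N → Fin N → ℂ) :
    (∏ i, ∑ j, MvPolynomial.C (A i j) * MvPolynomial.X j).coeff
      (Finsupp.equivFunOnFinite.symm fun _ => 1) = ∑ σ : Equiv.Perm (Fin N), ∏ i, A i (σ i) := by
  classical
  have h1 : (∏ i, ∑ j, MvPolynomial.C (A i j) * MvPolynomial.X j : MvPolynomial (Fin N) ℂ)
      = ∑ f : Fin N → Fin N, MvPolynomial.monomial (∑ i, Finsupp.single (f i) 1)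
          (∏ i, A i (f i)) := by
    rw [Finset.prod_univ_sum, Fintype.piFinset_univ]
    refine Finset.sum_congr rfl fun f _ => ?_
    rw [Finset.prod_mul_distrib, ← map_prod]
    simp only [MvPolynomial.X]
    rw [← MvPolynomial.monomial_sum_one, MvPolynomial.C_mul_monomial, mul_one]
  rw [h1, MvPolynomial.coeff_sum]
  simp_rw [MvPolynomial.coeff_monomial]
  rw [← Finset.sum_filter]
  symm
  refine Finset.sum_bij (fun σ _ => (σ : Fin N → Fin N)) ?_ ?_ ?_ ?_
  · intro σ _
    simp only [Finset.mem_filter, Finset.mem_univ, true_and]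
    ext j
    simp only [Finsupp.coe_finsetSum, Finset.sum_apply, Finsupp.single_apply]
    simp [← Equiv.eq_symm_apply]
  · intro σ _ τ _ h
    exact DFunLike.coe_injective h
  · intro f hf
    simp only [Finset.mem_filter, Finset.mem_univ, true_and] at hf
    have hsurj : Function.Surjective f := by
      intro j
      by_contra hcon
      push Not at hcon
      have := DFunLike.congr_fun hf j
      simp [hcon] at this
    exact ⟨Equiv.ofBijective f (Finite.surjective_iff_bijective.1 hsurj), by simp, rfl⟩
  · intro σ _
    rfl

theorem isHalfPlaneStable_prod_linear {N : ℕ} (A : Fin N → Fin N → ℝ) (hA : ∀ i j, 0 < A i j) :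
    IsHalfPlaneStable (∏ i, ∑ j, MvPolynomial.C (A i j : ℂ) * MvPolynomial.X j) := by
  intro z hz hz'
  rw [map_prod, Finset.prod_ne_zero_iff]
  intro i _ h
  obtain ⟨j, hj⟩ : ∃ j, 0 < (z j).re := hz'.resolve_left (fun h => by subst h; exact i.elim0)
  have h2 : (∑ j, A i j * (z j).re) = 0 := by
    have := congrArg Complex.re h
    simpa [map_sum] using this
  have h3 : 0 < ∑ j, A i j * (z j).re :=
    Finset.sum_pos' (fun k _ => mul_nonneg (hA i k).le (hz k)) ⟨j, by simp, mul_pos (hA i j) hj⟩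
  linarith

/-- The average over permutations of the products of a positive matrix is bounded below by the
exponential of minus a relative entropy. -/
theorem exp_neg_entropy_le_perm_average {N : ℕ} (M W : Fin N → Fin N → ℝ)
    (hM : ∀ i j, 0 < M i j) (hW : ∀ i j, 0 < W i j) (hrow : ∀ i, ∑ j, W i j = 1)
    (hcol : ∀ j, ∑ i, W i j = 1) :
    Real.exp (-∑ i, ∑ j, W i j * Real.log (N * W i j / M i j)) ≤
      (N.factorial : ℝ)⁻¹ * ∑ σ : Equiv.Perm (Fin N), ∏ i, M i (σ i) := by
  rcases Nat.eq_zero_or_pos N with hN | hN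
  · subst hN
    simp
  have hN' : (0 : ℝ) < N := by exact_mod_cast hN
  set p : MvPolynomial (Fin N) ℂ := ∏ i, ∑ j, MvPolynomial.C (M i j : ℂ) * MvPolynomial.X j with hp
  have hhom : p.IsHomogeneous N := by
    have := MvPolynomial.IsHomogeneous.prod (Finset.univ : Finset (Fin N))
      (fun i => ∑ j, MvPolynomial.C (M i j : ℂ) * MvPolynomial.X j) (fun _ => 1)
      (fun i _ => MvPolynomial.IsHomogeneous.sum _ _ _
        (fun j _ => MvPolynomial.isHomogeneous_C_mul_X _ _))
    simpa using this
  set E := ∑ i, ∑ j, W i j * Real.log (N * W i j / M i j) with hE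
  have hcap : ∀ x : Fin N → ℝ, (∀ i, 0 < x i) →
      (N : ℝ) ^ N * Real.exp (-E) * ∏ i, x i ≤ ‖MvPolynomial.eval (fun i => (x i : ℂ)) p‖ := by
    intro x hx
    have h1 : MvPolynomial.eval (fun i => (x i : ℂ)) p = ((∏ i, ∑ j, M i j * x j : ℝ) : ℂ) := by
      rw [hp, map_prod]
      simp
    have h2 : ∀ i, 0 < ∑ j, M i j * x j := fun i =>
      Finset.sum_pos (fun j _ => mul_pos (hM i j) (hx j)) ⟨⟨0, hN⟩, by simp⟩
    rw [h1, Complex.norm_real, Real.norm_of_nonneg (Finset.prod_nonneg fun i _ => (h2 i).le)]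
    have h3 : ∀ i, Real.exp (∑ j, W i j * (Real.log (M i j * x j / W i j)))
        ≤ ∑ j, M i j * x j := by
      intro i
      rw [← Real.le_log_iff_exp_le (h2 i)]
      have hconc := strictConcaveOn_log_Ioi.concaveOn.le_map_sum (t := Finset.univ)
        (w := fun j => W i j) (p := fun j => M i j * x j / W i j) (fun j _ => (hW i j).le)
        (by simpa using hrow i)
        (fun j _ => Set.mem_Ioi.2 (div_pos (mul_pos (hM i j) (hx j)) (hW i j)))
      simp only [smul_eq_mul] at hconc
      refine hconc.trans (le_of_eq ?_)
      congr 1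
      refine Finset.sum_congr rfl fun j _ => ?_
      have := (hW i j).ne'
      field_simp
    have h4 : (N : ℝ) ^ N * Real.exp (-E) * ∏ i, x i
        = ∏ i, Real.exp (∑ j, W i j * (Real.log (M i j * x j / W i j))) := by
      have hlogs : ∀ i j, W i j * Real.log (M i j * x j / W i j)
          = W i j * Real.log N + W i j * Real.log (x j)
            - W i j * Real.log (N * W i j / M i j) := by
        intro i j
        have a1 := (hW i j).ne'
        have a2 := (hM i j).ne'
        have a3 := (hx j).ne'
        rw [Real.log_div (by positivity) a1, Real.log_mul a2 a3, Real.log_div (by positivity) a2,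
          Real.log_mul hN'.ne' a1]
        ring
      simp_rw [hlogs]
      rw [← Real.exp_sum]
      simp_rw [Finset.sum_sub_distrib, Finset.sum_add_distrib, ← Finset.sum_mul, hrow]
      rw [← hE]
      have h5 : ∑ i, ∑ j, W i j * Real.log (x j) = ∑ j, Real.log (x j) := by
        rw [Finset.sum_comm]
        simp_rw [← Finset.sum_mul, hcol, one_mul]
      rw [h5, sub_eq_add_neg, Real.exp_add, Real.exp_add]
      have h6 : Real.exp (∑ j, Real.log (x j)) = ∏ j, x j := by
        rw [Real.exp_sum]
        exact Finset.prod_congr rfl fun j _ => Real.exp_log (hx j)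
      have h7 : Real.exp ((∑ _i : Fin N, (1 : ℝ)) * Real.log (N : ℝ)) = (N : ℝ) ^ N := by
        simp only [mul_one, Finset.sum_const, Finset.card_univ, Fintype.card_fin, nsmul_eq_mul]
        rw [mul_comm, Real.exp_mul, Real.exp_log hN', Real.rpow_natCast]
      rw [h6, h7]
      ring
    rw [h4]
    exact Finset.prod_le_prod (fun i _ => (Real.exp_pos _).le) (fun i _ => h3 i)
  have hmain := (isHalfPlaneStable_prod_linear M hM).le_norm_coeff p hhom _ hcap
  rw [hp, coeff_prod_linear] at hmain
  have h8 : ∑ σ : Equiv.Perm (Fin N), ∏ i, ((M i (σ i) : ℝ) : ℂ)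
      = ((∑ σ : Equiv.Perm (Fin N), ∏ i, M i (σ i) : ℝ) : ℂ) := by push_cast; rfl
  rw [h8, Complex.norm_real, Real.norm_of_nonneg
    (Finset.sum_nonneg fun σ _ => Finset.prod_nonneg fun i _ => (hM _ _).le)] at hmain
  have h9 : (N.factorial : ℝ) / N ^ N * (N ^ N * Real.exp (-E))
      = N.factorial * Real.exp (-E) := by
    have : (N : ℝ) ^ N ≠ 0 := by positivity
    field_simp
  rw [h9] at hmain
  rw [le_inv_mul_iff₀ (by positivity)]
  exact hmain

/-! ### Finite product expectations and permutation averages -/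

noncomputable section

/-- Expectation of `Φ (z₁, …, z_N)` for independent `zᵢ` with weights `w`. -/
def iidExp {Z : Type*} [Fintype Z] (w : Z → ℝ) (N : ℕ) (Φ : (Fin N → Z) → ℝ) : ℝ :=
  ∑ z : Fin N → Z, (∏ i, w (z i)) * Φ z

/-- Expectation of `Φ (k, l)` for independent samples `k` and `l` of size `N`. -/
def pairExp {I J : Type*} [Fintype I] [Fintype J] (p : I → ℝ) (q : J → ℝ) (N : ℕ)
    (Φ : (Fin N → I) → (Fin N → J) → ℝ) : ℝ :=
  iidExp p N fun k => iidExp q N fun l => Φ k l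

/-- The average over permutations of `∏ᵢ M(kᵢ, l_{σ(i)})`. -/
def permAvg {I J : Type*} {N : ℕ} (M : I → J → ℝ) (k : Fin N → I) (l : Fin N → J) : ℝ :=
  (N.factorial : ℝ)⁻¹ * ∑ σ : Equiv.Perm (Fin N), ∏ i, M (k i) (l (σ i))

end

section IidExp

variable {Z Z' : Type*} [Fintype Z] [Fintype Z'] {w : Z → ℝ} {N : ℕ}

theorem iidExp_add (Φ Ψ : (Fin N → Z) → ℝ) :
    iidExp w N (fun z => Φ z + Ψ z) = iidExp w N Φ + iidExp w N Ψ := by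
  simp [iidExp, mul_add, Finset.sum_add_distrib]

theorem iidExp_sub (Φ Ψ : (Fin N → Z) → ℝ) :
    iidExp w N (fun z => Φ z - Ψ z) = iidExp w N Φ - iidExp w N Ψ := by
  simp [iidExp, mul_sub, Finset.sum_sub_distrib]

theorem iidExp_const_mul (c : ℝ) (Φ : (Fin N → Z) → ℝ) :
    iidExp w N (fun z => c * Φ z) = c * iidExp w N Φ := by
  simp only [iidExp, Finset.mul_sum]
  exact Finset.sum_congr rfl fun z _ => by ring

theorem iidExp_sum {A : Type*} (s : Finset A) (Φ : A → (Fin N → Z) → ℝ) :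
    iidExp w N (fun z => ∑ a ∈ s, Φ a z) = ∑ a ∈ s, iidExp w N (Φ a) := by
  simp only [iidExp, Finset.mul_sum]
  exact Finset.sum_comm

theorem iidExp_prod (F : Fin N → Z → ℝ) :
    iidExp w N (fun z => ∏ i, F i (z i)) = ∏ i, ∑ a, w a * F i a := by
  classical
  simp only [iidExp, ← Finset.prod_mul_distrib]
  rw [Finset.prod_univ_sum, Fintype.piFinset_univ]

theorem iidExp_const (hw : ∑ a, w a = 1) (c : ℝ) : iidExp w N (fun _ => c) = c := by
  have h := iidExp_prod (w := w) (N := N) (fun _ _ => 1)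
  simp only [mul_one, hw, Finset.prod_const_one] at h
  have h2 := iidExp_const_mul (w := w) (N := N) c (fun _ => 1)
  simp only [mul_one] at h2
  rw [h2, h, mul_one]

theorem iidExp_mono (hw : ∀ a, 0 ≤ w a) {Φ Ψ : (Fin N → Z) → ℝ}
    (h : ∀ z, (∀ i, w (z i) ≠ 0) → Φ z ≤ Ψ z) : iidExp w N Φ ≤ iidExp w N Ψ := by
  refine Finset.sum_le_sum fun z _ => ?_
  by_cases hz : ∀ i, w (z i) ≠ 0
  · exact mul_le_mul_of_nonneg_left (h z hz) (Finset.prod_nonneg fun _ _ => hw _)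
  · push Not at hz
    obtain ⟨i, hi⟩ := hz
    rw [Finset.prod_eq_zero (Finset.mem_univ i) hi]
    simp

theorem iidExp_nonneg (hw : ∀ a, 0 ≤ w a) {Φ : (Fin N → Z) → ℝ} (h : ∀ z, 0 ≤ Φ z) :
    0 ≤ iidExp w N Φ :=
  Finset.sum_nonneg fun z _ => mul_nonneg (Finset.prod_nonneg fun _ _ => hw _) (h z)

theorem iidExp_succ (Φ : (Fin (N + 1) → Z) → ℝ) :
    iidExp w (N + 1) Φ = ∑ a, w a * iidExp w N (fun z => Φ (Fin.cons a z)) := by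
  simp only [iidExp]
  rw [← (Fin.consEquiv fun _ => Z).sum_comp, Fintype.sum_prod_type]
  refine Finset.sum_congr rfl fun a _ => ?_
  rw [Finset.mul_sum]
  refine Finset.sum_congr rfl fun z _ => ?_
  rw [Fin.prod_univ_succ]
  simp [Fin.consEquiv, mul_assoc]

theorem iidExp_comp_perm (σ : Equiv.Perm (Fin N)) (Φ : (Fin N → Z) → ℝ) :
    iidExp w N (fun z => Φ (z ∘ σ)) = iidExp w N Φ := by
  simp only [iidExp]
  rw [← (Equiv.arrowCongr σ (Equiv.refl Z)).sum_comp]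
  refine Finset.sum_congr rfl fun z _ => ?_
  have h1 : (Equiv.arrowCongr σ (Equiv.refl Z)) z = z ∘ σ.symm := rfl
  rw [h1]
  congr 1
  · exact Equiv.prod_comp σ.symm fun i => w (z i)
  · congr 1
    funext i
    simp

theorem iidExp_map [DecidableEq Z'] (c : Z → Z') (Φ : (Fin N → Z') → ℝ) :
    iidExp w N (fun z => Φ (c ∘ z))
      = iidExp (fun z' => ∑ z with c z = z', w z) N Φ := by
  classical
  simp only [iidExp]
  have h : ∀ z' : Fin N → Z', (∏ i, ∑ z with c z = z' i, w z)
      = ∑ z : Fin N → Z with c ∘ z = z', ∏ i, w (z i) := by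
    intro z'
    rw [Finset.prod_univ_sum]
    refine Finset.sum_congr ?_ fun _ _ => rfl
    ext z
    simp [Fintype.mem_piFinset, funext_iff]
  simp_rw [h, Finset.sum_mul]
  rw [← Finset.sum_fiberwise Finset.univ (fun z : Fin N → Z => c ∘ z)]
  refine Finset.sum_congr rfl fun z' _ => Finset.sum_congr rfl fun z hz => ?_
  rw [(Finset.mem_filter.1 hz).2]

end IidExp

section PermAvg

variable {I J : Type*} [Fintype I] [Fintype J] {p : I → ℝ} {q : J → ℝ} {N : ℕ}

theorem pairExp_eq_iidExp (Φ : (Fin N → I) → (Fin N → J) → ℝ) :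
    pairExp p q N Φ = iidExp (fun z : I × J => p z.1 * q z.2) N
      (fun z => Φ (fun i => (z i).1) (fun i => (z i).2)) := by
  simp only [pairExp, iidExp]
  rw [← (Equiv.arrowProdEquivProdArrow (Fin N) (fun _ => I) (fun _ => J)).symm.sum_comp,
    Fintype.sum_prod_type]
  refine Finset.sum_congr rfl fun k _ => ?_
  rw [Finset.mul_sum]
  refine Finset.sum_congr rfl fun l _ => ?_
  simp [Finset.prod_mul_distrib, Equiv.arrowProdEquivProdArrow, mul_assoc]

theorem permAvg_comp_right {I J : Type*} {N : ℕ} (M : I → J → ℝ) (k : Fin N → I) (l : Fin N → J)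
    (τ : Equiv.Perm (Fin N)) : permAvg M k (l ∘ τ) = permAvg M k l := by
  simp only [permAvg]
  congr 1
  rw [← Equiv.sum_comp (Equiv.mulLeft τ) (fun σ : Equiv.Perm (Fin N) => ∏ i, M (k i) (l (σ i)))]
  rfl

/-- Averaging over permutations against a symmetric function amounts to a change of the pair law. -/
theorem pairExp_permAvg_mul (M : I → J → ℝ) (Ψ : (Fin N → I) → (Fin N → J) → ℝ)
    (hΨ : ∀ k l (σ : Equiv.Perm (Fin N)), Ψ k (l ∘ σ) = Ψ k l) :
    pairExp p q N (fun k l => permAvg M k l * Ψ k l) =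
      iidExp (fun z : I × J => p z.1 * q z.2 * M z.1 z.2) N
        (fun z => Ψ (fun i => (z i).1) (fun i => (z i).2)) := by
  have h0 : pairExp p q N (fun k l => (∏ i, M (k i) (l i)) * Ψ k l) =
      iidExp (fun z : I × J => p z.1 * q z.2 * M z.1 z.2) N
        (fun z => Ψ (fun i => (z i).1) (fun i => (z i).2)) := by
    rw [pairExp_eq_iidExp]
    simp only [iidExp]
    refine Finset.sum_congr rfl fun z _ => ?_
    rw [← mul_assoc, ← Finset.prod_mul_distrib]
  rw [← h0]
  have h1 : ∀ σ : Equiv.Perm (Fin N), pairExp p q N (fun k l => (∏ i, M (k i) (l (σ i))) * Ψ k l)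
      = pairExp p q N (fun k l => (∏ i, M (k i) (l i)) * Ψ k l) := by
    intro σ
    simp only [pairExp]
    congr 1
    funext k
    rw [← iidExp_comp_perm σ fun l => (∏ i, M (k i) (l i)) * Ψ k l]
    congr 1
    funext l
    rw [hΨ]
    rfl
  have h2 : pairExp p q N (fun k l => permAvg M k l * Ψ k l) = (N.factorial : ℝ)⁻¹ *
      ∑ σ : Equiv.Perm (Fin N), pairExp p q N (fun k l => (∏ i, M (k i) (l (σ i))) * Ψ k l) := by
    simp only [pairExp, permAvg]
    simp_rw [← iidExp_sum, ← iidExp_const_mul]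
    congr 1
    funext k
    congr 1
    funext l
    rw [mul_assoc, Finset.sum_mul]
  rw [h2, Finset.sum_congr rfl (fun σ _ => h1 σ), Finset.sum_const, Finset.card_univ,
    Fintype.card_perm, Fintype.card_fin, nsmul_eq_mul, ← mul_assoc, inv_mul_cancel₀, one_mul]
  exact_mod_cast Nat.factorial_ne_zero N

theorem pairExp_sub_sq_of_refinement {I' J' : Type*} [Fintype I'] [Fintype J'] [DecidableEq I']
    [DecidableEq J'] {p' : I' → ℝ} {q' : J' → ℝ} {M : I → J → ℝ} {M' : I' → J' → ℝ} (c : I → I')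
    (d : J → J') (hp : ∀ k', p' k' = ∑ k with c k = k', p k)
    (hq : ∀ l', q' l' = ∑ l with d l = l', q l)
    (hM : ∀ k' l', p' k' * q' l' * M' k' l'
      = ∑ k with c k = k', ∑ l with d l = l', p k * q l * M k l) :
    pairExp p q N (fun k l => (permAvg M k l - permAvg M' (c ∘ k) (d ∘ l)) ^ 2)
      = pairExp p q N (fun k l => permAvg M k l ^ 2)
        - pairExp p' q' N (fun k l => permAvg M' k l ^ 2) := by
  have hmap : ∀ (w : I × J → ℝ) (Φ : (Fin N → I' × J') → ℝ),
      iidExp w N (fun z => Φ ((Prod.map c d) ∘ z)) =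
      iidExp (fun z' : I' × J' => ∑ k with c k = z'.1, ∑ l with d l = z'.2, w (k, l)) N Φ := by
    intro w Φ
    rw [iidExp_map]
    congr 1
    funext z'
    rw [← Finset.sum_product']
    refine Finset.sum_congr ?_ fun _ _ => rfl
    ext z
    simp [Prod.ext_iff]
  have hcross : pairExp p q N (fun k l => permAvg M k l * permAvg M' (c ∘ k) (d ∘ l))
      = pairExp p' q' N (fun k l => permAvg M' k l ^ 2) := by
    simp_rw [pow_two]
    rw [pairExp_permAvg_mul M _ (fun k l σ => permAvg_comp_right M' (c ∘ k) (d ∘ l) σ),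
      pairExp_permAvg_mul M' _ (fun k l σ => permAvg_comp_right M' k l σ)]
    have := hmap (fun z : I × J => p z.1 * q z.2 * M z.1 z.2)
      (fun z => permAvg M' (fun i => (z i).1) (fun i => (z i).2))
    simp only [← hM] at this
    exact this
  have hsq : pairExp p q N (fun k l => permAvg M' (c ∘ k) (d ∘ l) ^ 2)
      = pairExp p' q' N (fun k l => permAvg M' k l ^ 2) := by
    rw [pairExp_eq_iidExp, pairExp_eq_iidExp]
    have := hmap (fun z : I × J => p z.1 * q z.2)
      (fun z => permAvg M' (fun i => (z i).1) (fun i => (z i).2) ^ 2)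
    have h2 : ∀ z' : I' × J', ∑ k with c k = z'.1, ∑ l with d l = z'.2, p k * q l
        = p' z'.1 * q' z'.2 := by
      intro z'
      rw [hp, hq, Finset.sum_mul_sum]
    simp only [h2] at this
    exact this
  have hexp : pairExp p q N (fun k l => (permAvg M k l - permAvg M' (c ∘ k) (d ∘ l)) ^ 2)
      = pairExp p q N (fun k l => permAvg M k l ^ 2)
        - 2 * pairExp p q N (fun k l => permAvg M k l * permAvg M' (c ∘ k) (d ∘ l))
        + pairExp p q N (fun k l => permAvg M' (c ∘ k) (d ∘ l) ^ 2) := by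
    simp only [pairExp]
    simp_rw [← iidExp_const_mul, ← iidExp_sub, ← iidExp_add]
    congr 1
    funext k
    congr 1
    funext l
    ring
  rw [hexp, hcross, hsq]
  ring

end PermAvg

/-! ### Complete homogeneous symmetric sums -/

noncomputable section

/-- The complete homogeneous symmetric polynomial of degree `n` evaluated at `a`. -/
def homogSum {R : Type*} [Fintype R] [DecidableEq R] (a : R → ℝ) (n : ℕ) : ℝ :=
  ∑ s : Sym R n, (s.1.map a).prod

end

section HomogSum

variable {R : Type*} [Fintype R] [DecidableEq R]

theorem homogSum_nonneg {a : R → ℝ} (ha : ∀ r, 0 ≤ a r) (n : ℕ) : 0 ≤ homogSum a n :=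
  Finset.sum_nonneg fun s _ => Multiset.prod_nonneg fun x hx => by
    obtain ⟨r, _, rfl⟩ := Multiset.mem_map.1 hx
    exact ha r

theorem homogSum_zero (a : R → ℝ) : homogSum a 0 = 1 := by
  simp only [homogSum, Finset.univ_unique, Finset.sum_singleton]
  have : (default : Sym R 0).1 = 0 := Multiset.card_eq_zero.1 (default : Sym R 0).2
  rw [this]
  simp

theorem homogSum_option_succ (a : Option R → ℝ) (n : ℕ) :
    homogSum a (n + 1) = a none * homogSum a n + homogSum (fun r => a (some r)) (n + 1) := by
  simp only [homogSum]
  rw [← (symOptionSuccEquiv (α := R) (n := n)).symm.sum_comp, Fintype.sum_sum_type, Finset.mul_sum]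
  congr 1
  · refine Finset.sum_congr rfl fun s _ => ?_
    have : ((symOptionSuccEquiv (α := R) (n := n)).symm (Sum.inl s)).1 = none ::ₘ s.1 := rfl
    rw [this]
    simp
  · refine Finset.sum_congr rfl fun s _ => ?_
    have : ((symOptionSuccEquiv (α := R) (n := n)).symm (Sum.inr s)).1 = s.1.map some := rfl
    rw [this, Multiset.map_map]
    rfl

theorem homogSum_option_one (a : R → ℝ) (n : ℕ) :
    homogSum (fun o : Option R => o.elim 1 a) n = ∑ m ∈ Finset.range (n + 1), homogSum a m := by
  induction n with
  | zero => simp [homogSum_zero]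
  | succ n ih =>
    rw [homogSum_option_succ, Finset.sum_range_succ, ih]
    simp

theorem homogSum_equiv {S : Type*} [Fintype S] [DecidableEq S] (e : R ≃ S) (a : S → ℝ) (n : ℕ) :
    homogSum (a ∘ e) n = homogSum a n := by
  simp only [homogSum]
  rw [← (Sym.equivCongr (n := n) e).sum_comp]
  refine Finset.sum_congr rfl fun s _ => ?_
  have : ((Sym.equivCongr (n := n) e) s).1 = s.1.map e := rfl
  rw [this, Multiset.map_map]

end HomogSum

theorem sum_homogSum_le {R : Type*} [Fintype R] [DecidableEq R] (a : R → ℝ)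
    (h0 : ∀ r, 0 ≤ a r) (h1 : ∀ r, a r < 1) (n : ℕ) :
    ∑ m ∈ Finset.range (n + 1), homogSum a m ≤ ∏ r, (1 - a r)⁻¹ := by
  classical
  have key := Fintype.induction_empty_option (P := fun R _ => ∀ (_ : DecidableEq R) (a : R → ℝ),
      (∀ r, 0 ≤ a r) → (∀ r, a r < 1) →
      ∑ m ∈ Finset.range (n + 1), homogSum a m ≤ ∏ r, (1 - a r)⁻¹) ?_ ?_ ?_ R
  · exact key _ a h0 h1
  · intro α β _ e ih _ a h0 h1
    · let _ : Fintype α := Fintype.ofEquiv β e.symm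
      have := ih (Classical.decEq α) (a ∘ e) (fun r => h0 _) (fun r => h1 _)
      rw [← e.prod_comp]
      simp_rw [homogSum_equiv] at this
      exact this
  · intro _ a _ _
    · rw [Finset.sum_range_succ', homogSum_zero]
      simp [homogSum]
  · intro α _ ih inst a h0 h1
    · let _ : DecidableEq α := Classical.decEq α
      obtain rfl : inst = Option.instDecidableEq := Subsingleton.elim _ _
      have := ih (Classical.decEq α) (fun r => a (some r)) (fun r => h0 _) (fun r => h1 _)
      rw [Fintype.prod_option]
      have hpos : 0 < 1 - a none := by linarith [h1 none]
      rw [← div_eq_inv_mul, le_div_iff₀ hpos]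
      refine le_trans ?_ this
      rw [Finset.sum_range_succ' _ n, Finset.sum_range_succ' _ n, homogSum_zero, homogSum_zero]
      simp_rw [homogSum_option_succ]
      rw [Finset.sum_add_distrib, ← Finset.mul_sum]
      have hle : ∑ m ∈ Finset.range n, homogSum a m
          ≤ ∑ m ∈ Finset.range n, homogSum a (m + 1) + 1 := by
        rw [← homogSum_zero a, ← Finset.sum_range_succ' (fun m => homogSum a m) n,
          Finset.sum_range_succ]
        linarith [homogSum_nonneg h0 n]
      have hS : ∑ m ∈ Finset.range n, homogSum a (m + 1)
          = a none * ∑ m ∈ Finset.range n, homogSum a m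
            + ∑ m ∈ Finset.range n, homogSum (fun r => a (some r)) (m + 1) := by
        simp_rw [homogSum_option_succ]
        rw [Finset.sum_add_distrib, ← Finset.mul_sum]
      have := mul_le_mul_of_nonneg_left hle (h0 none)
      nlinarith

/-! ### Counting permutations fixing a function -/

section Count

variable {R : Type*} [DecidableEq R] {N : ℕ}

theorem exists_perm_comp_eq (f g : Fin N → R)
    (h : Finset.univ.val.map f = Finset.univ.val.map g) : ∃ σ : Equiv.Perm (Fin N), g ∘ σ = f := by
  have hc : ∀ r, Nonempty ({i // f i = r} ≃ {i // g i = r}) := by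
    intro r
    rw [← Fintype.card_eq]
    have h2 := congrArg (Multiset.count r) h
    rw [Multiset.count_map, Multiset.count_map] at h2
    simp only [Fintype.card_subtype]
    simpa [Finset.card_def, eq_comm] using h2
  refine ⟨Equiv.ofFiberEquiv fun r => (hc r).some, ?_⟩
  funext i
  exact Equiv.ofFiberEquiv_map _ _

theorem sum_fixing_eq [Fintype R] (a : R → ℝ) :
    ∑ g : Fin N → R, ∑ σ : Equiv.Perm (Fin N), (if g ∘ σ = g then ∏ i, a (g i) else 0)
      = N.factorial * homogSum a N := by
  let ty : (Fin N → R) → Sym R N := fun g => ⟨Finset.univ.val.map g, by simp⟩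
  have hprod : ∀ g, ∏ i, a (g i) = ((ty g).1.map a).prod := by
    intro g
    simp only [ty, Multiset.map_map]
    rfl
  have hty : ∀ (g : Fin N → R) (σ : Equiv.Perm (Fin N)), ty (g ∘ σ) = ty g := by
    intro g σ
    apply Subtype.ext
    simp only [ty]
    rw [← Multiset.map_map]
    congr 1
    simp
  rw [← Finset.sum_fiberwise Finset.univ ty, homogSum, Finset.mul_sum]
  refine Finset.sum_congr rfl fun s _ => ?_
  obtain ⟨g₀, hg₀⟩ : ∃ g₀, ty g₀ = s := by
    obtain ⟨l, hl⟩ := Quot.exists_rep s.1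
    have hlen : l.length = N := by
      have := s.2
      rw [← hl] at this
      exact this
    subst hlen
    refine ⟨l.get, ?_⟩
    apply Subtype.ext
    simp only [ty]
    rw [Fin.univ_val_map, List.ofFn_get]
    exact hl
  have h1 : ∀ g ∈ Finset.univ.filter (fun g => ty g = s),
      ∑ σ : Equiv.Perm (Fin N), (if g ∘ σ = g then ∏ i, a (g i) else 0)
      = ∑ σ : Equiv.Perm (Fin N), (if g₀ ∘ σ = g then (s.1.map a).prod else 0) := by
    intro g hg
    have hg' : ty g = s := (Finset.mem_filter.1 hg).2
    obtain ⟨τ, hτ⟩ := exists_perm_comp_eq g g₀ (congrArg Subtype.val (hg'.trans hg₀.symm))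
    rw [← Equiv.sum_comp (Equiv.mulLeft τ)
      (fun σ : Equiv.Perm (Fin N) => if g₀ ∘ σ = g then (s.1.map a).prod else 0)]
    refine Finset.sum_congr rfl fun σ _ => ?_
    rw [hprod, hg', Equiv.coe_mulLeft, Equiv.Perm.coe_mul, ← Function.comp_assoc, hτ]
  rw [Finset.sum_congr rfl h1, Finset.sum_comm]
  have h2 : ∀ σ : Equiv.Perm (Fin N), ∑ g with ty g = s,
      (if g₀ ∘ σ = g then (s.1.map a).prod else 0) = (s.1.map a).prod := by
    intro σ
    rw [Finset.sum_ite_eq, if_pos]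
    simp [hty, hg₀]
  rw [Finset.sum_congr rfl fun σ _ => h2 σ]
  simp [Fintype.card_perm]

end Count

/-! ### Second moments of permutation averages -/

theorem pairExp_permAvg_sq {I J R : Type*} [Fintype I] [Fintype J] [Fintype R] [DecidableEq R]
    {p : I → ℝ} {q : J → ℝ} (hp : ∀ k, 0 ≤ p k) (M : I → J → ℝ) (a : R → ℝ) (u : R → I → ℝ)
    (hu : ∀ r s, ∑ k, u r k * u s k = if r = s then 1 else 0)
    (hM : ∀ k k', √(p k) * √(p k') * ∑ l, q l * (M k l * M k' l) = ∑ r, a r * (u r k * u r k'))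
    (N : ℕ) : pairExp p q N (fun k l => permAvg M k l ^ 2) = homogSum a N := by
  have hfac : (N.factorial : ℝ) ≠ 0 := by exact_mod_cast Nat.factorial_ne_zero N
  have h1 : ∀ σ τ : Equiv.Perm (Fin N), pairExp p q N
      (fun k l => (∏ i, M (k i) (l (σ i))) * ∏ i, M (k i) (l (τ i)))
      = ∑ g : Fin N → R, if g ∘ σ = g ∘ τ then ∏ i, a (g i) else 0 := by
    intro σ τ
    have e1 : ∀ k : Fin N → I, iidExp q N
        (fun l => (∏ i, M (k i) (l (σ i))) * ∏ i, M (k i) (l (τ i)))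
        = ∏ j, ∑ l, q l * (M (k (σ.symm j)) l * M (k (τ.symm j)) l) := by
      intro k
      rw [← iidExp_prod]
      congr 1
      funext l
      rw [Finset.prod_mul_distrib]
      congr 1
      · rw [← Equiv.prod_comp σ fun j => M (k (σ.symm j)) (l j)]; simp
      · rw [← Equiv.prod_comp τ fun j => M (k (τ.symm j)) (l j)]; simp
    have e2 : ∀ k : Fin N → I, (∏ i, p (k i)) *
        ∏ j, ∑ l, q l * (M (k (σ.symm j)) l * M (k (τ.symm j)) l)
        = ∑ g : Fin N → R, (∏ i, a (g i)) * ∏ i, u (g (σ i)) (k i) * u (g (τ i)) (k i) := by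
      intro k
      have e3 : (∏ i, p (k i)) = ∏ j, √(p (k (σ.symm j))) * √(p (k (τ.symm j))) := by
        rw [Finset.prod_mul_distrib, Equiv.prod_comp σ.symm fun i => √(p (k i)),
          Equiv.prod_comp τ.symm fun i => √(p (k i)), ← Finset.prod_mul_distrib]
        exact Finset.prod_congr rfl fun i _ => (Real.mul_self_sqrt (hp _)).symm
      rw [e3, ← Finset.prod_mul_distrib]
      simp_rw [hM]
      rw [Finset.prod_univ_sum, Fintype.piFinset_univ]
      refine Finset.sum_congr rfl fun g _ => ?_
      rw [Finset.prod_mul_distrib, Finset.prod_mul_distrib, Finset.prod_mul_distrib,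
        ← Equiv.prod_comp σ fun j => u (g j) (k (σ.symm j)),
        ← Equiv.prod_comp τ fun j => u (g j) (k (τ.symm j))]
      simp
    simp only [pairExp]
    simp_rw [e1]
    rw [iidExp, Finset.sum_congr rfl fun k _ => e2 k, Finset.sum_comm]
    refine Finset.sum_congr rfl fun g _ => ?_
    rw [← Finset.mul_sum]
    have e4 := Finset.prod_univ_sum (fun _ : Fin N => (Finset.univ : Finset I))
      (fun i k => u (g (σ i)) k * u (g (τ i)) k)
    rw [Fintype.piFinset_univ] at e4
    rw [← e4]
    simp_rw [hu]
    split_ifs with h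
    · rw [Finset.prod_eq_one (f := fun i => if g (σ i) = g (τ i) then (1 : ℝ) else 0), mul_one]
      intro i _
      exact if_pos (congrFun h i)
    · obtain ⟨i, hi⟩ : ∃ i, g (σ i) ≠ g (τ i) := by
        by_contra hcon
        push Not at hcon
        exact h (funext hcon)
      rw [Finset.prod_eq_zero (f := fun i => if g (σ i) = g (τ i) then (1 : ℝ) else 0)
        (Finset.mem_univ i) (if_neg hi), mul_zero]
  have h2 : pairExp p q N (fun k l => permAvg M k l ^ 2) = (N.factorial : ℝ)⁻¹ ^ 2 *
      ∑ τ : Equiv.Perm (Fin N), ∑ σ : Equiv.Perm (Fin N), pairExp p q N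
      (fun k l => (∏ i, M (k i) (l (σ i))) * ∏ i, M (k i) (l (τ i))) := by
    simp only [pairExp, permAvg]
    simp_rw [← iidExp_sum, ← iidExp_const_mul]
    congr 1
    funext k
    congr 1
    funext l
    rw [mul_pow, pow_two (∑ σ : Equiv.Perm (Fin N), _), Finset.sum_mul_sum, Finset.sum_comm]
  have h3 : ∀ τ : Equiv.Perm (Fin N), (∑ σ : Equiv.Perm (Fin N), pairExp p q N
      (fun k l => (∏ i, M (k i) (l (σ i))) * ∏ i, M (k i) (l (τ i)))) =
      N.factorial * homogSum a N := by
    intro τ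
    simp_rw [h1]
    rw [Finset.sum_comm, ← sum_fixing_eq, ← (Equiv.arrowCongr τ (Equiv.refl R)).sum_comp]
    refine Finset.sum_congr rfl fun g _ => ?_
    rw [← Equiv.sum_comp (Equiv.mulLeft τ)]
    refine Finset.sum_congr rfl fun σ _ => ?_
    have e5 : (Equiv.arrowCongr τ (Equiv.refl R)) g = g ∘ τ.symm := rfl
    have e8 : ∏ i, a ((g ∘ τ.symm) i) = ∏ i, a (g i) := Equiv.prod_comp τ.symm fun i => a (g i)
    rw [e5, e8]
    have e6 : (g ∘ τ.symm) ∘ ((Equiv.mulLeft τ) σ) = g ∘ σ := by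
      funext i
      simp
    have e7 : (g ∘ τ.symm) ∘ τ = g := by
      funext i
      simp
    rw [e6, e7]
  rw [h2, Finset.sum_congr rfl fun τ _ => h3 τ, Finset.sum_const, Finset.card_univ,
    Fintype.card_perm, Fintype.card_fin, nsmul_eq_mul]
  field_simp

/-! ### Kernels on finite spaces with unit marginals -/

/-- A positive kernel on a product of two finite probability spaces, with both marginals equal
to one. -/
structure BlockKernel (I J : Type*) [Fintype I] [Fintype J] where
  p : I → ℝ
  q : J → ℝ
  M : I → J → ℝ
  p_nonneg : ∀ k, 0 ≤ p k
  q_nonneg : ∀ l, 0 ≤ q l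
  sum_p : ∑ k, p k = 1
  sum_q : ∑ l, q l = 1
  M_pos : ∀ k l, 0 < M k l
  row : ∀ k, ∑ l, q l * M k l = 1
  col : ∀ l, ∑ k, p k * M k l = 1

theorem exists_orthonormal_expansion {I : Type*} [Fintype I] [DecidableEq I] (A : Matrix I I ℝ)
    (hA : A.IsHermitian) : ∃ (a : I → ℝ) (u : I → I → ℝ),
      (∀ r s, ∑ k, u r k * u s k = if r = s then 1 else 0) ∧
      ∀ k k', A k k' = ∑ r, a r * (u r k * u r k') := by
  refine ⟨hA.eigenvalues, fun r k => hA.eigenvectorBasis r k, fun r s => ?_, fun k k' => ?_⟩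
  · have := hA.eigenvectorBasis.inner_eq_ite r s
    rw [PiLp.inner_apply] at this
    simp only [RCLike.inner_apply, conj_trivial] at this
    rw [← this]
    exact Finset.sum_congr rfl fun k _ => mul_comm _ _
  · conv_lhs => rw [hA.spectral_theorem, Unitary.conjStarAlgAut_apply]
    rw [Matrix.mul_apply]
    refine Finset.sum_congr rfl fun r _ => ?_
    rw [Matrix.mul_diagonal]
    simp only [Matrix.IsHermitian.eigenvectorUnitary_apply, Matrix.star_apply,
      Function.comp, RCLike.ofReal_real_eq_id, id, star_trivial]
    ring

namespace BlockKernel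

universe u v

variable {I : Type u} {J : Type v} [Fintype I] [Fintype J] (B : BlockKernel I J)

/-- The centred kernel. -/
def ctr (k : I) (l : J) : ℝ := B.M k l - 1

/-- The squared Hilbert–Schmidt norm of the centred kernel. -/
noncomputable def hs : ℝ := ∑ k, ∑ l, B.p k * B.q l * B.ctr k l ^ 2

/-- The centred kernel has operator norm at most `s`. -/
def HasGap (s : ℝ) : Prop := ∀ (f : I → ℝ) (g : J → ℝ),
  (∑ k, ∑ l, B.p k * B.q l * B.ctr k l * (f k * g l)) ^ 2 ≤
    s ^ 2 * (∑ k, B.p k * f k ^ 2) * ∑ l, B.q l * g l ^ 2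

theorem row_ctr (k : I) : ∑ l, B.q l * B.ctr k l = 0 := by
  simp [ctr, mul_sub, Finset.sum_sub_distrib, B.row, B.sum_q]

theorem col_ctr (l : J) : ∑ k, B.p k * B.ctr k l = 0 := by
  simp [ctr, mul_sub, Finset.sum_sub_distrib, B.col, B.sum_p]

/-- The `m`-th chaos contribution to the second moment of the permutation average. -/
noncomputable def chaos (m : ℕ) : ℝ := pairExp B.p B.q m fun k l => permAvg B.ctr k l ^ 2

theorem pairExp_nonneg {N : ℕ} {Φ : (Fin N → I) → (Fin N → J) → ℝ} (h : ∀ k l, 0 ≤ Φ k l) :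
    0 ≤ pairExp B.p B.q N Φ :=
  iidExp_nonneg B.p_nonneg fun k => iidExp_nonneg B.q_nonneg fun l => h k l

theorem chaos_nonneg (m : ℕ) : 0 ≤ B.chaos m := B.pairExp_nonneg fun _ _ => sq_nonneg _

theorem exists_spectral {s : ℝ} (hgap : B.HasGap s) :
    ∃ (R : Type u) (_ : Fintype R) (_ : DecidableEq R) (a : R → ℝ) (u : R → I → ℝ),
      (∀ r, 0 ≤ a r) ∧ (∀ r, a r ≤ s ^ 2) ∧ ∑ r, a r = B.hs ∧
      (∀ r t, ∑ k, u r k * u t k = if r = t then 1 else 0) ∧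
      (∀ r, ∑ k, u r k * √(B.p k) = 0) ∧
      ∀ k k', √(B.p k) * √(B.p k') * ∑ l, B.q l * (B.ctr k l * B.ctr k' l)
        = ∑ r, a r * (u r k * u r k') := by
  classical
  set A : Matrix I I ℝ := Matrix.of fun k k' =>
    √(B.p k) * √(B.p k') * ∑ l, B.q l * (B.ctr k l * B.ctr k' l) with hAdef
  have hA : A.IsHermitian := by
    ext k k'
    simp only [hAdef, Matrix.conjTranspose_apply, Matrix.of_apply, star_trivial]
    rw [mul_comm (√(B.p k'))]
    congr 1
    exact Finset.sum_congr rfl fun l _ => by ring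
  obtain ⟨a, u, hu, hAu⟩ := exists_orthonormal_expansion A hA
  have hApp : ∀ k k', A k k'
      = √(B.p k) * √(B.p k') * ∑ l, B.q l * (B.ctr k l * B.ctr k' l) := fun k k' => rfl
  have heig : ∀ r k, ∑ k', A k k' * u r k' = a r * u r k := by
    intro r k
    simp_rw [hAu, Finset.sum_mul]
    rw [Finset.sum_comm]
    have : ∀ t, ∑ k', a t * (u t k * u t k') * u r k' = a t * u t k * if t = r then 1 else 0 := by
      intro t
      rw [← hu t r, Finset.mul_sum]
      exact Finset.sum_congr rfl fun k' _ => by ring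
    simp_rw [this]
    simp
  have hquad : ∀ r, a r = ∑ k, ∑ k', u r k * A k k' * u r k' := by
    intro r
    have : ∀ k, ∑ k', u r k * A k k' * u r k' = a r * (u r k * u r k) := by
      intro k
      have h := heig r k
      calc _ = u r k * ∑ k', A k k' * u r k' := by
            rw [Finset.mul_sum]; exact Finset.sum_congr rfl fun _ _ => by ring
        _ = _ := by rw [h]; ring
    simp_rw [this, ← Finset.mul_sum, hu]
    simp
  set v : I → J → ℝ := fun r l => ∑ k, u r k * √(B.p k) * B.ctr k l with hv
  have ha : ∀ r, a r = ∑ l, B.q l * v r l ^ 2 := by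
    intro r
    rw [hquad]
    simp_rw [hApp, hv, pow_two, Finset.sum_mul_sum, Finset.mul_sum, Finset.sum_mul]
    symm
    rw [Finset.sum_comm]
    refine Finset.sum_congr rfl fun k _ => ?_
    rw [Finset.sum_comm]
    exact Finset.sum_congr rfl fun k' _ => Finset.sum_congr rfl fun l _ => by ring
  have ha0 : ∀ r, 0 ≤ a r := fun r => by
    rw [ha]
    exact Finset.sum_nonneg fun l _ => mul_nonneg (B.q_nonneg l) (sq_nonneg _)
  have ha1 : ∀ r, a r ≤ s ^ 2 := by
    intro r
    have h := hgap (fun k => u r k / √(B.p k)) (v r)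
    have e1 : ∑ k, ∑ l, B.p k * B.q l * B.ctr k l * (u r k / √(B.p k) * v r l) = a r := by
      rw [ha, Finset.sum_comm]
      refine Finset.sum_congr rfl fun l _ => ?_
      have e3 : ∀ k, B.p k * B.q l * B.ctr k l * (u r k / √(B.p k) * v r l)
          = B.q l * v r l * (u r k * √(B.p k) * B.ctr k l) := by
        intro k
        calc _ = B.q l * v r l * (u r k * (B.p k / √(B.p k)) * B.ctr k l) := by ring
          _ = _ := by rw [Real.div_sqrt]
      simp_rw [e3]
      rw [← Finset.mul_sum, pow_two, ← mul_assoc]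
    have e2 : ∑ k, B.p k * (u r k / √(B.p k)) ^ 2 ≤ 1 := by
      have h1 : ∑ k, u r k * u r k = 1 := by rw [hu]; simp
      rw [← h1]
      refine Finset.sum_le_sum fun k _ => ?_
      rcases (B.p_nonneg k).eq_or_lt with hk | hk
      · rw [← hk, zero_mul]; exact mul_self_nonneg _
      · rw [div_pow, Real.sq_sqrt hk.le]
        field_simp
        rfl
    rw [e1, ← ha] at h
    have h2 : a r ^ 2 ≤ s ^ 2 * a r := by
      calc a r ^ 2 ≤ _ := h
        _ ≤ s ^ 2 * 1 * a r := by
          gcongr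
          exact ha0 r
        _ = _ := by ring
    rcases (ha0 r).eq_or_lt with hr | hr
    · rw [← hr]; positivity
    · rw [pow_two] at h2
      exact le_of_mul_le_mul_right h2 hr
  have hmean : ∀ r, a r ≠ 0 → ∑ k, u r k * √(B.p k) = 0 := by
    intro r hr
    have h1 : a r * ∑ k, u r k * √(B.p k) = 0 := by
      rw [Finset.mul_sum]
      simp_rw [← mul_assoc, ← heig, Finset.sum_mul]
      rw [Finset.sum_comm]
      refine Finset.sum_eq_zero fun k' _ => ?_
      have : ∀ k, A k k' * u r k' * √(B.p k) =
          (√(B.p k') * u r k') * ∑ l, B.q l * B.ctr k' l * (B.p k * B.ctr k l) := by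
        intro k
        rw [hApp]
        calc _ = (√(B.p k') * u r k') * ((√(B.p k) * √(B.p k)) *
              ∑ l, B.q l * (B.ctr k l * B.ctr k' l)) := by ring
          _ = _ := by
            rw [Real.mul_self_sqrt (B.p_nonneg k), Finset.mul_sum]
            congr 1
            exact Finset.sum_congr rfl fun l _ => by ring
      simp_rw [this]
      rw [← Finset.mul_sum, Finset.sum_comm]
      simp_rw [← Finset.mul_sum, B.col_ctr]
      simp
    exact (mul_eq_zero.1 h1).resolve_left hr
  have htrace : ∑ r, a r = B.hs := by
    have h1 : ∀ k, ∑ r, a r * (u r k * u r k) = ∑ l, B.p k * B.q l * B.ctr k l ^ 2 := by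
      intro k
      rw [← hAu, hApp, Real.mul_self_sqrt (B.p_nonneg k), Finset.mul_sum]
      exact Finset.sum_congr rfl fun l _ => by ring
    rw [hs, ← Finset.sum_congr rfl fun k _ => h1 k, Finset.sum_comm]
    simp_rw [← Finset.mul_sum, hu]
    simp
  have hsub : ∀ F : I → ℝ, (∀ r, a r = 0 → F r = 0) →
      ∑ r : {r // a r ≠ 0}, F r = ∑ r, F r := by
    intro F hF
    rw [← Finset.sum_subtype (Finset.univ.filter fun r => a r ≠ 0) (by simp) F, Finset.sum_filter]
    refine Finset.sum_congr rfl fun r _ => ?_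
    split_ifs with h
    · rfl
    · exact (hF r (not_not.1 h)).symm
  refine ⟨{r // a r ≠ 0}, inferInstance, inferInstance, fun r => a r, fun r => u r,
    fun r => ha0 _, fun r => ha1 _, ?_, fun r t => ?_, fun r => hmean _ r.2, fun k k' => ?_⟩
  · rw [hsub a fun r h => h, htrace]
  · rw [hu]
    simp [Subtype.ext_iff]
  · rw [hsub (fun r => a r * (u r k * u r k')) fun r h => by simp [h], ← hAu, hApp]

/-- The second moment of the permutation average is the sum of the chaos contributions. -/
theorem pairExp_sq_eq_sum_chaos {s : ℝ} (hgap : B.HasGap s) (N : ℕ) :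
    pairExp B.p B.q N (fun k l => permAvg B.M k l ^ 2)
      = ∑ m ∈ Finset.range (N + 1), B.chaos m := by
  obtain ⟨R, _, _, a, u, -, -, -, hu, hmean, hgram⟩ := B.exists_spectral hgap
  have h1 : ∀ m, B.chaos m = homogSum a m := fun m =>
    pairExp_permAvg_sq B.p_nonneg B.ctr a u hu hgram m
  simp_rw [h1]
  rw [← homogSum_option_one]
  refine pairExp_permAvg_sq B.p_nonneg B.M (fun o : Option R => o.elim 1 a)
    (fun o => o.elim (fun k => √(B.p k)) u) ?_ ?_ N
  · have hpp : ∑ k, √(B.p k) * √(B.p k) = 1 := by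
      simp_rw [fun k => Real.mul_self_sqrt (B.p_nonneg k), B.sum_p]
    rintro (_ | r) (_ | t)
    · simpa using hpp
    · simpa [mul_comm] using hmean t
    · simpa using hmean r
    · simpa using hu r t
  · intro k k'
    rw [Fintype.sum_option]
    simp only [Option.elim_none, Option.elim_some, one_mul]
    rw [← hgram]
    have h2 : ∑ l, B.q l * (B.M k l * B.M k' l)
        = 1 + ∑ l, B.q l * (B.ctr k l * B.ctr k' l) := by
      have e : ∀ l, B.q l * (B.ctr k l * B.ctr k' l) = B.q l * (B.M k l * B.M k' l)
          - B.q l * B.M k l - B.q l * B.M k' l + B.q l := fun l => by simp only [ctr]; ring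
      simp_rw [e]
      rw [Finset.sum_add_distrib, Finset.sum_sub_distrib, Finset.sum_sub_distrib, B.row, B.row,
        B.sum_q]
      ring
    rw [h2]
    ring

theorem sum_chaos_le {s : ℝ} (hgap : B.HasGap s) (hs0 : 0 ≤ s) (hs1 : s < 1) (N : ℕ) :
    ∑ m ∈ Finset.range (N + 1), B.chaos m ≤ Real.exp (B.hs / (1 - s ^ 2)) := by
  obtain ⟨R, _, _, a, u, ha0, ha1, htr, hu, -, hgram⟩ := B.exists_spectral hgap
  have h1 : ∀ m, B.chaos m = homogSum a m := fun m =>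
    pairExp_permAvg_sq B.p_nonneg B.ctr a u hu hgram m
  have hs2 : s ^ 2 < 1 := by nlinarith
  simp_rw [h1]
  refine (sum_homogSum_le a ha0 (fun r => (ha1 r).trans_lt hs2) N).trans ?_
  rw [← htr, Finset.sum_div, Real.exp_sum]
  refine Finset.prod_le_prod (fun r _ => inv_nonneg.2 (by linarith [ha1 r])) fun r _ => ?_
  have hpos : 0 < 1 - a r := by linarith [ha1 r]
  have h2 : (1 - a r)⁻¹ = a r / (1 - a r) + 1 := by field_simp; ring
  rw [h2]
  refine (Real.add_one_le_exp _).trans (Real.exp_le_exp.2 ?_)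
  exact div_le_div_of_nonneg_left (ha0 r) (by linarith) (by linarith [ha1 r])

end BlockKernel

/-- A block kernel refines another one along maps of the index sets if it averages to it. -/
structure BlockKernel.Refines {I J I' J' : Type*} [Fintype I] [Fintype J] [Fintype I']
    [Fintype J'] [DecidableEq I'] [DecidableEq J'] (B : BlockKernel I J) (B' : BlockKernel I' J')
    (c : I → I') (d : J → J') : Prop where
  p_eq : ∀ k', B'.p k' = ∑ k with c k = k', B.p k
  q_eq : ∀ l', B'.q l' = ∑ l with d l = l', B.q l
  M_eq : ∀ k' l', B'.p k' * B'.q l' * B'.M k' l'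
      = ∑ k with c k = k', ∑ l with d l = l', B.p k * B.q l * B.M k l

section Refines

variable {I J I' J' : Type*} [Fintype I] [Fintype J] [Fintype I'] [Fintype J'] [DecidableEq I']
  [DecidableEq J'] {B : BlockKernel I J} {B' : BlockKernel I' J'} {c : I → I'} {d : J → J'}

theorem BlockKernel.Refines.chaos_le (h : B.Refines B' c d) (m : ℕ) : B'.chaos m ≤ B.chaos m := by
  have h1 := pairExp_sub_sq_of_refinement (N := m) (M := B.ctr) (M' := B'.ctr) c d h.p_eq h.q_eq ?_
  · have h2 := B.pairExp_nonneg (N := m)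
      (Φ := fun k l => (permAvg B.ctr k l - permAvg B'.ctr (c ∘ k) (d ∘ l)) ^ 2)
      fun _ _ => sq_nonneg _
    rw [h1] at h2
    exact sub_nonneg.1 h2
  · intro k' l'
    simp only [BlockKernel.ctr, mul_sub, mul_one, Finset.sum_sub_distrib]
    rw [h.M_eq, h.p_eq, h.q_eq, Finset.sum_mul_sum]

theorem BlockKernel.Refines.pairExp_sub_sq (h : B.Refines B' c d) {s : ℝ} (hB : B.HasGap s)
    (hB' : B'.HasGap s) (N : ℕ) :
    pairExp B.p B.q N (fun k l => (permAvg B.M k l - permAvg B'.M (c ∘ k) (d ∘ l)) ^ 2)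
      = ∑ m ∈ Finset.range (N + 1), (B.chaos m - B'.chaos m) := by
  rw [pairExp_sub_sq_of_refinement c d h.p_eq h.q_eq h.M_eq, B.pairExp_sq_eq_sum_chaos hB,
    B'.pairExp_sq_eq_sum_chaos hB', Finset.sum_sub_distrib]

end Refines

/-! ### Empirical deviations -/

section Deviation

variable {Z : Type*} [Fintype Z] {w : Z → ℝ} {N : ℕ}

theorem iidExp_sum_apply (hw : ∑ a, w a = 1) (h : Z → ℝ) (h0 : ∑ a, w a * h a = 0) :
    iidExp w N (fun z => ∑ i, h (z i)) = 0 := by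
  induction N with
  | zero => simp [iidExp]
  | succ N ih =>
    rw [iidExp_succ]
    simp only [Fin.sum_univ_succ, Fin.cons_zero, Fin.cons_succ]
    simp_rw [iidExp_add, iidExp_const hw, ih, add_zero, h0]

theorem iidExp_sum_sq (hw : ∑ a, w a = 1) (h : Z → ℝ) (h0 : ∑ a, w a * h a = 0) :
    iidExp w N (fun z => (∑ i, h (z i)) ^ 2) = N * ∑ a, w a * h a ^ 2 := by
  induction N with
  | zero => simp [iidExp]
  | succ N ih =>
    rw [iidExp_succ]
    simp only [Fin.sum_univ_succ, Fin.cons_zero, Fin.cons_succ, add_sq]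
    simp_rw [iidExp_add, iidExp_const hw, ih, iidExp_const_mul, iidExp_sum_apply hw h h0,
      mul_zero, add_zero, mul_add, Finset.sum_add_distrib, ← Finset.sum_mul, hw]
    push_cast
    ring

variable [DecidableEq Z]

/-- The relative deviation of the empirical frequency of `a` in the sample `z` from `w a`. -/
noncomputable def relDev (w : Z → ℝ) (z : Fin N → Z) (a : Z) : ℝ :=
  (N : ℝ)⁻¹ * ∑ i, ((if z i = a then 1 else 0) - w a) / w a

theorem sum_relDev_mul (hN : 0 < N) (z : Fin N → Z) (hz : ∀ i, w (z i) ≠ 0)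
    (F : Z → ℝ) :
    ∑ a, w a * relDev w z a * F a = (N : ℝ)⁻¹ * ∑ i, F (z i) - ∑ a, w a * F a := by
  have hN' : (N : ℝ) ≠ 0 := by positivity
  have h1 : ∀ a, w a * relDev w z a * F a
      = (N : ℝ)⁻¹ * ∑ i, ((if z i = a then F a else 0) - w a * F a) := by
    intro a
    rw [relDev, mul_left_comm, mul_assoc, Finset.mul_sum, Finset.sum_mul]
    congr 1
    refine Finset.sum_congr rfl fun i _ => ?_
    by_cases ha : w a = 0
    · have : z i ≠ a := fun h => hz i (h ▸ ha)
      simp [ha, this]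
    · rw [mul_div_cancel₀ _ ha]
      split_ifs <;> ring
  simp_rw [h1, ← Finset.mul_sum]
  rw [Finset.sum_comm]
  simp only [Finset.sum_sub_distrib, Finset.sum_ite_eq, Finset.mem_univ, if_true,
    Finset.sum_const, Finset.card_univ, Fintype.card_fin, nsmul_eq_mul]
  field_simp

theorem sum_relDev (hw : ∑ a, w a = 1) (hN : 0 < N) (z : Fin N → Z) (hz : ∀ i, w (z i) ≠ 0) :
    ∑ a, w a * relDev w z a = 0 := by
  have hN' : (N : ℝ) ≠ 0 := by positivity
  have := sum_relDev_mul hN z hz fun _ => 1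
  simpa [hw, hN'] using this

theorem sum_one_add_relDev_mul (hN : 0 < N) (z : Fin N → Z)
    (hz : ∀ i, w (z i) ≠ 0) (F : Z → ℝ) :
    ∑ a, w a * (1 + relDev w z a) * F a = (N : ℝ)⁻¹ * ∑ i, F (z i) := by
  have := sum_relDev_mul hN z hz F
  simp only [mul_add, add_mul, Finset.sum_add_distrib, mul_one]
  rw [this]
  ring

theorem iidExp_relDev_sq_le (hw0 : ∀ a, 0 ≤ w a) (hw : ∑ a, w a = 1) (hN : 0 < N) (a : Z) :
    iidExp w N (fun z => relDev w z a ^ 2) ≤ (N : ℝ)⁻¹ * (w a)⁻¹ := by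
  have hN' : (N : ℝ) ≠ 0 := by positivity
  simp only [relDev, mul_pow]
  rw [iidExp_const_mul]
  by_cases ha : w a = 0
  · simp [ha, iidExp]
  have hpos : 0 < w a := lt_of_le_of_ne (hw0 a) (Ne.symm ha)
  have hmean : ∑ b, w b * (((if b = a then 1 else 0) - w a) / w a) = 0 := by
    simp_rw [mul_div_assoc', mul_sub]
    rw [← Finset.sum_div, Finset.sum_sub_distrib, ← Finset.sum_mul, hw]
    simp
  rw [iidExp_sum_sq hw (fun b => ((if b = a then 1 else 0) - w a) / w a) hmean]
  have hvar : ∑ b, w b * (((if b = a then 1 else 0) - w a) / w a) ^ 2 ≤ (w a)⁻¹ := by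
    have h1 : ∀ b, w b * (((if b = a then 1 else 0) - w a) / w a) ^ 2
        = ((if b = a then w b * (1 - 2 * w a) else 0) + w b * w a ^ 2) / w a ^ 2 := by
      intro b
      split_ifs <;> field_simp <;> ring
    simp_rw [h1]
    rw [← Finset.sum_div, Finset.sum_add_distrib, ← Finset.sum_mul, hw]
    simp only [Finset.sum_ite_eq', Finset.mem_univ, if_true]
    rw [div_le_iff₀ (by positivity)]
    have : (w a)⁻¹ * w a ^ 2 = w a := by field_simp
    rw [this]
    nlinarith [sq_nonneg (w a)]
  calc _ = (N : ℝ)⁻¹ * ∑ b, w b * (((if b = a then 1 else 0) - w a) / w a) ^ 2 := by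
        field_simp
    _ ≤ _ := by gcongr

end Deviation

theorem sum_abs_le_of_sum_sq_le {J : Type*} [Fintype J] {c : ℝ} (hc : 0 < c) (q ψ : J → ℝ) (hq : ∀ l, 0 ≤ q l)
    (hq1 : ∑ l, q l = 1) (h : ∑ l, q l * ψ l ^ 2 ≤ c ^ 2) : ∑ l, q l * |ψ l| ≤ c := by
  have h1 : 2 * c * ∑ l, q l * |ψ l| ≤ ∑ l, q l * (c ^ 2 + ψ l ^ 2) := by
    rw [Finset.mul_sum]
    refine Finset.sum_le_sum fun l _ => ?_
    have : 2 * c * |ψ l| ≤ c ^ 2 + ψ l ^ 2 := by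
      nlinarith [sq_nonneg (c - |ψ l|), sq_abs (ψ l)]
    nlinarith [mul_le_mul_of_nonneg_left this (hq l)]
  simp only [mul_add, Finset.sum_add_distrib, ← Finset.sum_mul, hq1] at h1
  nlinarith

namespace BlockKernel

variable {I J : Type*} [Fintype I] [Fintype J] (B : BlockKernel I J)

/-! ### Solving the marginal equations -/

/-- Integration of the second variable against the centred kernel. -/
noncomputable def opR (g : J → ℝ) (k : I) : ℝ := ∑ l, B.q l * B.ctr k l * g l

/-- Integration of the first variable against the centred kernel. -/
noncomputable def opL (f : I → ℝ) (l : J) : ℝ := ∑ k, B.p k * B.ctr k l * f k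

theorem sum_p_opR (g : J → ℝ) : ∑ k, B.p k * B.opR g k = 0 := by
  simp only [opR, Finset.mul_sum]
  rw [Finset.sum_comm]
  refine Finset.sum_eq_zero fun l _ => ?_
  have : ∀ k, B.p k * (B.q l * B.ctr k l * g l) = (B.p k * B.ctr k l) * (B.q l * g l) :=
    fun k => by ring
  simp_rw [this]
  rw [← Finset.sum_mul, B.col_ctr, zero_mul]

theorem sum_q_opL (f : I → ℝ) : ∑ l, B.q l * B.opL f l = 0 := by
  simp only [opL, Finset.mul_sum]
  rw [Finset.sum_comm]
  refine Finset.sum_eq_zero fun k _ => ?_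
  have : ∀ l, B.q l * (B.p k * B.ctr k l * f k) = (B.q l * B.ctr k l) * (B.p k * f k) :=
    fun l => by ring
  simp_rw [this]
  rw [← Finset.sum_mul, B.row_ctr, zero_mul]

theorem sum_p_mul_opR (f : I → ℝ) (g : J → ℝ) :
    ∑ k, B.p k * (f k * B.opR g k) = ∑ k, ∑ l, B.p k * B.q l * B.ctr k l * (f k * g l) := by
  refine Finset.sum_congr rfl fun k _ => ?_
  rw [opR, Finset.mul_sum, Finset.mul_sum]
  exact Finset.sum_congr rfl fun l _ => by ring

theorem sum_q_mul_opL (f : I → ℝ) (g : J → ℝ) :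
    ∑ l, B.q l * (g l * B.opL f l) = ∑ k, ∑ l, B.p k * B.q l * B.ctr k l * (f k * g l) := by
  rw [Finset.sum_comm]
  refine Finset.sum_congr rfl fun l _ => ?_
  rw [opL, Finset.mul_sum, Finset.mul_sum]
  exact Finset.sum_congr rfl fun k _ => by ring

theorem sum_sq_le_of_opR_opL {s : ℝ} (hgap : B.HasGap s) (hs0 : 0 ≤ s) (hs1 : s < 1)
    {φ α : I → ℝ} {ψ β : J → ℝ} (hφ : ∀ k, φ k + B.opR ψ k = α k)
    (hψ : ∀ l, ψ l + B.opL φ l = β l) :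
    (∑ k, B.p k * φ k ^ 2) + ∑ l, B.q l * ψ l ^ 2 ≤
      ((∑ k, B.p k * α k ^ 2) + ∑ l, B.q l * β l ^ 2) / (1 - s) ^ 2 := by
  set S := ∑ k, ∑ l, B.p k * B.q l * B.ctr k l * (φ k * ψ l) with hS
  set a := ∑ k, B.p k * φ k ^ 2 with ha
  set b := ∑ l, B.q l * ψ l ^ 2 with hb
  have ha0 : 0 ≤ a := Finset.sum_nonneg fun k _ => mul_nonneg (B.p_nonneg k) (sq_nonneg _)
  have hb0 : 0 ≤ b := Finset.sum_nonneg fun k _ => mul_nonneg (B.q_nonneg k) (sq_nonneg _)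
  have hSle : -(s * (a + b)) ≤ 2 * S := by
    have h1 : S ^ 2 ≤ s ^ 2 * a * b := hgap φ ψ
    have h2 : (2 * S) ^ 2 ≤ (s * (a + b)) ^ 2 := by
      nlinarith [mul_nonneg (sq_nonneg s) (sq_nonneg (a - b))]
    exact (abs_le.1 (abs_le_of_sq_le_sq h2 (by positivity))).1
  have h1 : ∑ k, B.p k * (φ k * α k) = a + S := by
    rw [hS, ← B.sum_p_mul_opR, ha, ← Finset.sum_add_distrib]
    exact Finset.sum_congr rfl fun k _ => by rw [← hφ]; ring
  have h2 : ∑ l, B.q l * (ψ l * β l) = b + S := by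
    rw [hS, ← B.sum_q_mul_opL, hb, ← Finset.sum_add_distrib]
    exact Finset.sum_congr rfl fun k _ => by rw [← hψ]; ring
  set t := 1 - s with ht
  have ht0 : 0 < t := by linarith
  have young : ∀ x y : ℝ, 2 * t * (x * y) ≤ t ^ 2 * x ^ 2 + y ^ 2 := fun x y => by
    nlinarith [sq_nonneg (t * x - y)]
  have h3 : 2 * t * (∑ k, B.p k * (φ k * α k)) ≤ t ^ 2 * a + ∑ k, B.p k * α k ^ 2 := by
    rw [ha, Finset.mul_sum, Finset.mul_sum, ← Finset.sum_add_distrib]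
    refine Finset.sum_le_sum fun k _ => ?_
    have := mul_le_mul_of_nonneg_left (young (φ k) (α k)) (B.p_nonneg k)
    linarith
  have h4 : 2 * t * (∑ l, B.q l * (ψ l * β l)) ≤ t ^ 2 * b + ∑ l, B.q l * β l ^ 2 := by
    rw [hb, Finset.mul_sum, Finset.mul_sum, ← Finset.sum_add_distrib]
    refine Finset.sum_le_sum fun k _ => ?_
    have := mul_le_mul_of_nonneg_left (young (ψ k) (β k)) (B.q_nonneg k)
    linarith
  rw [le_div_iff₀ (by positivity)]
  rw [h1] at h3
  rw [h2] at h4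
  have h5 : t * (a + b) ≤ (a + b) + 2 * S := by rw [ht]; linarith
  nlinarith [mul_le_mul_of_nonneg_left h5 ht0.le]

theorem exists_opR_opL_eq {s : ℝ} (hgap : B.HasGap s) (hs0 : 0 ≤ s) (hs1 : s < 1)
    (α : I → ℝ) (β : J → ℝ) :
    ∃ (φ : I → ℝ) (ψ : J → ℝ), (∀ k, φ k + B.opR ψ k = α k) ∧ ∀ l, ψ l + B.opL φ l = β l := by
  let L : ((I → ℝ) × (J → ℝ)) →ₗ[ℝ] ((I → ℝ) × (J → ℝ)) :=
    { toFun := fun z => (fun k => z.1 k + B.opR z.2 k, fun l => z.2 l + B.opL z.1 l)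
      map_add' := by
        intro x y
        ext k
        · simp only [opR, Prod.fst_add, Prod.snd_add, Pi.add_apply, mul_add,
            Finset.sum_add_distrib]
          ring
        · simp only [opL, Prod.fst_add, Prod.snd_add, Pi.add_apply, mul_add,
            Finset.sum_add_distrib]
          ring
      map_smul' := by
        intro c x
        ext k
        · simp only [opR, Prod.smul_fst, Prod.smul_snd, Pi.smul_apply, smul_eq_mul,
            RingHom.id_apply, mul_add, Finset.mul_sum]
          congr 1
          exact Finset.sum_congr rfl fun l _ => by ring
        · simp only [opL, Prod.smul_fst, Prod.smul_snd, Pi.smul_apply, smul_eq_mul,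
            RingHom.id_apply, mul_add, Finset.mul_sum]
          congr 1
          exact Finset.sum_congr rfl fun l _ => by ring }
  have hinj : Function.Injective L := by
    rw [← LinearMap.ker_eq_bot, LinearMap.ker_eq_bot']
    rintro ⟨φ, ψ⟩ h
    have h1 : ∀ k, φ k + B.opR ψ k = 0 := fun k => congrFun (congrArg Prod.fst h) k
    have h2 : ∀ l, ψ l + B.opL φ l = 0 := fun l => congrFun (congrArg Prod.snd h) l
    have h3 := B.sum_sq_le_of_opR_opL hgap hs0 hs1 (α := fun _ => 0) (β := fun _ => 0) h1 h2
    simp only [ne_eq, OfNat.ofNat_ne_zero, not_false_eq_true, zero_pow, mul_zero,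
      Finset.sum_const_zero, add_zero, zero_div] at h3
    have ha0 : ∀ k, 0 ≤ B.p k * φ k ^ 2 := fun k => mul_nonneg (B.p_nonneg k) (sq_nonneg _)
    have hb0 : ∀ k, 0 ≤ B.q k * ψ k ^ 2 := fun k => mul_nonneg (B.q_nonneg k) (sq_nonneg _)
    have h4 : ∑ k, B.p k * φ k ^ 2 = 0 :=
      le_antisymm (by linarith [Finset.sum_nonneg fun l (_ : l ∈ Finset.univ) => hb0 l])
        (Finset.sum_nonneg fun k _ => ha0 k)
    have h5 : ∑ k, B.q k * ψ k ^ 2 = 0 :=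
      le_antisymm (by linarith [Finset.sum_nonneg fun l (_ : l ∈ Finset.univ) => ha0 l])
        (Finset.sum_nonneg fun k _ => hb0 k)
    rw [Finset.sum_eq_zero_iff_of_nonneg fun k _ => ha0 k] at h4
    rw [Finset.sum_eq_zero_iff_of_nonneg fun k _ => hb0 k] at h5
    ext k
    · have : B.opR ψ k = 0 := Finset.sum_eq_zero fun l _ => by
        rcases mul_eq_zero.1 (h5 l (Finset.mem_univ l)) with h | h
        · simp [h]
        · simp [pow_eq_zero_iff two_ne_zero |>.1 h]
      simpa [this] using h1 k
    · have : B.opL φ k = 0 := Finset.sum_eq_zero fun l _ => by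
        rcases mul_eq_zero.1 (h4 l (Finset.mem_univ l)) with h | h
        · simp [h]
        · simp [pow_eq_zero_iff two_ne_zero |>.1 h]
      simpa [this] using h2 k
  obtain ⟨⟨φ, ψ⟩, h⟩ := (LinearMap.injective_iff_surjective.1 hinj) (α, β)
  exact ⟨φ, ψ, fun k => congrFun (congrArg Prod.fst h) k,
    fun l => congrFun (congrArg Prod.snd h) l⟩

/-! ### The lower bound for permutation averages of block kernels -/

variable [DecidableEq I] [DecidableEq J]

/-- The random cost in the lower bound for the permutation average of a sample. -/
noncomputable def cost {N : ℕ} (s τ : ℝ) (k : Fin N → I) (l : Fin N → J) : ℝ :=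
  N * (|∑ a, ∑ b, B.p a * B.q b * B.ctr a b * (relDev B.p k a * relDev B.q l b)| +
    6 * (((∑ a, B.p a * B.opR (relDev B.q l) a ^ 2) + ∑ b, B.q b * B.opL (relDev B.p k) b ^ 2)
      / (1 - s) ^ 2 + τ ^ 2 * ∑ b, B.q b * relDev B.q l b ^ 2))

set_option maxHeartbeats 1000000 in
theorem exp_neg_cost_le {s : ℝ} (hgap : B.HasGap s) (hs0 : 0 ≤ s) (hs1 : s < 1) {K τ : ℝ}
    (hK : ∀ a b, |B.ctr a b| ≤ K) (hK0 : 0 < K) (hτ0 : 0 < τ) (hτ : τ ≤ 1 / 4)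
    (hτK : K * τ * (1 + 2 * K / (1 - s)) ≤ 1 / 16) {N : ℕ} (hN : 0 < N) (k : Fin N → I)
    (l : Fin N → J) (hk : ∀ i, B.p (k i) ≠ 0) (hl : ∀ i, B.q (l i) ≠ 0)
    (hx : ∀ a, |relDev B.p k a| ≤ τ) (hy : ∀ b, |relDev B.q l b| ≤ τ) :
    Real.exp (-B.cost s τ k l) ≤ permAvg B.M k l := by
  have hN' : (0 : ℝ) < N := by exact_mod_cast hN
  have ht0 : 0 < 1 - s := by linarith
  set x := relDev B.p k with hxdef
  set y := relDev B.q l with hydef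
  obtain ⟨φ, ψ, hφ, hψ⟩ := B.exists_opR_opL_eq hgap hs0 hs1 (B.opR y) (B.opL x)
  have hnorm := B.sum_sq_le_of_opR_opL hgap hs0 hs1 hφ hψ
  set n2 := (∑ a, B.p a * φ a ^ 2) + ∑ b, B.q b * ψ b ^ 2 with hn2
  have hpφ0 : 0 ≤ ∑ a, B.p a * φ a ^ 2 :=
    Finset.sum_nonneg fun k _ => mul_nonneg (B.p_nonneg k) (sq_nonneg _)
  have hqψ0 : 0 ≤ ∑ b, B.q b * ψ b ^ 2 :=
    Finset.sum_nonneg fun k _ => mul_nonneg (B.q_nonneg k) (sq_nonneg _)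
  have hxm : ∑ a, B.p a * x a = 0 := sum_relDev B.sum_p hN k hk
  have hym : ∑ b, B.q b * y b = 0 := sum_relDev B.sum_q hN l hl
  have hφm : ∑ a, B.p a * φ a = 0 := by
    have : ∀ a, B.p a * φ a = B.p a * B.opR y a - B.p a * B.opR ψ a := fun a => by
      rw [← hφ a]; ring
    simp_rw [this]
    rw [Finset.sum_sub_distrib, B.sum_p_opR, B.sum_p_opR, sub_zero]
  have hψm : ∑ b, B.q b * ψ b = 0 := by
    have : ∀ b, B.q b * ψ b = B.q b * B.opL x b - B.q b * B.opL φ b := fun a => by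
      rw [← hψ a]; ring
    simp_rw [this]
    rw [Finset.sum_sub_distrib, B.sum_q_opL, B.sum_q_opL, sub_zero]
  -- uniform bounds on the corrections
  have hopR : ∀ (g : J → ℝ) a, |B.opR g a| ≤ K * ∑ b, B.q b * |g b| := by
    intro g a
    rw [opR, Finset.mul_sum]
    refine (Finset.abs_sum_le_sum_abs _ _).trans (Finset.sum_le_sum fun b _ => ?_)
    rw [abs_mul, abs_mul, abs_of_nonneg (B.q_nonneg b)]
    have := mul_le_mul_of_nonneg_left (hK a b) (mul_nonneg (B.q_nonneg b) (abs_nonneg (g b)))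
    linarith
  have hopL : ∀ (f : I → ℝ) b, |B.opL f b| ≤ K * ∑ a, B.p a * |f a| := by
    intro g b
    rw [opL, Finset.mul_sum]
    refine (Finset.abs_sum_le_sum_abs _ _).trans (Finset.sum_le_sum fun a _ => ?_)
    rw [abs_mul, abs_mul, abs_of_nonneg (B.p_nonneg a)]
    have := mul_le_mul_of_nonneg_left (hK a b) (mul_nonneg (B.p_nonneg a) (abs_nonneg (g a)))
    linarith
  have hxs : ∑ a, B.p a * |x a| ≤ τ := by
    calc _ ≤ ∑ a, B.p a * τ :=
          Finset.sum_le_sum fun a _ => mul_le_mul_of_nonneg_left (hx a) (B.p_nonneg a)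
      _ = τ := by rw [← Finset.sum_mul, B.sum_p, one_mul]
  have hys : ∑ b, B.q b * |y b| ≤ τ := by
    calc _ ≤ ∑ b, B.q b * τ :=
          Finset.sum_le_sum fun a _ => mul_le_mul_of_nonneg_left (hy a) (B.q_nonneg a)
      _ = τ := by rw [← Finset.sum_mul, B.sum_q, one_mul]
  have hα : ∑ a, B.p a * B.opR y a ^ 2 ≤ (K * τ) ^ 2 := by
    calc _ ≤ ∑ a, B.p a * (K * τ) ^ 2 := Finset.sum_le_sum fun a _ => by
          refine mul_le_mul_of_nonneg_left ?_ (B.p_nonneg a)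
          exact sq_le_sq' (by linarith [(abs_le.1 ((hopR y a).trans
            (mul_le_mul_of_nonneg_left hys hK0.le))).1]) ((abs_le.1 ((hopR y a).trans
            (mul_le_mul_of_nonneg_left hys hK0.le))).2)
      _ = _ := by rw [← Finset.sum_mul, B.sum_p, one_mul]
  have hβ : ∑ b, B.q b * B.opL x b ^ 2 ≤ (K * τ) ^ 2 := by
    calc _ ≤ ∑ b, B.q b * (K * τ) ^ 2 := Finset.sum_le_sum fun a _ => by
          refine mul_le_mul_of_nonneg_left ?_ (B.q_nonneg a)
          exact sq_le_sq' (by linarith [(abs_le.1 ((hopL x a).trans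
            (mul_le_mul_of_nonneg_left hxs hK0.le))).1]) ((abs_le.1 ((hopL x a).trans
            (mul_le_mul_of_nonneg_left hxs hK0.le))).2)
      _ = _ := by rw [← Finset.sum_mul, B.sum_q, one_mul]
  have hn2c : n2 ≤ (2 * K * τ / (1 - s)) ^ 2 := by
    refine hnorm.trans ?_
    rw [div_pow]
    gcongr
    nlinarith [sq_nonneg (K * τ)]
  have hcpos : 0 < 2 * K * τ / (1 - s) := by positivity
  have hφs := sum_abs_le_of_sum_sq_le hcpos B.p φ B.p_nonneg B.sum_p (by linarith)
  have hψs := sum_abs_le_of_sum_sq_le hcpos B.q ψ B.q_nonneg B.sum_q (by linarith)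
  have hKeq : K * τ + K * (2 * K * τ / (1 - s)) = K * τ * (1 + 2 * K / (1 - s)) := by
    field_simp
  have hφb : ∀ a, |φ a| ≤ 1 / 16 := by
    intro a
    have h1 : φ a = B.opR y a - B.opR ψ a := by rw [← hφ a]; ring
    rw [h1]
    refine (abs_sub _ _).trans ?_
    have h2 := (hopR y a).trans (mul_le_mul_of_nonneg_left hys hK0.le)
    have h3 := (hopR ψ a).trans (mul_le_mul_of_nonneg_left hψs hK0.le)
    linarith
  have hψb : ∀ b, |ψ b| ≤ 1 / 16 := by
    intro a
    have h1 : ψ a = B.opL x a - B.opL φ a := by rw [← hψ a]; ring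
    rw [h1]
    refine (abs_sub _ _).trans ?_
    have h2 := (hopL x a).trans (mul_le_mul_of_nonneg_left hxs hK0.le)
    have h3 := (hopL φ a).trans (mul_le_mul_of_nonneg_left hφs hK0.le)
    linarith
  -- the doubly stochastic matrix
  set D : I → J → ℝ := fun a b => (1 + x a) * (1 + y b) with hD
  set E : I → J → ℝ := fun a b => φ a + ψ b + x a * y b with hE
  have hx1 : ∀ a, 3 / 4 ≤ 1 + x a := fun a => by linarith [(abs_le.1 (hx a)).1]
  have hy1 : ∀ b, 3 / 4 ≤ 1 + y b := fun b => by linarith [(abs_le.1 (hy b)).1]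
  have hD1 : ∀ a b, 1 / 2 ≤ D a b := fun a b => by
    have := mul_le_mul (hx1 a) (hy1 b) (by norm_num) (by linarith [hx1 a])
    simp only [hD]
    linarith
  have hDE : ∀ a b, D a b - E a b = 1 + (x a - φ a) + (y b - ψ b) := fun a b => by
    simp only [hD, hE]; ring
  have hDEpos : ∀ a b, 0 < D a b - E a b := fun a b => by
    rw [hDE]
    linarith [(abs_le.1 (hx a)).1, (abs_le.1 (hy b)).1, (abs_le.1 (hφb a)).2,
      (abs_le.1 (hψb b)).2]
  set W : Fin N → Fin N → ℝ := fun i j =>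
    (N : ℝ)⁻¹ * (B.M (k i) (l j) * (D (k i) (l j) - E (k i) (l j)) / D (k i) (l j)) with hW
  have hWpos : ∀ i j, 0 < W i j := fun i j => by
    have := B.M_pos (k i) (l j)
    have := hDEpos (k i) (l j)
    have : 0 < D (k i) (l j) := by linarith [hD1 (k i) (l j)]
    simp only [hW]
    positivity
  have hrow : ∀ i, ∑ j, W i j = 1 := by
    intro i
    simp only [hW]
    rw [← Finset.mul_sum, ← sum_one_add_relDev_mul hN l hl
      (fun b => B.M (k i) b * (D (k i) b - E (k i) b) / D (k i) b)]
    have hxi : 0 < 1 + x (k i) := by linarith [hx1 (k i)]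
    have h1 : ∀ b, B.q b * (1 + y b) * (B.M (k i) b * (D (k i) b - E (k i) b) / D (k i) b)
        = (B.q b * B.M (k i) b * (1 + (x (k i) - φ (k i))) +
            (B.q b * y b + B.q b * B.ctr (k i) b * y b - B.q b * ψ b
              - B.q b * B.ctr (k i) b * ψ b)) / (1 + x (k i)) := by
      intro b
      have hyb : 0 < 1 + y b := by linarith [hy1 b]
      rw [hDE]
      simp only [hD, ctr]
      field_simp
      ring
    rw [← hydef]
    simp_rw [h1]
    rw [← Finset.sum_div, Finset.sum_add_distrib, Finset.sum_sub_distrib, Finset.sum_sub_distrib,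
      Finset.sum_add_distrib, ← Finset.sum_mul, B.row, hym, hψm]
    have h2 := hφ (k i)
    simp only [opR] at h2
    rw [div_eq_one_iff_eq hxi.ne']
    linarith
  have hcol : ∀ j, ∑ i, W i j = 1 := by
    intro j
    simp only [hW]
    rw [← Finset.mul_sum, ← sum_one_add_relDev_mul hN k hk
      (fun a => B.M a (l j) * (D a (l j) - E a (l j)) / D a (l j))]
    have hyj : 0 < 1 + y (l j) := by linarith [hy1 (l j)]
    have h1 : ∀ a, B.p a * (1 + x a) * (B.M a (l j) * (D a (l j) - E a (l j)) / D a (l j))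
        = (B.p a * B.M a (l j) * (1 + (y (l j) - ψ (l j))) +
            (B.p a * x a + B.p a * B.ctr a (l j) * x a - B.p a * φ a
              - B.p a * B.ctr a (l j) * φ a)) / (1 + y (l j)) := by
      intro a
      have hxa : 0 < 1 + x a := by linarith [hx1 a]
      rw [hDE]
      simp only [hD, ctr]
      field_simp
      ring
    rw [← hxdef]
    simp_rw [h1]
    rw [← Finset.sum_div, Finset.sum_add_distrib, Finset.sum_sub_distrib, Finset.sum_sub_distrib,
      Finset.sum_add_distrib, ← Finset.sum_mul, B.col, hxm, hφm]
    have h2 := hψ (l j)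
    simp only [opL] at h2
    rw [div_eq_one_iff_eq hyj.ne']
    linarith
  refine le_trans (Real.exp_le_exp.2 (neg_le_neg ?_))
    (exp_neg_entropy_le_perm_average (fun i j => B.M (k i) (l j)) W (fun i j => B.M_pos _ _) hWpos
      hrow hcol)
  -- the entropy is at most the cost
  have hent : ∀ i j, W i j * Real.log (N * W i j / B.M (k i) (l j)) ≤
      (N : ℝ)⁻¹ * (B.M (k i) (l j) * (D (k i) (l j) - E (k i) (l j)) * (-E (k i) (l j))
        / D (k i) (l j) ^ 2) := by
    intro i j
    have hM := B.M_pos (k i) (l j)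
    have hDp : 0 < D (k i) (l j) := by linarith [hD1 (k i) (l j)]
    have hp := hDEpos (k i) (l j)
    have h1 : N * W i j / B.M (k i) (l j) = (D (k i) (l j) - E (k i) (l j)) / D (k i) (l j) := by
      simp only [hW]
      field_simp
    rw [h1]
    have h2 := Real.log_le_sub_one_of_pos (div_pos hp hDp)
    calc _ ≤ W i j * ((D (k i) (l j) - E (k i) (l j)) / D (k i) (l j) - 1) :=
          mul_le_mul_of_nonneg_left h2 (hWpos i j).le
      _ = _ := by
          simp only [hW]
          field_simp
          ring
  refine (Finset.sum_le_sum fun i _ => Finset.sum_le_sum fun j _ => hent i j).trans ?_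
  have hdouble : ∀ G : I → J → ℝ, ∑ i, ∑ j, (N : ℝ)⁻¹ * G (k i) (l j)
      = N * ∑ a, ∑ b, B.p a * (1 + x a) * (B.q b * (1 + y b) * G a b) := by
    intro G
    simp_rw [← Finset.mul_sum]
    have h1 : ∀ a, ∑ b, B.q b * (1 + y b) * G a b = (N : ℝ)⁻¹ * ∑ j, G a (l j) := fun a =>
      sum_one_add_relDev_mul hN l hl (G a)
    simp_rw [h1]
    rw [sum_one_add_relDev_mul hN k hk fun a => (N : ℝ)⁻¹ * ∑ j, G a (l j)]
    simp_rw [← Finset.mul_sum]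
    field_simp
  rw [hdouble fun a b => B.M a b * (D a b - E a b) * (-E a b) / D a b ^ 2, cost]
  refine mul_le_mul_of_nonneg_left ?_ hN'.le
  have hterm : ∀ a b, B.p a * (1 + x a) *
      (B.q b * (1 + y b) * (B.M a b * (D a b - E a b) * (-E a b) / D a b ^ 2)) ≤
      -(B.p a * φ a * (B.q b * B.M a b)) - B.q b * ψ b * (B.p a * B.M a b)
        - B.p a * x a * (B.q b * y b) - B.p a * B.q b * B.ctr a b * (x a * y b)
        + 6 * (B.p a * φ a ^ 2 * (B.q b * B.M a b) + B.q b * ψ b ^ 2 * (B.p a * B.M a b)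
        + τ ^ 2 * (B.q b * y b ^ 2 * (B.p a * B.M a b))) := by
    intro a b
    have hDp : 0 < D a b := by linarith [hD1 a b]
    have hm : 0 ≤ B.p a * B.q b * B.M a b :=
      mul_nonneg (mul_nonneg (B.p_nonneg a) (B.q_nonneg b)) (B.M_pos a b).le
    have h1 : B.p a * (1 + x a) *
        (B.q b * (1 + y b) * (B.M a b * (D a b - E a b) * (-E a b) / D a b ^ 2))
        = B.p a * B.q b * B.M a b * (-E a b + E a b ^ 2 / D a b) := by
      have : (1 + x a) * (1 + y b) = D a b := rfl
      calc _ = B.p a * B.q b * B.M a b * ((1 + x a) * (1 + y b)) *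
            ((D a b - E a b) * (-E a b) / D a b ^ 2) := by ring
        _ = _ := by
          rw [this]
          field_simp
          ring
    have h2 : E a b ^ 2 / D a b ≤ 6 * (φ a ^ 2 + ψ b ^ 2 + τ ^ 2 * y b ^ 2) := by
      rw [div_le_iff₀ hDp]
      have h3 : x a ^ 2 ≤ τ ^ 2 := sq_le_sq' (by linarith [(abs_le.1 (hx a)).1]) (abs_le.1 (hx a)).2
      have h4 : x a ^ 2 * y b ^ 2 ≤ τ ^ 2 * y b ^ 2 := mul_le_mul_of_nonneg_right h3 (sq_nonneg _)
      have h5 : E a b ^ 2 ≤ 3 * (φ a ^ 2 + ψ b ^ 2 + x a ^ 2 * y b ^ 2) := by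
        simp only [hE]
        nlinarith [sq_nonneg (φ a - ψ b), sq_nonneg (φ a - x a * y b), sq_nonneg (ψ b - x a * y b)]
      have h6 : 0 ≤ φ a ^ 2 + ψ b ^ 2 + τ ^ 2 * y b ^ 2 := by positivity
      nlinarith [mul_le_mul_of_nonneg_left (hD1 a b) h6]
    rw [h1]
    have h7 := mul_le_mul_of_nonneg_left h2 hm
    have h8 : B.M a b = B.ctr a b + 1 := by simp [ctr]
    calc _ = B.p a * B.q b * B.M a b * (-E a b) + B.p a * B.q b * B.M a b * (E a b ^ 2 / D a b) := by
          ring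
      _ ≤ B.p a * B.q b * B.M a b * (-E a b)
          + B.p a * B.q b * B.M a b * (6 * (φ a ^ 2 + ψ b ^ 2 + τ ^ 2 * y b ^ 2)) :=
          add_le_add le_rfl h7
      _ = _ := by
          simp only [hE]
          rw [h8]
          ring
  refine (Finset.sum_le_sum fun a _ => Finset.sum_le_sum fun b _ => hterm a b).trans ?_
  have hA : ∀ f : I → ℝ, ∑ a, ∑ b, B.p a * f a * (B.q b * B.M a b) = ∑ a, B.p a * f a := by
    intro f
    simp_rw [← Finset.mul_sum, B.row, mul_one]
  have hB : ∀ g : J → ℝ, ∑ a, ∑ b, B.q b * g b * (B.p a * B.M a b) = ∑ b, B.q b * g b := by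
    intro f
    rw [Finset.sum_comm]
    simp_rw [← Finset.mul_sum, B.col, mul_one]
  have hA2 := hA fun a => φ a ^ 2
  have hB2 := hB fun b => ψ b ^ 2
  have hB3 := hB fun b => y b ^ 2
  have hxy : ∑ a, ∑ b, B.p a * x a * (B.q b * y b) = 0 := by
    rw [← Finset.sum_mul_sum, hxm, zero_mul]
  have hsplit : ∑ a, ∑ b, (-(B.p a * φ a * (B.q b * B.M a b)) - B.q b * ψ b * (B.p a * B.M a b)
        - B.p a * x a * (B.q b * y b) - B.p a * B.q b * B.ctr a b * (x a * y b)
        + 6 * (B.p a * φ a ^ 2 * (B.q b * B.M a b) + B.q b * ψ b ^ 2 * (B.p a * B.M a b)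
        + τ ^ 2 * (B.q b * y b ^ 2 * (B.p a * B.M a b))))
      = -(∑ a, ∑ b, B.p a * φ a * (B.q b * B.M a b)) - ∑ a, ∑ b, B.q b * ψ b * (B.p a * B.M a b)
        - ∑ a, ∑ b, B.p a * x a * (B.q b * y b)
        - ∑ a, ∑ b, B.p a * B.q b * B.ctr a b * (x a * y b)
        + 6 * (∑ a, ∑ b, B.p a * φ a ^ 2 * (B.q b * B.M a b)
          + ∑ a, ∑ b, B.q b * ψ b ^ 2 * (B.p a * B.M a b)
          + τ ^ 2 * ∑ a, ∑ b, B.q b * y b ^ 2 * (B.p a * B.M a b)) := by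
    simp only [Finset.sum_add_distrib, Finset.sum_sub_distrib, Finset.sum_neg_distrib,
      Finset.mul_sum, mul_add]
  rw [hsplit, hA, hB, hA2, hB2, hB3, hxy, hφm, hψm]
  have habs := neg_abs_le (∑ a, ∑ b, B.p a * B.q b * B.ctr a b * (x a * y b))
  linarith

end BlockKernel

namespace BlockKernel

universe u v

variable {I : Type u} {J : Type v} [Fintype I] [Fintype J] (B : BlockKernel I J)

variable [DecidableEq I] [DecidableEq J]

theorem pairExp_cross_sq {N : ℕ} (hN : 0 < N) :
    pairExp B.p B.q N (fun k l => ((N : ℝ) *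
      ∑ a, ∑ b, B.p a * B.q b * B.ctr a b * (relDev B.p k a * relDev B.q l b)) ^ 2) = B.hs := by
  have hN' : (N : ℝ) ≠ 0 := by positivity
  have h1 : pairExp B.p B.q N (fun k l => ((N : ℝ) *
      ∑ a, ∑ b, B.p a * B.q b * B.ctr a b * (relDev B.p k a * relDev B.q l b)) ^ 2)
      = pairExp B.p B.q N (fun k l => ((N : ℝ)⁻¹ * ∑ j, ∑ i, B.ctr (k i) (l j)) ^ 2) := by
    simp only [pairExp]
    refine le_antisymm ?_ ?_ <;>
    · refine iidExp_mono B.p_nonneg fun k hk => iidExp_mono B.q_nonneg fun l hl => le_of_eq ?_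
      congr 1
      have e1 : ∀ a, ∑ b, B.p a * B.q b * B.ctr a b * (relDev B.p k a * relDev B.q l b)
          = B.p a * relDev B.p k a * ((N : ℝ)⁻¹ * ∑ j, B.ctr a (l j)) := by
        intro a
        have := sum_relDev_mul hN l hl (B.ctr a)
        rw [B.row_ctr, sub_zero] at this
        rw [← this, Finset.mul_sum]
        exact Finset.sum_congr rfl fun b _ => by ring
      simp_rw [e1]
      rw [sum_relDev_mul hN k hk fun a => (N : ℝ)⁻¹ * ∑ j, B.ctr a (l j)]
      have e2 : ∑ a, B.p a * ((N : ℝ)⁻¹ * ∑ j, B.ctr a (l j)) = 0 := by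
        simp only [Finset.mul_sum]
        rw [Finset.sum_comm]
        refine Finset.sum_eq_zero fun j _ => ?_
        have : ∀ a, B.p a * ((N : ℝ)⁻¹ * B.ctr a (l j)) = (N : ℝ)⁻¹ * (B.p a * B.ctr a (l j)) :=
          fun a => by ring
        simp_rw [this]
        rw [← Finset.mul_sum, B.col_ctr, mul_zero]
      rw [e2, sub_zero, ← Finset.mul_sum, ← mul_assoc, ← mul_assoc, mul_inv_cancel₀ hN', one_mul,
        Finset.sum_comm]
  rw [h1]
  simp only [pairExp, mul_pow, iidExp_const_mul]
  have h2 : ∀ k : Fin N → I, iidExp B.q N (fun l => (∑ j, ∑ i, B.ctr (k i) (l j)) ^ 2)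
      = N * ∑ b, B.q b * (∑ i, B.ctr (k i) b) ^ 2 := by
    intro k
    refine iidExp_sum_sq B.sum_q (fun b => ∑ i, B.ctr (k i) b) ?_
    simp only [Finset.mul_sum]
    rw [Finset.sum_comm]
    exact Finset.sum_eq_zero fun i _ => B.row_ctr _
  simp_rw [h2]
  rw [iidExp_const_mul, iidExp_sum]
  simp_rw [iidExp_const_mul]
  have h3 : ∀ b, iidExp B.p N (fun k => (∑ i, B.ctr (k i) b) ^ 2)
      = N * ∑ a, B.p a * B.ctr a b ^ 2 := fun b =>
    iidExp_sum_sq B.sum_p (fun a => B.ctr a b) (B.col_ctr b)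
  simp_rw [h3]
  have h4 : ∑ b, B.q b * (N * ∑ a, B.p a * B.ctr a b ^ 2) = N * B.hs := by
    rw [hs, Finset.sum_comm, Finset.mul_sum]
    refine Finset.sum_congr rfl fun b _ => ?_
    rw [mul_left_comm, Finset.mul_sum]
    congr 1
    exact Finset.sum_congr rfl fun a _ => by ring
  rw [h4]
  field_simp

theorem iidExp_opR_sq {N : ℕ} (hN : 0 < N) :
    iidExp B.q N (fun l => N * ∑ a, B.p a * B.opR (relDev B.q l) a ^ 2) = B.hs := by
  have hN' : (N : ℝ) ≠ 0 := by positivity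
  have h1 : iidExp B.q N (fun l => N * ∑ a, B.p a * B.opR (relDev B.q l) a ^ 2)
      = iidExp B.q N (fun l => N * ∑ a, B.p a * ((N : ℝ)⁻¹ * ∑ j, B.ctr a (l j)) ^ 2) := by
    refine le_antisymm ?_ ?_ <;>
    · refine iidExp_mono B.q_nonneg fun l hl => le_of_eq ?_
      congr 1
      refine Finset.sum_congr rfl fun a _ => ?_
      have := sum_relDev_mul hN l hl (B.ctr a)
      rw [B.row_ctr, sub_zero] at this
      rw [← this, opR]
      congr 2
      exact Finset.sum_congr rfl fun b _ => by ring
  rw [h1, iidExp_const_mul, iidExp_sum]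
  simp_rw [mul_pow, iidExp_const_mul]
  have h2 : ∀ a, iidExp B.q N (fun l => (∑ j, B.ctr a (l j)) ^ 2)
      = N * ∑ b, B.q b * B.ctr a b ^ 2 := fun a => iidExp_sum_sq B.sum_q _ (B.row_ctr a)
  simp_rw [h2]
  rw [hs, Finset.mul_sum]
  refine Finset.sum_congr rfl fun a _ => ?_
  have h3 : ∑ b, B.p a * B.q b * B.ctr a b ^ 2 = B.p a * ∑ b, B.q b * B.ctr a b ^ 2 := by
    rw [Finset.mul_sum]; exact Finset.sum_congr rfl fun b _ => by ring
  rw [h3]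
  field_simp

theorem iidExp_opL_sq {N : ℕ} (hN : 0 < N) :
    iidExp B.p N (fun k => N * ∑ b, B.q b * B.opL (relDev B.p k) b ^ 2) = B.hs := by
  have hN' : (N : ℝ) ≠ 0 := by positivity
  have h1 : iidExp B.p N (fun k => N * ∑ b, B.q b * B.opL (relDev B.p k) b ^ 2)
      = iidExp B.p N (fun k => N * ∑ b, B.q b * ((N : ℝ)⁻¹ * ∑ j, B.ctr (k j) b) ^ 2) := by
    refine le_antisymm ?_ ?_ <;>
    · refine iidExp_mono B.p_nonneg fun k hk => le_of_eq ?_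
      congr 1
      refine Finset.sum_congr rfl fun b _ => ?_
      have := sum_relDev_mul hN k hk fun a => B.ctr a b
      rw [B.col_ctr, sub_zero] at this
      rw [← this, opL]
      congr 2
      exact Finset.sum_congr rfl fun a _ => by ring
  rw [h1, iidExp_const_mul, iidExp_sum]
  simp_rw [mul_pow, iidExp_const_mul]
  have h2 : ∀ b, iidExp B.p N (fun k => (∑ j, B.ctr (k j) b) ^ 2)
      = N * ∑ a, B.p a * B.ctr a b ^ 2 := fun b =>
    iidExp_sum_sq B.sum_p (fun a => B.ctr a b) (B.col_ctr b)
  simp_rw [h2]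
  rw [hs, Finset.sum_comm, Finset.mul_sum]
  refine Finset.sum_congr rfl fun b _ => ?_
  have h3 : ∑ a, B.p a * B.q b * B.ctr a b ^ 2 = B.q b * ∑ a, B.p a * B.ctr a b ^ 2 := by
    rw [Finset.mul_sum]; exact Finset.sum_congr rfl fun b _ => by ring
  rw [h3]
  field_simp

theorem iidExp_sum_relDev_sq_le {N : ℕ} (hN : 0 < N) :
    iidExp B.q N (fun l => N * ∑ b, B.q b * relDev B.q l b ^ 2) ≤ Fintype.card J := by
  have hN' : (0 : ℝ) < N := by exact_mod_cast hN
  rw [iidExp_const_mul, iidExp_sum, Finset.mul_sum]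
  have h1 : ∀ b, (N : ℝ) * iidExp B.q N (fun l => B.q b * relDev B.q l b ^ 2) ≤ 1 := by
    intro b
    rw [iidExp_const_mul]
    rcases (B.q_nonneg b).eq_or_lt with hb | hb
    · simp [← hb]
    calc _ ≤ (N : ℝ) * (B.q b * ((N : ℝ)⁻¹ * (B.q b)⁻¹)) := by
          gcongr
          exact iidExp_relDev_sq_le B.q_nonneg B.sum_q hN b
      _ = 1 := by field_simp
  calc _ ≤ ∑ _b : J, (1 : ℝ) := Finset.sum_le_sum fun b _ => h1 b
    _ = _ := by simp

theorem cost_nonneg {N : ℕ} (s τ : ℝ) (k : Fin N → I) (l : Fin N → J) : 0 ≤ B.cost s τ k l := by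
  have h1 : 0 ≤ ∑ a, B.p a * B.opR (relDev B.q l) a ^ 2 :=
    Finset.sum_nonneg fun a _ => mul_nonneg (B.p_nonneg a) (sq_nonneg _)
  have h2 : 0 ≤ ∑ b, B.q b * B.opL (relDev B.p k) b ^ 2 :=
    Finset.sum_nonneg fun a _ => mul_nonneg (B.q_nonneg a) (sq_nonneg _)
  have h3 : 0 ≤ ∑ b, B.q b * relDev B.q l b ^ 2 :=
    Finset.sum_nonneg fun a _ => mul_nonneg (B.q_nonneg a) (sq_nonneg _)
  unfold cost
  positivity

theorem pairExp_cost_le {s τ : ℝ} (hs1 : s < 1) (hτ : τ ^ 2 * Fintype.card J ≤ 1)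
    {N : ℕ} (hN : 0 < N) :
    pairExp B.p B.q N (fun k l => B.cost s τ k l) ≤ 7 + B.hs + 12 * B.hs / (1 - s) ^ 2 := by
  have ht0 : 0 < 1 - s := by linarith
  set S : (Fin N → I) → (Fin N → J) → ℝ := fun k l => (N : ℝ) *
    ∑ a, ∑ b, B.p a * B.q b * B.ctr a b * (relDev B.p k a * relDev B.q l b) with hS
  set U : (Fin N → J) → ℝ := fun l => N * ∑ a, B.p a * B.opR (relDev B.q l) a ^ 2 with hU
  set V : (Fin N → I) → ℝ := fun k => N * ∑ b, B.q b * B.opL (relDev B.p k) b ^ 2 with hV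
  set Y : (Fin N → J) → ℝ := fun l => N * ∑ b, B.q b * relDev B.q l b ^ 2 with hY
  have h1 : ∀ k l, B.cost s τ k l ≤
      ((1 + S k l ^ 2) + 6 / (1 - s) ^ 2 * U l) + (6 / (1 - s) ^ 2 * V k + 6 * τ ^ 2 * Y l) := by
    intro k l
    have h2 : |S k l| ≤ 1 + S k l ^ 2 := by
      nlinarith [sq_abs (S k l), sq_nonneg (|S k l| - 1)]
    have h3 : B.cost s τ k l = |S k l| + 6 / (1 - s) ^ 2 * U l
        + (6 / (1 - s) ^ 2 * V k + 6 * τ ^ 2 * Y l) := by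
      simp only [cost, hS, hU, hV, hY, abs_mul, Nat.abs_cast]
      ring
    rw [h3]
    linarith
  have h4 : pairExp B.p B.q N (fun k l => B.cost s τ k l) ≤ pairExp B.p B.q N (fun k l =>
      ((1 + S k l ^ 2) + 6 / (1 - s) ^ 2 * U l) + (6 / (1 - s) ^ 2 * V k + 6 * τ ^ 2 * Y l)) :=
    iidExp_mono B.p_nonneg fun k _ => iidExp_mono B.q_nonneg fun l _ => h1 k l
  refine h4.trans ?_
  have hS2 : iidExp B.p N (fun k => iidExp B.q N fun l => S k l ^ 2) = B.hs :=
    B.pairExp_cross_sq hN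
  simp only [pairExp, iidExp_add, iidExp_const_mul, iidExp_const B.sum_q, iidExp_const B.sum_p]
  rw [hS2, B.iidExp_opR_sq hN, B.iidExp_opL_sq hN]
  have h5 : 6 * τ ^ 2 * iidExp B.q N Y ≤ 6 := by
    have := B.iidExp_sum_relDev_sq_le hN
    nlinarith [mul_le_mul_of_nonneg_left this (sq_nonneg τ)]
  have h6 : 12 * B.hs / (1 - s) ^ 2 = 6 / (1 - s) ^ 2 * B.hs + 6 / (1 - s) ^ 2 * B.hs := by ring
  rw [h6]
  linarith

/-- The permutation average of a block kernel is bounded below in probability, with bounds that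
depend only on the spectral gap and the Hilbert–Schmidt norm. -/
theorem exists_lower_tail_le {s : ℝ} (hgap : B.HasGap s) (hs0 : 0 ≤ s) (hs1 : s < 1) :
    ∃ C : ℝ, ∀ N : ℕ, 0 < N → ∀ δ : ℝ, 0 < δ → δ < 1 →
      pairExp B.p B.q N (fun k l => if permAvg B.M k l < δ then 1 else 0) ≤
        C / N + (7 + B.hs + 12 * B.hs / (1 - s) ^ 2) / Real.log δ⁻¹ := by
  have ht0 : 0 < 1 - s := by linarith
  set K : ℝ := 1 + ∑ a, ∑ b, |B.ctr a b| with hKdef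
  have hK : ∀ a b, |B.ctr a b| ≤ K := by
    intro a b
    have h1 : |B.ctr a b| ≤ ∑ b, |B.ctr a b| :=
      Finset.single_le_sum (f := fun b => |B.ctr a b|) (fun _ _ => abs_nonneg _) (Finset.mem_univ b)
    have h2 : ∑ b, |B.ctr a b| ≤ ∑ a, ∑ b, |B.ctr a b| :=
      Finset.single_le_sum (f := fun a => ∑ b, |B.ctr a b|)
        (fun _ _ => Finset.sum_nonneg fun _ _ => abs_nonneg _) (Finset.mem_univ a)
    linarith
  have hK0 : 0 < K := by
    have : 0 ≤ ∑ a, ∑ b, |B.ctr a b| :=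
      Finset.sum_nonneg fun _ _ => Finset.sum_nonneg fun _ _ => abs_nonneg _
    linarith
  obtain ⟨τ, hτ0, hτ1, hτ2, hτ3⟩ : ∃ τ : ℝ, 0 < τ ∧ τ ≤ 1 / 4 ∧
      K * τ * (1 + 2 * K / (1 - s)) ≤ 1 / 16 ∧ τ ^ 2 * Fintype.card J ≤ 1 := by
    set A : ℝ := K * (1 + 2 * K / (1 - s)) with hA
    have hA0 : 0 < A := by positivity
    refine ⟨1 / (4 + 16 * A + Fintype.card J), by positivity, ?_, ?_, ?_⟩
    · apply one_div_le_one_div_of_le <;> [norm_num; skip]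
      have : (0 : ℝ) ≤ Fintype.card J := by positivity
      linarith
    · have h1 : K * (1 / (4 + 16 * A + Fintype.card J)) * (1 + 2 * K / (1 - s))
          = A / (4 + 16 * A + Fintype.card J) := by rw [hA]; ring
      rw [h1, div_le_div_iff₀ (by positivity) (by norm_num)]
      have : (0 : ℝ) ≤ Fintype.card J := by positivity
      linarith
    · rw [div_pow, one_pow, one_div, inv_mul_le_iff₀ (by positivity)]
      have : (0 : ℝ) ≤ Fintype.card J := by positivity
      nlinarith
  refine ⟨(∑ a, (B.p a)⁻¹ + ∑ b, (B.q b)⁻¹) / τ ^ 2, fun N hN δ hδ0 hδ1 => ?_⟩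
  have hN' : (0 : ℝ) < N := by exact_mod_cast hN
  have hlog : 0 < Real.log δ⁻¹ := Real.log_pos ((one_lt_inv₀ hδ0).2 hδ1)
  set c := Real.log δ⁻¹ with hc
  have hpt : pairExp B.p B.q N (fun k l => if permAvg B.M k l < δ then 1 else 0) ≤
      pairExp B.p B.q N (fun k l => (τ ^ 2)⁻¹ * ∑ a, relDev B.p k a ^ 2
        + (τ ^ 2)⁻¹ * ∑ b, relDev B.q l b ^ 2 + c⁻¹ * B.cost s τ k l) := by
    refine iidExp_mono B.p_nonneg fun k hk => iidExp_mono B.q_nonneg fun l hl => ?_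
    have hcost := B.cost_nonneg s τ k l
    have hx0 : 0 ≤ ∑ a, relDev B.p k a ^ 2 := Finset.sum_nonneg fun _ _ => sq_nonneg _
    have hy0 : 0 ≤ ∑ a, relDev B.q l a ^ 2 := Finset.sum_nonneg fun _ _ => sq_nonneg _
    have hx1 : 0 ≤ (τ ^ 2)⁻¹ * ∑ a, relDev B.p k a ^ 2 := by positivity
    have hy1 : 0 ≤ (τ ^ 2)⁻¹ * ∑ a, relDev B.q l a ^ 2 := by positivity
    have hc1 : 0 ≤ c⁻¹ * B.cost s τ k l := by positivity
    beta_reduce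
    split_ifs with hlt
    swap
    · positivity
    by_cases hx : ∀ a, |relDev B.p k a| ≤ τ
    · by_cases hy : ∀ b, |relDev B.q l b| ≤ τ
      · have h := B.exp_neg_cost_le hgap hs0 hs1 hK hK0 hτ0 hτ1 hτ2 hN k l hk hl hx hy
        have h2 : Real.exp (-B.cost s τ k l) < Real.exp (-c) := by
          have : Real.exp (-c) = δ := by
            rw [hc, Real.log_inv, neg_neg, Real.exp_log hδ0]
          rw [this]
          exact h.trans_lt hlt
        have h3 : c < B.cost s τ k l := by
          have := Real.exp_lt_exp.1 h2
          linarith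
        have h4 : 1 ≤ c⁻¹ * B.cost s τ k l := by
          rw [le_inv_mul_iff₀ hlog]
          linarith
        linarith
      · push Not at hy
        obtain ⟨b, hb⟩ := hy
        have h1 : relDev B.q l b ^ 2 ≤ ∑ b, relDev B.q l b ^ 2 :=
          Finset.single_le_sum (f := fun b => relDev B.q l b ^ 2) (fun _ _ => sq_nonneg _)
            (Finset.mem_univ b)
        have h2 : τ ^ 2 ≤ relDev B.q l b ^ 2 := by
          rw [← sq_abs (relDev B.q l b)]
          gcongr
        have h4 : 1 ≤ (τ ^ 2)⁻¹ * ∑ b, relDev B.q l b ^ 2 := by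
          rw [le_inv_mul_iff₀ (by positivity)]
          linarith
        linarith
    · push Not at hx
      obtain ⟨b, hb⟩ := hx
      have h1 : relDev B.p k b ^ 2 ≤ ∑ b, relDev B.p k b ^ 2 :=
        Finset.single_le_sum (f := fun b => relDev B.p k b ^ 2) (fun _ _ => sq_nonneg _)
          (Finset.mem_univ b)
      have h2 : τ ^ 2 ≤ relDev B.p k b ^ 2 := by
        rw [← sq_abs (relDev B.p k b)]
        gcongr
      have h4 : 1 ≤ (τ ^ 2)⁻¹ * ∑ b, relDev B.p k b ^ 2 := by
        rw [le_inv_mul_iff₀ (by positivity)]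
        linarith
      linarith
  refine hpt.trans ?_
  have hcostE := B.pairExp_cost_le hs1 hτ3 hN
  simp only [pairExp, iidExp_add, iidExp_const_mul, iidExp_const B.sum_q, iidExp_const B.sum_p,
    iidExp_sum] at hcostE ⊢
  have h1 : ∑ a, iidExp B.p N (fun k => relDev B.p k a ^ 2) ≤ (N : ℝ)⁻¹ * ∑ a, (B.p a)⁻¹ := by
    rw [Finset.mul_sum]
    exact Finset.sum_le_sum fun a _ => iidExp_relDev_sq_le B.p_nonneg B.sum_p hN a
  have h2 : ∑ b, iidExp B.q N (fun l => relDev B.q l b ^ 2) ≤ (N : ℝ)⁻¹ * ∑ b, (B.q b)⁻¹ := by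
    rw [Finset.mul_sum]
    exact Finset.sum_le_sum fun a _ => iidExp_relDev_sq_le B.q_nonneg B.sum_q hN a
  calc _ ≤ (τ ^ 2)⁻¹ * ((N : ℝ)⁻¹ * ∑ a, (B.p a)⁻¹) + (τ ^ 2)⁻¹ * ((N : ℝ)⁻¹ * ∑ b, (B.q b)⁻¹)
        + c⁻¹ * (7 + B.hs + 12 * B.hs / (1 - s) ^ 2) := by gcongr
    _ = _ := by
      field_simp

end BlockKernel

/-! ### Square integrable coupling densities and their spectral gap -/

/-- A positive square integrable function which is the density of a coupling of `μ` and `ν` with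
respect to the product measure. -/
structure IsCouplingDensity {α β : Type*} [MeasurableSpace α] [MeasurableSpace β] (μ : Measure α)
    (ν : Measure β) (ξ : α × β → ℝ) : Prop where
  measurable : Measurable ξ
  pos : ∀ z, 0 < ξ z
  memLp : MemLp ξ 2 (μ.prod ν)
  left : ∀ f : α → ℝ, Measurable f → ∫ z, ξ z * f z.1 ∂(μ.prod ν) = ∫ x, f x ∂μ
  right : ∀ g : β → ℝ, Measurable g → ∫ z, ξ z * g z.2 ∂(μ.prod ν) = ∫ y, g y ∂ν

section Gap

variable {α β : Type*} [MeasurableSpace α] [MeasurableSpace β] {μ : Measure α} {ν : Measure β}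
  [IsProbabilityMeasure μ] [IsProbabilityMeasure ν] {ξ : α × β → ℝ}

theorem IsCouplingDensity.integrable (h : IsCouplingDensity μ ν ξ) : Integrable ξ (μ.prod ν) :=
  h.memLp.integrable (by norm_num)

theorem integrable_of_bounded {Ω : Type*} [MeasurableSpace Ω] {P : Measure Ω} [IsFiniteMeasure P]
    {f : Ω → ℝ} (hf : Measurable f) {C : ℝ} (hC : ∀ x, |f x| ≤ C) : Integrable f P :=
  Integrable.of_bound hf.aestronglyMeasurable C (ae_of_all _ hC)

theorem integrable_mul_of_bounded {Ω : Type*} [MeasurableSpace Ω] {P : Measure Ω} {g f : Ω → ℝ}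
    (hg : Integrable g P) (hf : Measurable f) {C : ℝ} (hC : ∀ x, |f x| ≤ C) :
    Integrable (fun x => g x * f x) P :=
  hg.mul_bdd hf.aestronglyMeasurable (ae_of_all _ hC)

theorem sq_integral_indicator_le {s : Set α} (hs : MeasurableSet s) {f : α → ℝ} (hf : Measurable f)
    {C : ℝ} (hC : ∀ x, |f x| ≤ C) (hμ : μ.real s ≤ 1 / 2) :
    2 * (∫ x, s.indicator f x ∂μ) ^ 2 ≤ ∫ x, s.indicator f x ^ 2 ∂μ := by
  set m := ∫ x, s.indicator f x ∂μ with hm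
  have hi : Measurable (s.indicator f) := hf.indicator hs
  have hC' : ∀ x, |s.indicator f x| ≤ C := fun x => by
    by_cases hx : x ∈ s
    · simp [hx, hC]
    · simpa [hx] using (abs_nonneg _).trans (hC x)
  have h1 : Integrable (s.indicator f) μ := integrable_of_bounded hi hC'
  have h2 : Integrable (fun x => s.indicator f x ^ 2) μ :=
    integrable_of_bounded (hi.pow_const 2) (C := C ^ 2) fun x => by
      rw [abs_pow]; exact pow_le_pow_left₀ (abs_nonneg _) (hC' x) 2
  have h3 : Integrable (s.indicator fun _ => (2 * m) ^ 2) μ := (integrable_const _).indicator hs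
  have h4 : 0 ≤ ∫ x, (s.indicator f x ^ 2 - 4 * m * s.indicator f x
      + s.indicator (fun _ => (2 * m) ^ 2) x) ∂μ := by
    refine integral_nonneg fun x => ?_
    by_cases hx : x ∈ s
    · simp only [hx, Set.indicator_of_mem, Pi.zero_apply]
      nlinarith [sq_nonneg (f x - 2 * m)]
    · simp [hx]
  have h5 : Integrable (fun x => s.indicator f x ^ 2 - 4 * m * s.indicator f x) μ :=
    h2.sub (h1.const_mul _)
  rw [integral_add h5 h3, integral_sub h2 (h1.const_mul _),
    integral_const_mul, integral_indicator_const _ hs, smul_eq_mul, ← hm] at h4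
  nlinarith [sq_nonneg m]

/-- Good sets on which the density is bounded below, up to a small remainder. -/
structure HasGoodSets (μ : Measure α) (ν : Measure β) (ξ : α × β → ℝ) (c : ℝ) : Prop where
  c_pos : 0 < c
  c_le : c ≤ 1
  exists_sets : ∃ (A : Set α) (B : Set β), MeasurableSet A ∧ MeasurableSet B ∧
    (∀ x ∈ A, ∀ y ∈ B, c ≤ ξ (x, y)) ∧ μ.real Aᶜ ≤ 1 / 2 ∧ ν.real Bᶜ ≤ 1 / 2 ∧
    ∫ z in (A ×ˢ B)ᶜ, ξ z ^ 2 ∂(μ.prod ν) ≤ 1 / 16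

set_option maxHeartbeats 1000000 in
theorem IsCouplingDensity.integral_mul_le (h : IsCouplingDensity μ ν ξ) {c : ℝ}
    (hc : HasGoodSets μ ν ξ c) {f : α → ℝ} {g : β → ℝ} (hf : Measurable f) (hg : Measurable g)
    {C : ℝ} (hfC : ∀ x, |f x| ≤ C) (hgC : ∀ x, |g x| ≤ C) (hf0 : ∫ x, f x ∂μ = 0)
    (hg0 : ∫ y, g y ∂ν = 0) :
    ∫ z, ξ z * (f z.1 * g z.2) ∂(μ.prod ν) ≤
      (1 / 2 - c / 16) * ((∫ x, f x ^ 2 ∂μ) + ∫ y, g y ^ 2 ∂ν) := by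
  obtain ⟨A, B, hA, hB, hAB, hμA, hνB, hbad⟩ := hc.exists_sets
  have hcpos := hc.c_pos
  have hcle := hc.c_le
  have sqb : ∀ {u : ℝ}, |u| ≤ C → |u ^ 2| ≤ C ^ 2 := fun hu => by
    rw [abs_pow]; exact pow_le_pow_left₀ (abs_nonneg _) hu 2
  have hindA : ∀ (s : Set α) x, |s.indicator f x| ≤ C := fun s x => by
    by_cases hx : x ∈ s
    · simp [hx, hfC]
    · simpa [hx] using (abs_nonneg _).trans (hfC x)
  have hindB : ∀ (s : Set β) x, |s.indicator g x| ≤ C := fun s x => by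
    by_cases hx : x ∈ s
    · simp [hx, hgC]
    · simpa [hx] using (abs_nonneg _).trans (hgC x)
  have mA : Measurable (A.indicator f) := hf.indicator hA
  have mB : Measurable (B.indicator g) := hg.indicator hB
  have mAc : Measurable (Aᶜ.indicator f) := hf.indicator hA.compl
  have mBc : Measurable (Bᶜ.indicator g) := hg.indicator hB.compl
  set FG := ∫ x, A.indicator f x ^ 2 ∂μ with hFG
  set FB := ∫ x, Aᶜ.indicator f x ^ 2 ∂μ with hFB
  set GG := ∫ x, B.indicator g x ^ 2 ∂ν with hGG
  set GB := ∫ x, Bᶜ.indicator g x ^ 2 ∂ν with hGB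
  set X := ∫ z, ξ z * (f z.1 * g z.2) ∂(μ.prod ν) with hX
  have hF : ∫ x, f x ^ 2 ∂μ = FG + FB := by
    rw [hFG, hFB, ← integral_add (integrable_of_bounded (mA.pow_const 2) fun x => sqb (hindA _ x))
      (integrable_of_bounded (mAc.pow_const 2) fun x => sqb (hindA _ x))]
    refine integral_congr_ae (ae_of_all _ fun x => ?_)
    by_cases hx : x ∈ A <;> simp [hx]
  have hG : ∫ x, g x ^ 2 ∂ν = GG + GB := by
    rw [hGG, hGB, ← integral_add (integrable_of_bounded (mB.pow_const 2) fun x => sqb (hindB _ x))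
      (integrable_of_bounded (mBc.pow_const 2) fun x => sqb (hindB _ x))]
    refine integral_congr_ae (ae_of_all _ fun x => ?_)
    by_cases hx : x ∈ B <;> simp [hx]
  have mean_f : ∫ x, A.indicator f x ∂μ = -∫ x, Aᶜ.indicator f x ∂μ := by
    rw [eq_neg_iff_add_eq_zero, ← integral_add (integrable_of_bounded mA (hindA _))
      (integrable_of_bounded mAc (hindA _)), ← hf0]
    exact integral_congr_ae (ae_of_all _ fun x => Set.indicator_self_add_compl_apply A f x)
  have mean_g : ∫ x, B.indicator g x ∂ν = -∫ x, Bᶜ.indicator g x ∂ν := by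
    rw [eq_neg_iff_add_eq_zero, ← integral_add (integrable_of_bounded mB (hindB _))
      (integrable_of_bounded mBc (hindB _)), ← hg0]
    exact integral_congr_ae (ae_of_all _ fun x => Set.indicator_self_add_compl_apply B g x)
  have iξ := h.integrable
  have m1 : Measurable fun z : α × β => z.1 := measurable_fst
  have m2 : Measurable fun z : α × β => z.2 := measurable_snd
  have C0 : 0 ≤ C := by
    obtain ⟨x⟩ : Nonempty α := nonempty_of_isProbabilityMeasure μ
    exact (abs_nonneg _).trans (hfC x)
  have iff2 : Integrable (fun z => ξ z * f z.1 ^ 2) (μ.prod ν) :=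
    integrable_mul_of_bounded iξ ((hf.comp m1).pow_const 2) fun z => sqb (hfC z.1)
  have igg2 : Integrable (fun z => ξ z * g z.2 ^ 2) (μ.prod ν) :=
    integrable_mul_of_bounded iξ ((hg.comp m2).pow_const 2) fun z => sqb (hgC z.2)
  have ifg : Integrable (fun z => ξ z * (f z.1 * g z.2)) (μ.prod ν) :=
    integrable_mul_of_bounded iξ ((hf.comp m1).mul (hg.comp m2)) (C := C * C) fun z => by
      rw [abs_mul]
      exact mul_le_mul (hfC _) (hgC _) (abs_nonneg _) C0
  have hFX : ∫ z, ξ z * f z.1 ^ 2 ∂(μ.prod ν) = FG + FB := by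
    rw [← hF]; exact h.left (fun x => f x ^ 2) (hf.pow_const 2)
  have hGX : ∫ z, ξ z * g z.2 ^ 2 ∂(μ.prod ν) = GG + GB := by
    rw [← hG]; exact h.right (fun x => g x ^ 2) (hg.pow_const 2)
  -- first estimate: the energy on the good set
  have est1 : c / 2 * ((FG + GG) - (FB + GB)) ≤ (FG + FB) + (GG + GB) - 2 * X := by
    have oneA : Measurable (A.indicator fun _ => (1 : ℝ)) := measurable_const.indicator hA
    have oneB : Measurable (B.indicator fun _ => (1 : ℝ)) := measurable_const.indicator hB
    have honeA : ∀ x, |A.indicator (fun _ => (1 : ℝ)) x| ≤ 1 :=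
      fun x => by by_cases hx : x ∈ A <;> simp [hx]
    have honeB : ∀ x, |B.indicator (fun _ => (1 : ℝ)) x| ≤ 1 :=
      fun x => by by_cases hx : x ∈ B <;> simp [hx]
    have i1 : Integrable (fun z : α × β =>
        A.indicator f z.1 ^ 2 * B.indicator (fun _ => (1 : ℝ)) z.2) (μ.prod ν) :=
      (integrable_of_bounded (mA.pow_const 2) fun x => sqb (hindA _ x)).mul_prod
        (integrable_of_bounded oneB honeB)
    have i2 : Integrable (fun z : α × β =>
        A.indicator (fun _ => (1 : ℝ)) z.1 * B.indicator g z.2 ^ 2) (μ.prod ν) :=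
      (integrable_of_bounded oneA honeA).mul_prod
        (integrable_of_bounded (mB.pow_const 2) fun x => sqb (hindB _ x))
    have i3 : Integrable (fun z : α × β => A.indicator f z.1 * B.indicator g z.2) (μ.prod ν) :=
      (integrable_of_bounded mA (hindA _)).mul_prod (integrable_of_bounded mB (hindB _))
    have hle : ∫ z : α × β, c * (A.indicator f z.1 ^ 2 * B.indicator (fun _ => (1 : ℝ)) z.2
        + A.indicator (fun _ => (1 : ℝ)) z.1 * B.indicator g z.2 ^ 2
        - 2 * (A.indicator f z.1 * B.indicator g z.2)) ∂(μ.prod ν) ≤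
        ∫ z, (ξ z * f z.1 ^ 2 + ξ z * g z.2 ^ 2 - 2 * (ξ z * (f z.1 * g z.2))) ∂(μ.prod ν) := by
      refine integral_mono (((i1.add i2).sub (i3.const_mul 2)).const_mul c)
        ((iff2.add igg2).sub (ifg.const_mul 2)) fun z => ?_
      have hz := h.pos z
      have hR : ξ z * f z.1 ^ 2 + ξ z * g z.2 ^ 2 - 2 * (ξ z * (f z.1 * g z.2))
          = ξ z * (f z.1 - g z.2) ^ 2 := by ring
      simp only [hR]
      by_cases hx : z.1 ∈ A <;> by_cases hy : z.2 ∈ B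
      · simp only [hx, hy, Set.indicator_of_mem]
        have := hAB z.1 hx z.2 hy
        nlinarith [mul_le_mul_of_nonneg_right this (sq_nonneg (f z.1 - g z.2))]
      all_goals
        simp only [hx, hy, Set.indicator_of_mem, Set.indicator_of_notMem, not_false_eq_true]
        have := mul_nonneg hz.le (sq_nonneg (f z.1 - g z.2))
        nlinarith
    have i12 : Integrable (fun z : α × β => A.indicator f z.1 ^ 2 * B.indicator (fun _ => (1 : ℝ)) z.2
        + A.indicator (fun _ => (1 : ℝ)) z.1 * B.indicator g z.2 ^ 2) (μ.prod ν) := i1.add i2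
    have ifg2 : Integrable (fun z => ξ z * f z.1 ^ 2 + ξ z * g z.2 ^ 2) (μ.prod ν) := iff2.add igg2
    rw [integral_const_mul, integral_sub i12 (i3.const_mul 2), integral_add i1 i2,
      integral_const_mul, integral_prod_mul (fun x => A.indicator f x ^ 2),
      integral_prod_mul _ (fun y => B.indicator g y ^ 2),
      integral_prod_mul (fun x => A.indicator f x), mean_f, mean_g,
      integral_indicator_const _ hA, integral_indicator_const _ hB,
      integral_sub ifg2 (ifg.const_mul 2), integral_add iff2 igg2, integral_const_mul,
      hFX, hGX, ← hX, ← hFG, ← hGG] at hle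
    simp only [smul_eq_mul, mul_one] at hle
    have q1 := sq_integral_indicator_le (μ := μ) hA.compl hf hfC hμA
    have q2 := sq_integral_indicator_le (μ := ν) hB.compl hg hgC hνB
    rw [← hFB] at q1
    rw [← hGB] at q2
    have r1 : 1 / 2 ≤ μ.real A := by
      have := probReal_compl_eq_one_sub (μ := μ) hA
      linarith
    have r2 : 1 / 2 ≤ ν.real B := by
      have := probReal_compl_eq_one_sub (μ := ν) hB
      linarith
    have FG0 : 0 ≤ FG := integral_nonneg fun x => sq_nonneg _
    have GG0 : 0 ≤ GG := integral_nonneg fun x => sq_nonneg _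
    have hbr : 1 / 2 * ((FG + GG) - (FB + GB)) ≤ FG * ν.real B + μ.real A * GG
        - 2 * ((-∫ x, Aᶜ.indicator f x ∂μ) * (-∫ x, Bᶜ.indicator g x ∂ν)) := by
      nlinarith [sq_nonneg ((∫ x, Aᶜ.indicator f x ∂μ) - ∫ x, Bᶜ.indicator g x ∂ν),
        mul_le_mul_of_nonneg_left r2 FG0, mul_le_mul_of_nonneg_left r1 GG0]
    have := mul_le_mul_of_nonneg_left hbr hcpos.le
    linarith
  -- second estimate: the bad set carries little correlation
  have est2 : X ≤ 1 / 2 * (FG + GG) + 1 / 8 * ((FG + FB) + (GG + GB)) := by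
    have iA2 : Integrable (fun z => ξ z * A.indicator f z.1 ^ 2) (μ.prod ν) :=
      integrable_mul_of_bounded iξ ((mA.comp m1).pow_const 2) fun z => sqb (hindA _ z.1)
    have iB2 : Integrable (fun z => ξ z * B.indicator g z.2 ^ 2) (μ.prod ν) :=
      integrable_mul_of_bounded iξ ((mB.comp m2).pow_const 2) fun z => sqb (hindB _ z.2)
    have iprod : Integrable (fun z : α × β => f z.1 ^ 2 * g z.2 ^ 2) (μ.prod ν) :=
      (integrable_of_bounded (hf.pow_const 2) fun x => sqb (hfC x)).mul_prod
        (integrable_of_bounded (hg.pow_const 2) fun x => sqb (hgC x))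
    have ibad : Integrable ((A ×ˢ B)ᶜ.indicator fun z => ξ z ^ 2) (μ.prod ν) :=
      h.memLp.integrable_sq.indicator (hA.prod hB).compl
    have hAX : ∫ z, ξ z * A.indicator f z.1 ^ 2 ∂(μ.prod ν) = FG :=
      h.left (fun x => A.indicator f x ^ 2) (mA.pow_const 2)
    have hBX : ∫ z, ξ z * B.indicator g z.2 ^ 2 ∂(μ.prod ν) = GG :=
      h.right (fun x => B.indicator g x ^ 2) (mB.pow_const 2)
    have hlam : ∀ lam : ℝ, 0 < lam →
        X ≤ 1 / 2 * (FG + GG) + 1 / 2 * (lam / 16 + (FG + FB) * (GG + GB) / lam) := by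
      intro lam hlam
      have hle : X ≤ ∫ z, (1 / 2 * (ξ z * A.indicator f z.1 ^ 2 + ξ z * B.indicator g z.2 ^ 2)
          + 1 / 2 * (lam * (A ×ˢ B)ᶜ.indicator (fun z => ξ z ^ 2) z
            + lam⁻¹ * (f z.1 ^ 2 * g z.2 ^ 2))) ∂(μ.prod ν) := by
        refine integral_mono ifg (((iA2.add iB2).const_mul _).add
          (((ibad.const_mul _).add (iprod.const_mul _)).const_mul _)) fun z => ?_
        have hz := h.pos z
        by_cases hmem : z ∈ A ×ˢ B
        · have hx : z.1 ∈ A := hmem.1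
          have hy : z.2 ∈ B := hmem.2
          simp only [hx, hy, Set.indicator_of_mem, Set.mem_compl_iff, hmem, not_true_eq_false,
            not_false_eq_true, Set.indicator_of_notMem, mul_zero, zero_add]
          have h1 := mul_nonneg hz.le (sq_nonneg (f z.1 - g z.2))
          have h2 : 0 ≤ lam⁻¹ * (f z.1 ^ 2 * g z.2 ^ 2) := by positivity
          linear_combination (1 / 2) * h1 + (1 / 2) * h2
        · simp only [Set.mem_compl_iff, hmem, not_false_eq_true, Set.indicator_of_mem]
          have h1 := mul_nonneg hz.le (sq_nonneg (A.indicator f z.1))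
          have h2 := mul_nonneg hz.le (sq_nonneg (B.indicator g z.2))
          have h3 : 0 ≤ lam⁻¹ * (lam * ξ z - f z.1 * g z.2) ^ 2 := by positivity
          have h4 : lam⁻¹ * (lam * ξ z - f z.1 * g z.2) ^ 2 = lam * ξ z ^ 2
              - 2 * (ξ z * (f z.1 * g z.2)) + lam⁻¹ * (f z.1 ^ 2 * g z.2 ^ 2) := by
            field_simp
            ring
          linarith
      have j1 : Integrable (fun z => 1 / 2 * (ξ z * A.indicator f z.1 ^ 2
          + ξ z * B.indicator g z.2 ^ 2)) (μ.prod ν) := (iA2.add iB2).const_mul _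
      have j2 : Integrable (fun z => 1 / 2 * (lam * (A ×ˢ B)ᶜ.indicator (fun z => ξ z ^ 2) z
          + lam⁻¹ * (f z.1 ^ 2 * g z.2 ^ 2))) (μ.prod ν) :=
        ((ibad.const_mul _).add (iprod.const_mul _)).const_mul _
      rw [integral_add j1 j2, integral_const_mul,
        integral_add iA2 iB2, hAX, hBX, integral_const_mul,
        integral_add (ibad.const_mul _) (iprod.const_mul _), integral_const_mul,
        integral_const_mul, integral_indicator (hA.prod hB).compl,
        integral_prod_mul (fun x => f x ^ 2) (fun y => g y ^ 2), hF, hG] at hle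
      have h1 := mul_le_mul_of_nonneg_left hbad hlam.le
      have h2 : lam⁻¹ * ((FG + FB) * (GG + GB)) = (FG + FB) * (GG + GB) / lam := by
        rw [div_eq_inv_mul]
      rw [h2] at hle
      linarith
    have hF0 : 0 ≤ FG + FB := by rw [← hF]; exact integral_nonneg fun x => sq_nonneg _
    have hG0 : 0 ≤ GG + GB := by rw [← hG]; exact integral_nonneg fun x => sq_nonneg _
    refine le_of_forall_pos_le_add fun ε hε => ?_
    set S := (FG + FB) + (GG + GB) with hS
    have hS0 : 0 ≤ S := by positivity
    have hh := hlam (2 * (S + ε)) (by positivity)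
    have h3 : (FG + FB) * (GG + GB) / (2 * (S + ε)) ≤ S / 8 := by
      rw [div_le_iff₀ (by positivity)]
      nlinarith [sq_nonneg ((FG + FB) - (GG + GB)), mul_nonneg hS0 hε.le]
    linarith
  have hbad0 : 0 ≤ FB + GB :=
    add_nonneg (integral_nonneg fun x => sq_nonneg _) (integral_nonneg fun x => sq_nonneg _)
  have hgood0 : 0 ≤ FG + GG :=
    add_nonneg (integral_nonneg fun x => sq_nonneg _) (integral_nonneg fun x => sq_nonneg _)
  rw [hF, hG]
  have tot0 : 0 ≤ (FG + FB) + (GG + GB) := by linarith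
  have h1 := mul_le_mul_of_nonneg_left est2 hcpos.le
  have h2 : c * c * ((FG + FB) + (GG + GB)) ≤ c * 1 * ((FG + FB) + (GG + GB)) := by gcongr
  have h3 : (1 + c) * X ≤ (1 + c) * ((1 / 2 - c / 16) * ((FG + FB) + (GG + GB))) := by
    linear_combination h1 + (1 / 2) * est1 + (1 / 16) * h2
  exact le_of_mul_le_mul_left h3 (by linarith)

theorem IsCouplingDensity.gap (h : IsCouplingDensity μ ν ξ) {c : ℝ}
    (hc : HasGoodSets μ ν ξ c) {f : α → ℝ} {g : β → ℝ} (hf : Measurable f) (hg : Measurable g)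
    {C : ℝ} (hfC : ∀ x, |f x| ≤ C) (hgC : ∀ x, |g x| ≤ C) :
    (∫ z, ξ z * (f z.1 * g z.2) ∂(μ.prod ν) - (∫ x, f x ∂μ) * ∫ y, g y ∂ν) ^ 2 ≤
      (1 - c / 8) ^ 2 * (∫ x, f x ^ 2 ∂μ) * ∫ y, g y ^ 2 ∂ν := by
  have hcpos := hc.c_pos
  have hcle := hc.c_le
  set m := ∫ x, f x ∂μ with hm
  set m' := ∫ y, g y ∂ν with hm'
  have C0 : 0 ≤ C := by
    obtain ⟨x⟩ : Nonempty α := nonempty_of_isProbabilityMeasure μ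
    exact (abs_nonneg _).trans (hfC x)
  have iξ := h.integrable
  have m1 : Measurable fun z : α × β => z.1 := measurable_fst
  have m2 : Measurable fun z : α × β => z.2 := measurable_snd
  have sqb : ∀ {u : ℝ}, |u| ≤ C → |u ^ 2| ≤ C ^ 2 := fun hu => by
    rw [abs_pow]; exact pow_le_pow_left₀ (abs_nonneg _) hu 2
  have if1 : Integrable f μ := integrable_of_bounded hf hfC
  have ig1 : Integrable g ν := integrable_of_bounded hg hgC
  have if2 : Integrable (fun x => f x ^ 2) μ :=
    integrable_of_bounded (hf.pow_const 2) fun x => sqb (hfC x)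
  have ig2 : Integrable (fun x => g x ^ 2) ν :=
    integrable_of_bounded (hg.pow_const 2) fun x => sqb (hgC x)
  have hf2 : ∫ x, (f x - m) ^ 2 ∂μ ≤ ∫ x, f x ^ 2 ∂μ := by
    have e : ∀ x, (f x - m) ^ 2 = f x ^ 2 - 2 * m * f x + m ^ 2 := fun x => by ring
    simp_rw [e]
    have hi : Integrable (fun x => f x ^ 2 - 2 * m * f x) μ := if2.sub (if1.const_mul _)
    rw [integral_add hi (integrable_const _),
      integral_sub if2 (if1.const_mul _), integral_const_mul, ← hm]
    simp only [integral_const, probReal_univ, one_smul]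
    nlinarith [sq_nonneg m]
  have hg2 : ∫ x, (g x - m') ^ 2 ∂ν ≤ ∫ x, g x ^ 2 ∂ν := by
    have e : ∀ x, (g x - m') ^ 2 = g x ^ 2 - 2 * m' * g x + m' ^ 2 := fun x => by ring
    simp_rw [e]
    have hi : Integrable (fun x => g x ^ 2 - 2 * m' * g x) ν := ig2.sub (ig1.const_mul _)
    rw [integral_add hi (integrable_const _),
      integral_sub ig2 (ig1.const_mul _), integral_const_mul, ← hm']
    simp only [integral_const, probReal_univ, one_smul]
    nlinarith [sq_nonneg m']
  have hXeq : ∫ z, ξ z * (f z.1 * g z.2) ∂(μ.prod ν) - m * m'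
      = ∫ z, ξ z * ((f z.1 - m) * (g z.2 - m')) ∂(μ.prod ν) := by
    have ifg : Integrable (fun z => ξ z * (f z.1 * g z.2)) (μ.prod ν) :=
      integrable_mul_of_bounded iξ ((hf.comp m1).mul (hg.comp m2)) (C := C * C) fun z => by
        rw [abs_mul]
        exact mul_le_mul (hfC _) (hgC _) (abs_nonneg _) C0
    have iff1 : Integrable (fun z => ξ z * f z.1) (μ.prod ν) :=
      integrable_mul_of_bounded iξ (hf.comp m1) fun z => hfC z.1
    have igg1 : Integrable (fun z => ξ z * g z.2) (μ.prod ν) :=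
      integrable_mul_of_bounded iξ (hg.comp m2) fun z => hgC z.2
    have e : ∀ z, ξ z * ((f z.1 - m) * (g z.2 - m')) = ξ z * (f z.1 * g z.2)
        - m' * (ξ z * f z.1) - m * (ξ z * g z.2) + m * m' * ξ z := fun z => by ring
    simp_rw [e]
    have j1 : Integrable (fun z => ξ z * (f z.1 * g z.2) - m' * (ξ z * f z.1)) (μ.prod ν) :=
      ifg.sub (iff1.const_mul _)
    have j2 : Integrable (fun z => ξ z * (f z.1 * g z.2) - m' * (ξ z * f z.1) - m * (ξ z * g z.2))
      (μ.prod ν) := j1.sub (igg1.const_mul _)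
    rw [integral_add j2 (iξ.const_mul _), integral_sub j1 (igg1.const_mul _),
      integral_sub ifg (iff1.const_mul _), integral_const_mul, integral_const_mul,
      integral_const_mul, h.left f hf, h.right g hg, ← hm, ← hm']
    have h1 : ∫ z, ξ z ∂(μ.prod ν) = 1 := by
      have := h.left (fun _ => 1) measurable_const
      simpa using this
    rw [h1]
    ring
  rw [hXeq]
  set X := ∫ z, ξ z * ((f z.1 - m) * (g z.2 - m')) ∂(μ.prod ν) with hX
  set F := ∫ x, (f x - m) ^ 2 ∂μ with hF
  set G := ∫ x, (g x - m') ^ 2 ∂ν with hG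
  have hquad : ∀ t : ℝ, 0 ≤ ((1 / 2 - c / 16) * F) * (t * t) + (-X) * t
      + (1 / 2 - c / 16) * G := by
    intro t
    have hb1 : ∀ x, |t * (f x - m)| ≤ |t| * (C + |m|) + (C + |m'|) := fun x => by
      rw [abs_mul]
      have h1 := mul_le_mul_of_nonneg_left ((abs_sub (f x) m).trans
        (add_le_add_left (hfC x) |m|)) (abs_nonneg t)
      have := abs_nonneg m'
      linarith
    have hb2 : ∀ x, |g x - m'| ≤ |t| * (C + |m|) + (C + |m'|) := fun x => by
      have h1 := (abs_sub (g x) m').trans (add_le_add_left (hgC x) |m'|)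
      have : 0 ≤ |t| * (C + |m|) := by positivity
      linarith
    have := h.integral_mul_le hc (f := fun x => t * (f x - m)) (g := fun y => g y - m')
      ((hf.sub_const m).const_mul t) (hg.sub_const m') hb1 hb2
      (by rw [integral_const_mul, integral_sub if1 (integrable_const _), ← hm]; simp)
      (by rw [integral_sub ig1 (integrable_const _), ← hm']; simp)
    have e1 : ∫ z, ξ z * (t * (f z.1 - m) * (g z.2 - m')) ∂(μ.prod ν) = t * X := by
      rw [hX, ← integral_const_mul]
      congr 1
      funext z
      ring
    have e2 : ∫ x, (t * (f x - m)) ^ 2 ∂μ = t ^ 2 * F := by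
      simp_rw [mul_pow]
      rw [integral_const_mul]
    rw [e1, e2] at this
    linarith
  have hd := discrim_le_zero hquad
  simp only [discrim] at hd
  have F0 : 0 ≤ F := integral_nonneg fun x => sq_nonneg _
  have G0 : 0 ≤ G := integral_nonneg fun x => sq_nonneg _
  calc X ^ 2 ≤ (1 - c / 8) ^ 2 * F * G := by nlinarith
    _ ≤ _ := by gcongr

end Gap

/-! ### Block approximations of a coupling density -/

section Blocks

variable {α β I J : Type*} [MeasurableSpace α] [MeasurableSpace β]
  [Fintype I] [DecidableEq I] [MeasurableSpace I] [MeasurableSingletonClass I]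
  [Fintype J] [DecidableEq J] [MeasurableSpace J] [MeasurableSingletonClass J]

/-- The integral of `F` over the cell of the product partition with labels `k` and `l`. -/
noncomputable def cellIntegral (μ : Measure α) (ν : Measure β) (F : α × β → ℝ) (cl : α → I)
    (cl' : β → J) (k : I) (l : J) : ℝ :=
  ∫ z, F z * (if cl z.1 = k ∧ cl' z.2 = l then 1 else 0) ∂(μ.prod ν)

/-- The block averages of `ξ`. -/
noncomputable def blockDensity (μ : Measure α) (ν : Measure β) (ξ : α × β → ℝ) (cl : α → I)
    (cl' : β → J) (k : I) (l : J) : ℝ :=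
  if μ.real (cl ⁻¹' {k}) * ν.real (cl' ⁻¹' {l}) = 0 then 1
  else cellIntegral μ ν ξ cl cl' k l / (μ.real (cl ⁻¹' {k}) * ν.real (cl' ⁻¹' {l}))

variable {μ : Measure α} {ν : Measure β} [IsProbabilityMeasure μ] [IsProbabilityMeasure ν]
  {ξ : α × β → ℝ} {cl : α → I} {cl' : β → J}

theorem measurable_comp_label (hcl : Measurable cl) (hcl' : Measurable cl') (h : I → J → ℝ) :
    Measurable fun z : α × β => h (cl z.1) (cl' z.2) :=
  (measurable_of_finite fun q : I × J => h q.1 q.2).comp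
    ((hcl.comp measurable_fst).prodMk (hcl'.comp measurable_snd))

theorem abs_le_sum_abs {I J : Type*} [Fintype I] [Fintype J] (h : I → J → ℝ) (k : I) (l : J) :
    |h k l| ≤ ∑ i, ∑ j, |h i j| :=
  (Finset.single_le_sum (f := fun j => |h k j|) (fun _ _ => abs_nonneg _) (Finset.mem_univ l)).trans
    (Finset.single_le_sum (f := fun i => ∑ j, |h i j|)
      (fun _ _ => Finset.sum_nonneg fun _ _ => abs_nonneg _) (Finset.mem_univ k))

theorem integral_mul_comp_label (hcl : Measurable cl) (hcl' : Measurable cl') {F : α × β → ℝ}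
    (hF : Integrable F (μ.prod ν)) (h : I → J → ℝ) :
    ∫ z, F z * h (cl z.1) (cl' z.2) ∂(μ.prod ν)
      = ∑ k, ∑ l, h k l * cellIntegral μ ν F cl cl' k l := by
  have hi : ∀ k l, Integrable (fun z => F z * (if cl z.1 = k ∧ cl' z.2 = l then (1 : ℝ) else 0))
      (μ.prod ν) := fun k l =>
    integrable_mul_of_bounded hF
      (measurable_comp_label hcl hcl' fun i j => if i = k ∧ j = l then (1 : ℝ) else 0) (C := 1)
      fun z => by split_ifs <;> simp
  have e : ∀ z, F z * h (cl z.1) (cl' z.2)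
      = ∑ k, ∑ l, h k l * (F z * (if cl z.1 = k ∧ cl' z.2 = l then (1 : ℝ) else 0)) := fun z => by
    rw [Finset.sum_eq_single (cl z.1), Finset.sum_eq_single (cl' z.2)]
    · simp [mul_comm]
    · intro l _ hl
      simp [hl.symm]
    · simp
    · intro k _ hk
      simp [hk.symm]
    · simp
  simp_rw [e]
  rw [integral_finsetSum _ fun k _ => integrable_finsetSum _ fun l _ => (hi k l).const_mul _]
  refine Finset.sum_congr rfl fun k _ => ?_
  rw [integral_finsetSum _ fun l _ => (hi k l).const_mul _]
  refine Finset.sum_congr rfl fun l _ => ?_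
  rw [integral_const_mul, cellIntegral]

theorem integral_label_eq (hcl : Measurable cl) (k : I) :
    ∫ x, (if cl x = k then (1 : ℝ) else 0) ∂μ = μ.real (cl ⁻¹' {k}) := by
  rw [← integral_indicator_one (hcl (measurableSet_singleton k))]
  refine integral_congr_ae (ae_of_all _ fun x => ?_)
  by_cases h : cl x = k <;> simp [h]

theorem cellIntegral_one (hcl : Measurable cl) (hcl' : Measurable cl') (k : I) (l : J) :
    cellIntegral μ ν (fun _ => 1) cl cl' k l = μ.real (cl ⁻¹' {k}) * ν.real (cl' ⁻¹' {l}) := by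
  rw [← integral_label_eq hcl, ← integral_label_eq hcl', ← integral_prod_mul, cellIntegral]
  refine integral_congr_ae (ae_of_all _ fun z => ?_)
  by_cases h : cl z.1 = k <;> simp [h]

theorem integral_comp_label (hcl : Measurable cl) (hcl' : Measurable cl') (h : I → J → ℝ) :
    ∫ z, h (cl z.1) (cl' z.2) ∂(μ.prod ν)
      = ∑ k, ∑ l, h k l * (μ.real (cl ⁻¹' {k}) * ν.real (cl' ⁻¹' {l})) := by
  have := integral_mul_comp_label (μ := μ) (ν := ν) hcl hcl' (integrable_const (1 : ℝ)) h
  simp only [one_mul] at this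
  rw [this]
  simp only [cellIntegral_one hcl hcl']

theorem integral_comp_label_left (hcl : Measurable cl) (h : I → ℝ) :
    ∫ x, h (cl x) ∂μ = ∑ k, μ.real (cl ⁻¹' {k}) * h k := by
  have hi : ∀ k, Integrable (fun x => if cl x = k then (1 : ℝ) else 0) μ := fun k =>
    integrable_of_bounded ((measurable_of_finite fun i => if i = k then (1 : ℝ) else 0).comp hcl)
      (C := 1) fun x => by split_ifs <;> simp
  have e : ∀ x, h (cl x) = ∑ k, h k * (if cl x = k then (1 : ℝ) else 0) := fun x => by simp
  simp_rw [e]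
  rw [integral_finsetSum _ fun k _ => (hi k).const_mul _]
  refine Finset.sum_congr rfl fun k _ => ?_
  rw [integral_const_mul, integral_label_eq hcl, mul_comm]

theorem sum_measureReal_label (hcl : Measurable cl) : ∑ k, μ.real (cl ⁻¹' {k}) = 1 := by
  have := integral_comp_label_left (μ := μ) hcl fun _ => 1
  simpa using this.symm

variable (h : IsCouplingDensity μ ν ξ) (hcl : Measurable cl) (hcl' : Measurable cl')
include h hcl hcl'

theorem IsCouplingDensity.sum_cellIntegral_left (k : I) :
    ∑ l, cellIntegral μ ν ξ cl cl' k l = μ.real (cl ⁻¹' {k}) := by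
  have h1 := integral_mul_comp_label hcl hcl' h.integrable fun i _ => if i = k then 1 else 0
  simp only [ite_mul, one_mul, zero_mul, Finset.sum_ite_irrel, Finset.sum_const_zero,
    Finset.sum_ite_eq', Finset.mem_univ, if_true] at h1
  rw [← h1, ← integral_label_eq hcl]
  exact h.left _ ((measurable_of_finite fun i => if i = k then (1 : ℝ) else 0).comp hcl)

theorem IsCouplingDensity.sum_cellIntegral_right (l : J) :
    ∑ k, cellIntegral μ ν ξ cl cl' k l = ν.real (cl' ⁻¹' {l}) := by
  have h1 := integral_mul_comp_label hcl hcl' h.integrable fun _ j => if j = l then 1 else 0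
  simp only [ite_mul, one_mul, zero_mul, Finset.sum_ite_eq', Finset.mem_univ, if_true] at h1
  rw [← h1, ← integral_label_eq hcl']
  exact h.right _ ((measurable_of_finite fun i => if i = l then (1 : ℝ) else 0).comp hcl')

omit hcl hcl' in
omit [IsProbabilityMeasure μ] [IsProbabilityMeasure ν] [Fintype I] [Fintype J] [MeasurableSpace I]
  [MeasurableSingletonClass I] [MeasurableSpace J] [MeasurableSingletonClass J] in
theorem IsCouplingDensity.cellIntegral_nonneg (k : I) (l : J) :
    0 ≤ cellIntegral μ ν ξ cl cl' k l :=
  integral_nonneg fun z => mul_nonneg (h.pos z).le (by split_ifs <;> simp)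

theorem IsCouplingDensity.mul_blockDensity (k : I) (l : J) :
    μ.real (cl ⁻¹' {k}) * ν.real (cl' ⁻¹' {l}) * blockDensity μ ν ξ cl cl' k l
      = cellIntegral μ ν ξ cl cl' k l := by
  rw [blockDensity]
  split_ifs with h0
  · rw [h0, zero_mul]
    have hl := Finset.single_le_sum (f := fun l => cellIntegral μ ν ξ cl cl' k l)
      (fun l _ => h.cellIntegral_nonneg k l) (Finset.mem_univ l)
    have hr := Finset.single_le_sum (f := fun k => cellIntegral μ ν ξ cl cl' k l)
      (fun k _ => h.cellIntegral_nonneg k l) (Finset.mem_univ k)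
    rw [h.sum_cellIntegral_left hcl hcl'] at hl
    rw [h.sum_cellIntegral_right hcl hcl'] at hr
    refine le_antisymm (h.cellIntegral_nonneg k l) ?_
    rcases mul_eq_zero.1 h0 with h0 | h0
    · exact hl.trans h0.le
    · exact hr.trans h0.le
  · exact mul_div_cancel₀ _ h0

theorem IsCouplingDensity.blockDensity_pos (k : I) (l : J) :
    0 < blockDensity μ ν ξ cl cl' k l := by
  rw [blockDensity]
  split_ifs with h0
  · exact one_pos
  · have hp : 0 < μ.real (cl ⁻¹' {k}) :=
      lt_of_le_of_ne measureReal_nonneg fun e => h0 (by rw [← e, zero_mul])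
    have hq : 0 < ν.real (cl' ⁻¹' {l}) :=
      lt_of_le_of_ne measureReal_nonneg fun e => h0 (by rw [← e, mul_zero])
    refine div_pos ?_ (mul_pos hp hq)
    rw [cellIntegral, integral_pos_iff_support_of_nonneg
      (fun z => mul_nonneg (h.pos z).le (by split_ifs <;> simp))
      (integrable_mul_of_bounded h.integrable
        (measurable_comp_label hcl hcl' fun i j => if i = k ∧ j = l then (1 : ℝ) else 0) (C := 1)
        fun z => by split_ifs <;> simp)]
    have hs : (Function.support fun z => ξ z * (if cl z.1 = k ∧ cl' z.2 = l then (1 : ℝ) else 0))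
        = (cl ⁻¹' {k}) ×ˢ (cl' ⁻¹' {l}) := by
      ext z
      simp [(h.pos z).ne']
    rw [hs, Measure.prod_prod]
    exact ENNReal.mul_pos (fun e => hp.ne' (by rw [measureReal_def, e]; rfl))
      (fun e => hq.ne' (by rw [measureReal_def, e]; rfl))

/-- The block kernel associated with measurable finite partitions. -/
noncomputable def IsCouplingDensity.blockKernel : BlockKernel I J where
  p k := μ.real (cl ⁻¹' {k})
  q l := ν.real (cl' ⁻¹' {l})
  M := blockDensity μ ν ξ cl cl'
  p_nonneg _ := measureReal_nonneg
  q_nonneg _ := measureReal_nonneg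
  sum_p := sum_measureReal_label hcl
  sum_q := sum_measureReal_label hcl'
  M_pos := h.blockDensity_pos hcl hcl'
  row k := by
    by_cases hk : μ.real (cl ⁻¹' {k}) = 0
    · simp only [blockDensity, hk, zero_mul, if_true, mul_one]
      exact sum_measureReal_label hcl'
    · refine mul_left_cancel₀ hk ?_
      rw [Finset.mul_sum, mul_one]
      simp only [← mul_assoc, h.mul_blockDensity hcl hcl']
      exact h.sum_cellIntegral_left hcl hcl' k
  col l := by
    by_cases hl : ν.real (cl' ⁻¹' {l}) = 0
    · simp only [blockDensity, hl, mul_zero, if_true, mul_one]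
      exact sum_measureReal_label hcl
    · refine mul_left_cancel₀ hl ?_
      rw [Finset.mul_sum, mul_one]
      have e : ∀ k, ν.real (cl' ⁻¹' {l}) * (μ.real (cl ⁻¹' {k}) * blockDensity μ ν ξ cl cl' k l)
          = cellIntegral μ ν ξ cl cl' k l := fun k => by
        rw [← h.mul_blockDensity hcl hcl']
        ring
      simp only [e]
      exact h.sum_cellIntegral_right hcl hcl' l

theorem IsCouplingDensity.hasGap_blockKernel {c : ℝ} (hc : HasGoodSets μ ν ξ c) :
    (h.blockKernel hcl hcl').HasGap (1 - c / 8) := by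
  intro f g
  have mf : Measurable fun x => f (cl x) := (measurable_of_finite f).comp hcl
  have mg : Measurable fun y => g (cl' y) := (measurable_of_finite g).comp hcl'
  have bf : ∀ x, |f (cl x)| ≤ (∑ k, |f k|) + ∑ l, |g l| := fun x =>
    (Finset.single_le_sum (f := fun k => |f k|) (fun _ _ => abs_nonneg _)
      (Finset.mem_univ (cl x))).trans (le_add_of_nonneg_right
        (Finset.sum_nonneg fun _ _ => abs_nonneg _))
  have bg : ∀ y, |g (cl' y)| ≤ (∑ k, |f k|) + ∑ l, |g l| := fun y =>
    (Finset.single_le_sum (f := fun l => |g l|) (fun _ _ => abs_nonneg _)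
      (Finset.mem_univ (cl' y))).trans (le_add_of_nonneg_left
        (Finset.sum_nonneg fun _ _ => abs_nonneg _))
  have key := h.gap hc mf mg bf bg
  rw [integral_mul_comp_label hcl hcl' h.integrable fun k l => f k * g l,
    integral_comp_label_left hcl f, integral_comp_label_left hcl' g,
    integral_comp_label_left hcl fun k => f k ^ 2,
    integral_comp_label_left hcl' fun l => g l ^ 2] at key
  refine Eq.trans_le ?_ key
  congr 1
  rw [Finset.sum_mul_sum, ← Finset.sum_sub_distrib]
  refine Finset.sum_congr rfl fun k _ => ?_
  rw [← Finset.sum_sub_distrib]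
  refine Finset.sum_congr rfl fun l _ => ?_
  rw [← h.mul_blockDensity hcl hcl']
  simp only [BlockKernel.ctr, IsCouplingDensity.blockKernel]
  ring

theorem IsCouplingDensity.hs_blockKernel_le :
    (h.blockKernel hcl hcl').hs ≤ ∫ z, ξ z ^ 2 ∂(μ.prod ν) := by
  set M := blockDensity μ ν ξ cl cl' with hM
  have i1 := h.memLp.integrable_sq
  have mM := measurable_comp_label hcl hcl' M
  have i2 : Integrable (fun z => ξ z * M (cl z.1) (cl' z.2)) (μ.prod ν) :=
    integrable_mul_of_bounded h.integrable mM fun z => abs_le_sum_abs M _ _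
  have i3 : Integrable (fun z : α × β => M (cl z.1) (cl' z.2) ^ 2) (μ.prod ν) :=
    integrable_of_bounded (mM.pow_const 2) (C := (∑ i, ∑ j, |M i j|) ^ 2) fun z => by
      rw [abs_pow]
      exact pow_le_pow_left₀ (abs_nonneg _) (abs_le_sum_abs M _ _) 2
  have h0 : 0 ≤ ∫ z, (ξ z ^ 2 - 2 * (ξ z * M (cl z.1) (cl' z.2)) + M (cl z.1) (cl' z.2) ^ 2)
      ∂(μ.prod ν) := integral_nonneg fun z => by
    simp only [Pi.zero_apply]
    nlinarith [sq_nonneg (ξ z - M (cl z.1) (cl' z.2))]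
  have i12 : Integrable (fun z => ξ z ^ 2 - 2 * (ξ z * M (cl z.1) (cl' z.2))) (μ.prod ν) :=
    i1.sub (i2.const_mul 2)
  rw [integral_add i12 i3, integral_sub i1 (i2.const_mul 2), integral_const_mul,
    integral_mul_comp_label hcl hcl' h.integrable M,
    integral_comp_label hcl hcl' fun k l => M k l ^ 2] at h0
  have e1 : ∀ k l, M k l * cellIntegral μ ν ξ cl cl' k l
      = M k l ^ 2 * (μ.real (cl ⁻¹' {k}) * ν.real (cl' ⁻¹' {l})) := fun k l => by
    rw [← h.mul_blockDensity hcl hcl']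
    ring
  simp only [e1] at h0
  have e2 : (h.blockKernel hcl hcl').hs
      = (∑ k, ∑ l, M k l ^ 2 * (μ.real (cl ⁻¹' {k}) * ν.real (cl' ⁻¹' {l}))) - 1 := by
    have e3 : ∑ k, ∑ l, cellIntegral μ ν ξ cl cl' k l = 1 := by
      simp only [h.sum_cellIntegral_left hcl hcl']
      exact sum_measureReal_label hcl
    have e4 : ∑ k, ∑ l, μ.real (cl ⁻¹' {k}) * ν.real (cl' ⁻¹' {l}) = 1 := by
      rw [← Finset.sum_mul_sum, sum_measureReal_label hcl, sum_measureReal_label hcl', one_mul]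
    have e5 : ∀ k l, μ.real (cl ⁻¹' {k}) * ν.real (cl' ⁻¹' {l}) * (M k l - 1) ^ 2
        = M k l ^ 2 * (μ.real (cl ⁻¹' {k}) * ν.real (cl' ⁻¹' {l}))
          - 2 * cellIntegral μ ν ξ cl cl' k l + μ.real (cl ⁻¹' {k}) * ν.real (cl' ⁻¹' {l}) :=
      fun k l => by
        rw [← h.mul_blockDensity hcl hcl']
        ring
    calc (h.blockKernel hcl hcl').hs
        = ∑ k, ∑ l, μ.real (cl ⁻¹' {k}) * ν.real (cl' ⁻¹' {l}) * (M k l - 1) ^ 2 := rfl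
      _ = _ := by
        simp only [e5, Finset.sum_add_distrib, Finset.sum_sub_distrib, e4]
        simp only [← Finset.mul_sum, e3]
        ring
  linarith

omit h in
theorem integrable_comp_label (M : I → J → ℝ) :
    Integrable (fun z : α × β => M (cl z.1) (cl' z.2)) (μ.prod ν) :=
  integrable_of_bounded (measurable_comp_label hcl hcl' M) fun z => abs_le_sum_abs M _ _

theorem IsCouplingDensity.refines {I' J' : Type*} [Fintype I'] [DecidableEq I']
    [MeasurableSpace I'] [MeasurableSingletonClass I'] [Fintype J'] [DecidableEq J']
    [MeasurableSpace J'] [MeasurableSingletonClass J'] {dl : α → I'} {dl' : β → J'}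
    (hdl : Measurable dl) (hdl' : Measurable dl') {r : I → I'} {r' : J → J'}
    (hr : ∀ x, dl x = r (cl x)) (hr' : ∀ y, dl' y = r' (cl' y)) :
    (h.blockKernel hcl hcl').Refines (h.blockKernel hdl hdl') r r' where
  p_eq k' := by
    change μ.real (dl ⁻¹' {k'}) = ∑ k with r k = k', μ.real (cl ⁻¹' {k})
    rw [← integral_label_eq hdl]
    simp only [hr]
    rw [integral_comp_label_left hcl fun k => if r k = k' then (1 : ℝ) else 0]
    simp [Finset.sum_filter]
  q_eq l' := by
    change ν.real (dl' ⁻¹' {l'}) = ∑ l with r' l = l', ν.real (cl' ⁻¹' {l})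
    rw [← integral_label_eq hdl']
    simp only [hr']
    rw [integral_comp_label_left hcl' fun k => if r' k = l' then (1 : ℝ) else 0]
    simp [Finset.sum_filter]
  M_eq k' l' := by
    simp only [IsCouplingDensity.blockKernel]
    simp only [h.mul_blockDensity hcl hcl', h.mul_blockDensity hdl hdl']
    rw [cellIntegral]
    simp only [hr, hr']
    rw [integral_mul_comp_label hcl hcl' h.integrable
      fun k l => if r k = k' ∧ r' l = l' then (1 : ℝ) else 0, Finset.sum_filter]
    refine Finset.sum_congr rfl fun k _ => ?_
    rw [Finset.sum_filter]
    by_cases hk : r k = k' <;> simp [hk]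

theorem IsCouplingDensity.ae_eq_condExp :
    (fun z => blockDensity μ ν ξ cl cl' (cl z.1) (cl' z.2)) =ᵐ[μ.prod ν]
      (μ.prod ν)[ξ | MeasurableSpace.comap (fun z : α × β => (cl z.1, cl' z.2)) inferInstance] := by
  have hm : Measurable fun z : α × β => (cl z.1, cl' z.2) :=
    (hcl.comp measurable_fst).prodMk (hcl'.comp measurable_snd)
  set M := blockDensity μ ν ξ cl cl' with hM
  have iM := integrable_comp_label (μ := μ) (ν := ν) hcl hcl' M
  refine ae_eq_condExp_of_forall_setIntegral_eq hm.comap_le h.integrable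
    (fun s _ _ => iM.integrableOn) ?_ ?_
  · rintro _ ⟨S, hS, rfl⟩ -
    classical
    rw [← integral_indicator (hm hS), ← integral_indicator (hm hS)]
    have e1 : ∀ z, ((fun z : α × β => (cl z.1, cl' z.2)) ⁻¹' S).indicator
        (fun z => M (cl z.1) (cl' z.2)) z
        = (fun k l => if (k, l) ∈ S then M k l else 0) (cl z.1) (cl' z.2) := fun z => rfl
    have e2 : ∀ z, ((fun z : α × β => (cl z.1, cl' z.2)) ⁻¹' S).indicator ξ z
        = ξ z * (fun k l => if (k, l) ∈ S then (1 : ℝ) else 0) (cl z.1) (cl' z.2) := fun z => by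
      by_cases hz : (cl z.1, cl' z.2) ∈ S <;> simp [hz]
    simp_rw [e1, e2]
    rw [integral_comp_label hcl hcl' fun k l => if (k, l) ∈ S then M k l else 0,
      integral_mul_comp_label hcl hcl' h.integrable fun k l => if (k, l) ∈ S then (1 : ℝ) else 0]
    refine Finset.sum_congr rfl fun k _ => Finset.sum_congr rfl fun l _ => ?_
    rw [← h.mul_blockDensity hcl hcl']
    split_ifs <;> ring
  · refine Measurable.aestronglyMeasurable ?_
    exact (measurable_of_finite fun q : I × J => M q.1 q.2).comp (comap_measurable _)

end Blocks

/-! ### Dyadic labels and the approximating kernels -/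

section Labels

variable {α β : Type*} [MeasurableSpace α] [MeasurableSpace.CountablyGenerated α]
  [MeasurableSpace β] [MeasurableSpace.CountablyGenerated β]

open Classical in
/-- The label recording membership in the first `r` sets of a generating sequence. -/
noncomputable def binLabel (r : ℕ) (x : α) : Fin r → Bool :=
  fun i => decide (x ∈ MeasurableSpace.natGeneratingSequence α i)

theorem measurable_binLabel (r : ℕ) : Measurable (binLabel r : α → Fin r → Bool) := by
  refine measurable_pi_lambda _ fun i => measurable_to_bool ?_
  have : (fun x => binLabel r x i) ⁻¹' {true} = MeasurableSpace.natGeneratingSequence α i := by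
    ext x
    simp [binLabel]
  rw [this]
  exact MeasurableSpace.measurableSet_natGeneratingSequence _

theorem binLabel_eq_of_le {r r' : ℕ} (h : r ≤ r') (x : α) :
    binLabel r x = (fun f : Fin r' → Bool => f ∘ Fin.castLE h) (binLabel r' x) := rfl

variable (α β) in
/-- The filtration generated by the labels of both coordinates. -/
noncomputable def labelFiltration : Filtration ℕ (inferInstance : MeasurableSpace (α × β)) where
  seq r := MeasurableSpace.comap (fun z : α × β => (binLabel r z.1, binLabel r z.2)) inferInstance
  mono' r r' h := by
    rintro _ ⟨S, -, rfl⟩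
    refine ⟨(fun q : (Fin r' → Bool) × (Fin r' → Bool) =>
      (q.1 ∘ Fin.castLE h, q.2 ∘ Fin.castLE h)) ⁻¹' S, MeasurableSet.of_discrete, rfl⟩
  le' r := (((measurable_binLabel r).comp measurable_fst).prodMk
    ((measurable_binLabel r).comp measurable_snd)).comap_le

theorem iSup_labelFiltration :
    ⨆ r, labelFiltration α β r = (inferInstance : MeasurableSpace (α × β)) := by
  refine le_antisymm (iSup_le fun r => (labelFiltration α β).le r) ?_
  refine sup_le ?_ ?_
  · conv_lhs => rw [← MeasurableSpace.generateFrom_natGeneratingSequence α]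
    rw [MeasurableSpace.comap_generateFrom]
    refine MeasurableSpace.generateFrom_le ?_
    rintro _ ⟨_, ⟨n, rfl⟩, rfl⟩
    refine le_iSup (fun r => labelFiltration α β r) (n + 1) _ ?_
    refine ⟨{q | q.1 (Fin.last n) = true}, MeasurableSet.of_discrete, ?_⟩
    ext z
    simp [binLabel]
  · conv_lhs => rw [← MeasurableSpace.generateFrom_natGeneratingSequence β]
    rw [MeasurableSpace.comap_generateFrom]
    refine MeasurableSpace.generateFrom_le ?_
    rintro _ ⟨_, ⟨n, rfl⟩, rfl⟩
    refine le_iSup (fun r => labelFiltration α β r) (n + 1) _ ?_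
    refine ⟨{q | q.2 (Fin.last n) = true}, MeasurableSet.of_discrete, ?_⟩
    ext z
    simp [binLabel]

variable {μ : Measure α} {ν : Measure β} [IsProbabilityMeasure μ] [IsProbabilityMeasure ν]
  {ξ : α × β → ℝ}

/-- The block kernel of level `r`. -/
noncomputable def IsCouplingDensity.kernel (h : IsCouplingDensity μ ν ξ) (r : ℕ) :
    BlockKernel (Fin r → Bool) (Fin r → Bool) :=
  h.blockKernel (measurable_binLabel r) (measurable_binLabel r)

theorem IsCouplingDensity.tendsto_kernel (h : IsCouplingDensity μ ν ξ) :
    ∀ᵐ z ∂(μ.prod ν), Tendsto (fun r => (h.kernel r).M (binLabel r z.1) (binLabel r z.2)) atTop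
      (𝓝 (ξ z)) := by
  have h1 : ∀ᵐ z ∂(μ.prod ν), Tendsto (fun r => ((μ.prod ν)[ξ | labelFiltration α β r]) z) atTop
      (𝓝 (ξ z)) := by
    refine h.integrable.tendsto_ae_condExp ?_
    rw [iSup_labelFiltration]
    exact h.measurable.stronglyMeasurable
  have h2 : ∀ᵐ z ∂(μ.prod ν), ∀ r, (h.kernel r).M (binLabel r z.1) (binLabel r z.2)
      = ((μ.prod ν)[ξ | labelFiltration α β r]) z :=
    ae_all_iff.2 fun r => h.ae_eq_condExp (measurable_binLabel r) (measurable_binLabel r)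
  filter_upwards [h1, h2] with z hz1 hz2
  simpa only [hz2] using hz1

theorem IsCouplingDensity.kernel_refines (h : IsCouplingDensity μ ν ξ) {r r' : ℕ} (hr : r ≤ r') :
    (h.kernel r').Refines (h.kernel r) (fun f => f ∘ Fin.castLE hr) fun f => f ∘ Fin.castLE hr :=
  h.refines _ _ _ _ (binLabel_eq_of_le hr) (binLabel_eq_of_le hr)

theorem IsCouplingDensity.exists_chaos_sub_le (h : IsCouplingDensity μ ν ξ) {c : ℝ}
    (hc : HasGoodSets μ ν ξ c) {e : ℝ} (he : 0 < e) :
    ∃ r, ∀ r', r ≤ r' → ∀ N,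
      ∑ m ∈ Finset.range (N + 1), ((h.kernel r').chaos m - (h.kernel r).chaos m) ≤ e := by
  have hcpos := hc.c_pos
  have hcle := hc.c_le
  set s := 1 - c / 8 with hs
  have hs0 : 0 ≤ s := by linarith
  have hs1 : s < 1 := by linarith
  set K := Real.exp ((∫ z, ξ z ^ 2 ∂(μ.prod ν)) / (1 - s ^ 2)) with hK
  have hgap : ∀ r, (h.kernel r).HasGap s := fun r => h.hasGap_blockKernel _ _ hc
  have hbound : ∀ r N, ∑ m ∈ Finset.range N, (h.kernel r).chaos m ≤ K := fun r N => by
    refine (Finset.sum_le_sum_of_subset_of_nonneg (Finset.range_mono (Nat.le_succ N))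
      fun m _ _ => (h.kernel r).chaos_nonneg m).trans ?_
    refine ((h.kernel r).sum_chaos_le (hgap r) hs0 hs1 N).trans (Real.exp_le_exp.2 ?_)
    have : 0 < 1 - s ^ 2 := by nlinarith
    gcongr
    exact h.hs_blockKernel_le _ _
  have hsum : ∀ r, Summable (h.kernel r).chaos := fun r =>
    summable_of_sum_range_le (h.kernel r).chaos_nonneg (hbound r)
  set H : ℕ → ℝ := fun r => ∑' m, (h.kernel r).chaos m with hH
  have hmono : Monotone H := fun r r' hr =>
    (hsum r).tsum_le_tsum (fun m => (h.kernel_refines hr).chaos_le m) (hsum r')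
  have hbdd : BddAbove (Set.range H) := ⟨K, by
    rintro _ ⟨r, rfl⟩
    exact Real.tsum_le_of_sum_range_le (h.kernel r).chaos_nonneg (hbound r)⟩
  have hlim := tendsto_atTop_ciSup hmono hbdd
  obtain ⟨r, hr⟩ := (hlim.eventually (lt_mem_nhds (sub_lt_self (⨆ r, H r) he))).exists
  refine ⟨r, fun r' hr' N => ?_⟩
  have h1 : ∑ m ∈ Finset.range (N + 1), ((h.kernel r').chaos m - (h.kernel r).chaos m)
      ≤ ∑' m, ((h.kernel r').chaos m - (h.kernel r).chaos m) :=
    ((hsum r').sub (hsum r)).sum_le_tsum _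
      fun m _ => sub_nonneg.2 ((h.kernel_refines hr').chaos_le m)
  rw [(hsum r').tsum_sub (hsum r)] at h1
  have h2 := le_ciSup hbdd r'
  linarith

end Labels

/-! ### Independent samples of the product measure -/

section Sample

variable {α β : Type*} [MeasurableSpace α] [MeasurableSpace β]

/-- The joint law of two independent samples of size `N`. -/
noncomputable def sampleLaw (μ : Measure α) (ν : Measure β) (N : ℕ) :
    Measure ((Fin N → α) × (Fin N → β)) :=
  (Measure.pi fun _ => μ).prod (Measure.pi fun _ => ν)

variable {μ : Measure α} {ν : Measure β} [IsProbabilityMeasure μ] [IsProbabilityMeasure ν] {N : ℕ}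

instance : IsProbabilityMeasure (sampleLaw μ ν N) := by
  unfold sampleLaw
  infer_instance

theorem measurePreserving_sampleLaw (i j : Fin N) :
    MeasurePreserving (fun z : (Fin N → α) × (Fin N → β) => (z.1 i, z.2 j)) (sampleLaw μ ν N)
      (μ.prod ν) :=
  (measurePreserving_eval (fun _ => μ) i).prod (measurePreserving_eval (fun _ => ν) j)

theorem measureReal_pi_label {I : Type*} (cl : α → I) (k : Fin N → I) :
    (Measure.pi fun _ : Fin N => μ).real ((fun x i => cl (x i)) ⁻¹' {k})
      = ∏ i, μ.real (cl ⁻¹' {k i}) := by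
  have : (fun (x : Fin N → α) i => cl (x i)) ⁻¹' {k} = Set.univ.pi fun i => cl ⁻¹' {k i} := by
    ext x
    simp [funext_iff]
  rw [this, measureReal_def, Measure.pi_pi, ENNReal.toReal_prod]
  rfl

theorem integral_label_sampleLaw {I J : Type*} [Fintype I] [DecidableEq I] [MeasurableSpace I]
    [MeasurableSingletonClass I] [Fintype J] [DecidableEq J] [MeasurableSpace J]
    [MeasurableSingletonClass J] {cl : α → I} {cl' : β → J} (hcl : Measurable cl)
    (hcl' : Measurable cl') (Φ : (Fin N → I) → (Fin N → J) → ℝ) :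
    ∫ z, Φ (fun i => cl (z.1 i)) (fun i => cl' (z.2 i)) ∂(sampleLaw μ ν N)
      = pairExp (fun k => μ.real (cl ⁻¹' {k})) (fun l => ν.real (cl' ⁻¹' {l})) N Φ := by
  have h1 : Measurable fun (x : Fin N → α) i => cl (x i) := by fun_prop
  have h2 : Measurable fun (x : Fin N → β) i => cl' (x i) := by fun_prop
  rw [sampleLaw, integral_comp_label h1 h2 Φ]
  simp only [pairExp, iidExp, measureReal_pi_label, Finset.mul_sum]
  exact Finset.sum_congr rfl fun k _ => Finset.sum_congr rfl fun l _ => by ring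

variable [MeasurableSpace.CountablyGenerated α] [MeasurableSpace.CountablyGenerated β]
  {ξ : α × β → ℝ}

/-- The permutation average of the block kernel of level `r`. -/
noncomputable def IsCouplingDensity.blockAvg (h : IsCouplingDensity μ ν ξ) (r : ℕ)
    (z : (Fin N → α) × (Fin N → β)) : ℝ :=
  permAvg (h.kernel r).M (fun i => binLabel r (z.1 i)) fun i => binLabel r (z.2 i)

omit [IsProbabilityMeasure μ] [IsProbabilityMeasure ν] [MeasurableSpace.CountablyGenerated α]
  [MeasurableSpace.CountablyGenerated β] in
theorem measurable_permAvg (hξ : Measurable ξ) :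
    Measurable fun z : (Fin N → α) × (Fin N → β) => permAvg (fun x y => ξ (x, y)) z.1 z.2 := by
  unfold permAvg
  fun_prop

theorem IsCouplingDensity.measurable_blockAvg (h : IsCouplingDensity μ ν ξ) (r : ℕ) :
    Measurable (h.blockAvg r : (Fin N → α) × (Fin N → β) → ℝ) := by
  have h1 : Measurable fun (x : Fin N → α) i => binLabel r (x i) :=
    measurable_pi_lambda _ fun i => (measurable_binLabel r).comp (measurable_pi_apply i)
  have h2 : Measurable fun (x : Fin N → β) i => binLabel r (x i) :=
    measurable_pi_lambda _ fun i => (measurable_binLabel r).comp (measurable_pi_apply i)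
  exact measurable_comp_label h1 h2 fun k l => permAvg (h.kernel r).M k l

theorem IsCouplingDensity.tendsto_blockAvg (h : IsCouplingDensity μ ν ξ) :
    ∀ᵐ z ∂(sampleLaw μ ν N), Tendsto (fun r => h.blockAvg r z) atTop
      (𝓝 (permAvg (fun x y => ξ (x, y)) z.1 z.2)) := by
  have h1 : ∀ᵐ z ∂(sampleLaw μ ν N), ∀ i j : Fin N,
      Tendsto (fun r => (h.kernel r).M (binLabel r (z.1 i)) (binLabel r (z.2 j))) atTop
        (𝓝 (ξ (z.1 i, z.2 j))) :=
    ae_all_iff.2 fun i => ae_all_iff.2 fun j =>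
      (measurePreserving_sampleLaw i j).quasiMeasurePreserving.ae h.tendsto_kernel
  filter_upwards [h1] with z hz
  exact (tendsto_finsetSum _ fun σ _ => tendsto_finsetProd _ fun i _ => hz i (σ i)).const_mul _

theorem IsCouplingDensity.integral_blockAvg_sub_sq (h : IsCouplingDensity μ ν ξ) {c : ℝ}
    (hc : HasGoodSets μ ν ξ c) {r r' : ℕ} (hr : r ≤ r') :
    ∫ z, (h.blockAvg r' z - h.blockAvg r z) ^ 2 ∂(sampleLaw μ ν N)
      = ∑ m ∈ Finset.range (N + 1), ((h.kernel r').chaos m - (h.kernel r).chaos m) := by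
  rw [← (h.kernel_refines hr).pairExp_sub_sq (h.hasGap_blockKernel _ _ hc)
    (h.hasGap_blockKernel _ _ hc) N]
  exact integral_label_sampleLaw (measurable_binLabel r') (measurable_binLabel r')
    fun k l => (permAvg (h.kernel r').M k l - permAvg (h.kernel r).M
      ((fun f => f ∘ Fin.castLE hr) ∘ k) ((fun f => f ∘ Fin.castLE hr) ∘ l)) ^ 2

theorem IsCouplingDensity.integrable_blockAvg_sub_sq (h : IsCouplingDensity μ ν ξ) (r r' : ℕ) :
    Integrable (fun z => (h.blockAvg r' z - h.blockAvg r z) ^ 2) (sampleLaw μ ν N) := by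
  have hb : ∀ r, ∃ C, ∀ z : (Fin N → α) × (Fin N → β), |h.blockAvg r z| ≤ C := fun r =>
    ⟨_, fun z => abs_le_sum_abs (fun k l => permAvg (h.kernel r).M k l) _ _⟩
  obtain ⟨C, hC⟩ := hb r
  obtain ⟨C', hC'⟩ := hb r'
  refine integrable_of_bounded (((h.measurable_blockAvg r').sub (h.measurable_blockAvg r)).pow_const 2)
    (C := (C' + C) ^ 2) fun z => ?_
  rw [abs_pow]
  exact pow_le_pow_left₀ (abs_nonneg _) ((abs_sub _ _).trans (add_le_add (hC' z) (hC z))) 2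

theorem IsCouplingDensity.lintegral_sub_sq_le (h : IsCouplingDensity μ ν ξ) {c : ℝ}
    (hc : HasGoodSets μ ν ξ c) {e : ℝ} {r : ℕ}
    (hr : ∀ r', r ≤ r' → ∀ N,
      ∑ m ∈ Finset.range (N + 1), ((h.kernel r').chaos m - (h.kernel r).chaos m) ≤ e) :
    ∫⁻ z, ENNReal.ofReal ((permAvg (fun x y => ξ (x, y)) z.1 z.2 - h.blockAvg r z) ^ 2)
      ∂(sampleLaw μ ν N) ≤ ENNReal.ofReal e := by
  have hm : ∀ r', Measurable fun z : (Fin N → α) × (Fin N → β) =>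
      ENNReal.ofReal ((h.blockAvg r' z - h.blockAvg r z) ^ 2) := fun r' =>
    ENNReal.measurable_ofReal.comp
      (((h.measurable_blockAvg r').sub (h.measurable_blockAvg r)).pow_const 2)
  calc ∫⁻ z, ENNReal.ofReal ((permAvg (fun x y => ξ (x, y)) z.1 z.2 - h.blockAvg r z) ^ 2)
      ∂(sampleLaw μ ν N)
      ≤ ∫⁻ z, liminf (fun r' => ENNReal.ofReal ((h.blockAvg r' z - h.blockAvg r z) ^ 2)) atTop
        ∂(sampleLaw μ ν N) := by
        refine lintegral_mono_ae ?_
        filter_upwards [h.tendsto_blockAvg] with z hz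
        exact (ENNReal.tendsto_ofReal ((hz.sub_const _).pow 2)).liminf_eq.ge
    _ ≤ liminf (fun r' => ∫⁻ z, ENNReal.ofReal ((h.blockAvg r' z - h.blockAvg r z) ^ 2)
        ∂(sampleLaw μ ν N)) atTop := lintegral_liminf_le hm
    _ ≤ ENNReal.ofReal e := by
        refine liminf_le_of_frequently_le' (Eventually.frequently ?_)
        filter_upwards [eventually_ge_atTop r] with r' hr'
        rw [← ofReal_integral_eq_lintegral_ofReal (h.integrable_blockAvg_sub_sq r r')
          (ae_of_all _ fun z => sq_nonneg _), h.integral_blockAvg_sub_sq hc hr']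
        exact ENNReal.ofReal_le_ofReal (hr r' hr' N)

theorem IsCouplingDensity.measureReal_blockAvg_lt (h : IsCouplingDensity μ ν ξ) (r : ℕ) (δ : ℝ) :
    (sampleLaw μ ν N).real {z | h.blockAvg r z < δ}
      = pairExp (h.kernel r).p (h.kernel r).q N
          fun k l => if permAvg (h.kernel r).M k l < δ then 1 else 0 := by
  have hs : MeasurableSet {z : (Fin N → α) × (Fin N → β) | h.blockAvg r z < δ} :=
    measurableSet_lt (h.measurable_blockAvg r) measurable_const
  rw [← integral_indicator_one hs]
  refine Eq.trans ?_ (integral_label_sampleLaw (measurable_binLabel r) (measurable_binLabel r)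
    fun k l => if permAvg (h.kernel r).M k l < δ then 1 else 0)
  refine integral_congr_ae (ae_of_all _ fun z => ?_)
  by_cases hz : h.blockAvg r z < δ
  · have hz' := hz
    rw [IsCouplingDensity.blockAvg] at hz'
    simp [hz, hz']
  · have hz' := hz
    rw [IsCouplingDensity.blockAvg] at hz'
    simp [hz, hz']

/-- The permutation averages of a coupling density are bounded away from zero in probability. -/
theorem IsCouplingDensity.exists_permAvg_lower (h : IsCouplingDensity μ ν ξ) {c : ℝ}
    (hc : HasGoodSets μ ν ξ c) {e : ℝ} (he : 0 < e) :
    ∃ δ : ℝ, 0 < δ ∧ ∀ᶠ N in atTop, (sampleLaw μ ν N).real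
      {z | permAvg (fun x y => ξ (x, y)) z.1 z.2 < δ} ≤ e := by
  have hcpos := hc.c_pos
  have hcle := hc.c_le
  set s := 1 - c / 8 with hs
  have hs0 : 0 ≤ s := by linarith
  have hs1 : s < 1 := by linarith
  set K := ∫ z, ξ z ^ 2 ∂(μ.prod ν) with hK
  have hK0 : 0 ≤ K := integral_nonneg fun z => sq_nonneg _
  have h1s : 0 < 1 - s := by linarith
  set A := 7 + K + 12 * K / (1 - s) ^ 2 with hA
  have hA0 : 0 < A := by positivity
  set L := 3 * A / e + 1 with hL
  have hL0 : 0 < L := by positivity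
  set δ := Real.exp (-L) / 2 with hδ
  have hδ0 : 0 < δ := by positivity
  have h2δ : 2 * δ = Real.exp (-L) := by rw [hδ]; ring
  have hlog : Real.log (2 * δ)⁻¹ = L := by rw [h2δ, ← Real.exp_neg, neg_neg, Real.log_exp]
  have hAL : A / L ≤ e / 3 := by
    rw [div_le_iff₀ hL0, hL]
    have : e / 3 * (3 * A / e + 1) = A + e / 3 := by field_simp
    linarith
  obtain ⟨r, hr⟩ := h.exists_chaos_sub_le hc (e := e / 3 * δ ^ 2) (by positivity)
  obtain ⟨C, hC⟩ := (h.kernel r).exists_lower_tail_le (h.hasGap_blockKernel _ _ hc) hs0 hs1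
  refine ⟨δ, hδ0, ?_⟩
  have hCN : ∀ᶠ N : ℕ in atTop, C / N < e / 3 :=
    (tendsto_const_div_atTop_nhds_zero_nat C).eventually (gt_mem_nhds (by positivity))
  filter_upwards [hCN, eventually_gt_atTop 0] with N hN1 hN2
  have b1 : (sampleLaw μ ν N).real {z | h.blockAvg r z < 2 * δ} ≤ e / 3 + e / 3 := by
    rw [h.measureReal_blockAvg_lt]
    refine (hC N hN2 (2 * δ) (by positivity) ?_).trans (add_le_add hN1.le ?_)
    · rw [h2δ, Real.exp_lt_one_iff]
      linarith
    · rw [hlog]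
      refine le_trans ?_ hAL
      have := h.hs_blockKernel_le (measurable_binLabel r) (measurable_binLabel r)
      rw [hA]
      gcongr <;> exact this
  have b2 : (sampleLaw μ ν N).real
      {z | δ ^ 2 ≤ (permAvg (fun x y => ξ (x, y)) z.1 z.2 - h.blockAvg r z) ^ 2} ≤ e / 3 := by
    have hm : Measurable fun z : (Fin N → α) × (Fin N → β) =>
        (permAvg (fun x y => ξ (x, y)) z.1 z.2 - h.blockAvg r z) ^ 2 :=
      ((measurable_permAvg h.measurable).sub (h.measurable_blockAvg r)).pow_const 2
    have := (mul_meas_ge_le_lintegral (μ := sampleLaw μ ν N) (ENNReal.measurable_ofReal.comp hm)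
      (ENNReal.ofReal (δ ^ 2))).trans (h.lintegral_sub_sq_le hc hr)
    have hset : {z : (Fin N → α) × (Fin N → β) | ENNReal.ofReal (δ ^ 2) ≤ (ENNReal.ofReal ∘ fun z =>
        (permAvg (fun x y => ξ (x, y)) z.1 z.2 - h.blockAvg r z) ^ 2) z}
        = {z | δ ^ 2 ≤ (permAvg (fun x y => ξ (x, y)) z.1 z.2 - h.blockAvg r z) ^ 2} := by
      ext z
      simp only [Set.mem_ofPred_eq, Function.comp]
      exact ENNReal.ofReal_le_ofReal_iff (sq_nonneg _)
    rw [hset, ← ofReal_measureReal, ← ENNReal.ofReal_mul (by positivity),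
      ENNReal.ofReal_le_ofReal_iff (by positivity), mul_comm] at this
    exact le_of_mul_le_mul_right this (by positivity)
  calc (sampleLaw μ ν N).real {z | permAvg (fun x y => ξ (x, y)) z.1 z.2 < δ}
      ≤ (sampleLaw μ ν N).real ({z | h.blockAvg r z < 2 * δ} ∪
        {z | δ ^ 2 ≤ (permAvg (fun x y => ξ (x, y)) z.1 z.2 - h.blockAvg r z) ^ 2}) := by
        refine measureReal_mono fun z hz => ?_
        simp only [Set.mem_ofPred_eq, Set.mem_union] at hz ⊢
        by_contra! hcon
        nlinarith [hcon.1, hcon.2]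
    _ ≤ _ := measureReal_union_le _ _
    _ ≤ e := by linarith

end Sample

/-! ### Comparison with the tilted sample and the law of large numbers -/

section Tilt

variable {Z : Type*} [MeasurableSpace Z]

theorem pi_withDensity {ρ : Measure Z} [IsProbabilityMeasure ρ] {f : Z → ENNReal}
    (hf : Measurable f) [IsProbabilityMeasure (ρ.withDensity f)] (N : ℕ) :
    (Measure.pi fun _ : Fin N => ρ.withDensity f)
      = (Measure.pi fun _ : Fin N => ρ).withDensity fun w => ∏ i, f (w i) := by
  refine Measure.pi_eq fun s hs => ?_
  have hind : iIndepFun (fun (i : Fin N) (w : Fin N → Z) => (s i).indicator f (w i))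
      (Measure.pi fun _ : Fin N => ρ) :=
    iIndepFun_pi fun i => (hf.indicator (hs i)).aemeasurable
  have hp := lintegral_prod_eq_prod_lintegral_of_indepFun Finset.univ _ hind
    fun i => (hf.indicator (hs i)).comp (measurable_pi_apply i)
  rw [withDensity_apply _ (MeasurableSet.univ_pi hs), ← lintegral_indicator (MeasurableSet.univ_pi hs)]
  have e : ∀ w : Fin N → Z, (Set.univ.pi s).indicator (fun w => ∏ i, f (w i)) w
      = ∏ i, (s i).indicator f (w i) := fun w => by
    by_cases hw : w ∈ Set.univ.pi s
    · rw [Set.indicator_of_mem hw]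
      exact Finset.prod_congr rfl fun i _ => (Set.indicator_of_mem (hw i (Set.mem_univ i)) f).symm
    · rw [Set.indicator_of_notMem hw]
      simp only [Set.mem_pi, Set.mem_univ, true_implies, not_forall] at hw
      obtain ⟨i, hi⟩ := hw
      exact (Finset.prod_eq_zero (Finset.mem_univ i) (Set.indicator_of_notMem hi f)).symm
  simp_rw [e]
  rw [hp]
  refine Finset.prod_congr rfl fun i _ => ?_
  rw [withDensity_apply _ (hs i), ← lintegral_indicator (hs i)]
  exact (measurePreserving_eval (fun _ : Fin N => ρ) i).lintegral_comp (hf.indicator (hs i))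

/-- The `L¹` law of large numbers for samples of a probability measure. -/
theorem tendsto_lintegral_average {κ : Measure Z} [IsProbabilityMeasure κ] {η : Z → ℝ}
    (hm : Measurable η) (hη : Integrable η κ) :
    Tendsto (fun N : ℕ => ∫⁻ w, ENNReal.ofReal |(N : ℝ)⁻¹ * ∑ i, η (w i) - ∫ z, η z ∂κ|
      ∂(Measure.pi fun _ : Fin N => κ)) atTop (𝓝 0) := by
  obtain ⟨Ω, mΩ, P, X, hX, hlaw, hind, hP⟩ := exists_iid ℕ κ
  have h0 : MeasurePreserving (X 0) P κ := ⟨hX 0, (hlaw 0).map_eq⟩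
  have hL := strong_law_Lp (μ := P) le_rfl ENNReal.one_ne_top (fun i ω => η (X i ω))
    (memLp_one_iff_integrable.2 (h0.integrable_comp_of_integrable hη))
    (fun i j hij => (hind.indepFun hij).comp hm hm)
    (fun i => (IdentDistrib.mk (hX i).aemeasurable (hX 0).aemeasurable
      ((hlaw i).map_eq.trans (hlaw 0).map_eq.symm)).comp hm)
  refine hL.congr fun N => ?_
  have hN : MeasurePreserving (fun ω (i : Fin N) => X i ω) P (Measure.pi fun _ : Fin N => κ) := by
    refine ⟨measurable_pi_lambda _ fun i => hX i, ?_⟩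
    rw [(iIndepFun_iff_map_fun_eq_pi_map fun i : Fin N => (hX i).aemeasurable).1
      (hind.precomp Fin.val_injective)]
    simp only [(hlaw _).map_eq]
  have e : ∫ ω, η (X 0 ω) ∂P = ∫ z, η z ∂κ := by
    rw [← h0.map_eq, integral_map (hX 0).aemeasurable hm.aestronglyMeasurable]
  rw [eLpNorm_one_eq_lintegral_enorm, ← hN.lintegral_comp (by fun_prop)]
  refine lintegral_congr fun ω => ?_
  rw [e, Real.enorm_eq_ofReal_abs, smul_eq_mul, Finset.sum_range]

end Tilt

section Comparison

variable {α β : Type*} [MeasurableSpace α] [MeasurableSpace β] {μ : Measure α} {ν : Measure β}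
  [IsProbabilityMeasure μ] [IsProbabilityMeasure ν] {ξ : α × β → ℝ}

theorem measurePreserving_matching {N : ℕ} (σ : Equiv.Perm (Fin N)) :
    MeasurePreserving (fun (z : (Fin N → α) × (Fin N → β)) i => (z.1 i, z.2 (σ i)))
      (sampleLaw μ ν N) (Measure.pi fun _ : Fin N => μ.prod ν) := by
  have h1 : MeasurePreserving (fun (y : Fin N → β) i => y (σ i)) (Measure.pi fun _ => ν)
      (Measure.pi fun _ => ν) := by
    have e : (fun (y : Fin N → β) i => y (σ i))
        = MeasurableEquiv.piCongrLeft (fun _ : Fin N => β) σ.symm := by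
      funext y i
      have := MeasurableEquiv.piCongrLeft_apply_apply (β := fun _ : Fin N => β) σ.symm y (σ i)
      rw [Equiv.symm_apply_apply] at this
      exact this.symm
    rw [e]
    exact measurePreserving_piCongrLeft (fun _ : Fin N => ν) σ.symm
  have h2 := (MeasurePreserving.id (Measure.pi fun _ : Fin N => μ)).prod h1
  exact (measurePreserving_arrowProdEquivProdArrow α β (Fin N) (fun _ => μ) (fun _ => ν)).symm.comp h2

/-- The average over permutations of the likelihood times the deviation of the matched sample. -/
noncomputable def weightedDeviation (ξ η : α × β → ℝ) (θ : ℝ) {N : ℕ}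
    (z : (Fin N → α) × (Fin N → β)) : ℝ :=
  (N.factorial : ℝ)⁻¹ * ∑ σ : Equiv.Perm (Fin N), (∏ i, ξ (z.1 i, z.2 (σ i))) *
    |(N : ℝ)⁻¹ * ∑ i, η (z.1 i, z.2 (σ i)) - θ|

theorem lintegral_weightedDeviation (h : Measurable ξ) (hpos : ∀ z, 0 < ξ z) {η : α × β → ℝ}
    (hη : Measurable η) (θ : ℝ) (N : ℕ)
    [IsProbabilityMeasure ((μ.prod ν).withDensity fun z => ENNReal.ofReal (ξ z))] :
    ∫⁻ z, ENNReal.ofReal (weightedDeviation ξ η θ z) ∂(sampleLaw μ ν N)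
      = ∫⁻ w, ENNReal.ofReal |(N : ℝ)⁻¹ * ∑ i, η (w i) - θ|
        ∂(Measure.pi fun _ : Fin N => (μ.prod ν).withDensity fun z => ENNReal.ofReal (ξ z)) := by
  have hd : Measurable fun w : Fin N → α × β => ENNReal.ofReal |(N : ℝ)⁻¹ * ∑ i, η (w i) - θ| := by
    fun_prop
  have hx : Measurable fun w : Fin N → α × β => ∏ i, ENNReal.ofReal (ξ (w i)) := by fun_prop
  rw [pi_withDensity h.ennreal_ofReal, lintegral_withDensity_eq_lintegral_mul _ hx hd]
  set G : (Fin N → α × β) → ENNReal := (fun w => ∏ i, ENNReal.ofReal (ξ (w i))) *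
    fun w => ENNReal.ofReal |(N : ℝ)⁻¹ * ∑ i, η (w i) - θ| with hG
  have hGm : Measurable G := hx.mul hd
  have e : ∀ z : (Fin N → α) × (Fin N → β), ENNReal.ofReal (weightedDeviation ξ η θ z)
      = ENNReal.ofReal (N.factorial : ℝ)⁻¹ *
        ∑ σ : Equiv.Perm (Fin N), G fun i => (z.1 i, z.2 (σ i)) := fun z => by
    rw [weightedDeviation, ENNReal.ofReal_mul (by positivity), ENNReal.ofReal_sum_of_nonneg
      fun σ _ => mul_nonneg (Finset.prod_nonneg fun i _ => (hpos _).le) (abs_nonneg _)]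
    congr 1
    refine Finset.sum_congr rfl fun σ _ => ?_
    rw [ENNReal.ofReal_mul (Finset.prod_nonneg fun i _ => (hpos _).le),
      ENNReal.ofReal_prod_of_nonneg fun i _ => (hpos _).le]
    rfl
  simp_rw [e]
  have hm : ∀ σ : Equiv.Perm (Fin N), Measurable fun z : (Fin N → α) × (Fin N → β) =>
      G fun i => (z.1 i, z.2 (σ i)) := fun σ => hGm.comp (by fun_prop)
  rw [lintegral_const_mul _ (Finset.measurable_sum _ fun σ _ => hm σ),
    lintegral_finsetSum _ fun σ _ => hm σ]
  simp_rw [(measurePreserving_matching (μ := μ) (ν := ν) _).lintegral_comp hGm]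
  rw [Finset.sum_const, Finset.card_univ, Fintype.card_perm, Fintype.card_fin, nsmul_eq_mul,
    ← mul_assoc, ENNReal.ofReal_inv_of_pos (by positivity), ENNReal.ofReal_natCast,
    ENNReal.inv_mul_cancel (by positivity) (ENNReal.natCast_ne_top _), one_mul]

theorem measurable_weightedDeviation (h : Measurable ξ) {η : α × β → ℝ} (hη : Measurable η)
    (θ : ℝ) (N : ℕ) :
    Measurable fun z : (Fin N → α) × (Fin N → β) => weightedDeviation ξ η θ z := by
  unfold weightedDeviation
  fun_prop

/-- The self-normalised matching average concentrates. -/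
theorem IsCouplingDensity.tendsto_measureReal_deviation [MeasurableSpace.CountablyGenerated α]
    [MeasurableSpace.CountablyGenerated β] (h : IsCouplingDensity μ ν ξ) {c : ℝ}
    (hc : HasGoodSets μ ν ξ c) {η : α × β → ℝ} (hη : Measurable η)
    [IsProbabilityMeasure ((μ.prod ν).withDensity fun z => ENNReal.ofReal (ξ z))]
    (hi : Integrable η ((μ.prod ν).withDensity fun z => ENNReal.ofReal (ξ z))) {θ : ℝ}
    (hθ : θ = ∫ z, η z ∂((μ.prod ν).withDensity fun z => ENNReal.ofReal (ξ z))) {t : ℝ}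
    (ht : 0 < t) :
    Tendsto (fun N => (sampleLaw μ ν N).real {z | t * permAvg (fun x y => ξ (x, y)) z.1 z.2
      ≤ weightedDeviation ξ η θ z}) atTop (𝓝 0) := by
  have hlim : Tendsto (fun N : ℕ => ∫⁻ z, ENNReal.ofReal (weightedDeviation ξ η θ z)
      ∂(sampleLaw μ ν N)) atTop (𝓝 0) := by
    simp_rw [lintegral_weightedDeviation h.measurable h.pos hη]
    rw [hθ]
    exact tendsto_lintegral_average hη hi
  rw [tendsto_order]
  refine ⟨fun a ha => Eventually.of_forall fun N => ha.trans_le measureReal_nonneg, fun e he => ?_⟩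
  obtain ⟨δ, hδ, hN⟩ := h.exists_permAvg_lower hc (e := e / 3) (by positivity)
  have hev := hlim.eventually (gt_mem_nhds (show (0 : ENNReal) < ENNReal.ofReal (e / 3 * (t * δ)) by
    rw [ENNReal.ofReal_pos]; positivity))
  filter_upwards [hN, hev] with N hN1 hN2
  have hm := measurable_weightedDeviation h.measurable hη θ N
  have b2 : (sampleLaw μ ν N).real {z | t * δ ≤ weightedDeviation ξ η θ z} ≤ e / 3 := by
    have := (mul_meas_ge_le_lintegral (μ := sampleLaw μ ν N) hm.ennreal_ofReal
      (ENNReal.ofReal (t * δ))).trans hN2.le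
    have hset : {z : (Fin N → α) × (Fin N → β) |
        ENNReal.ofReal (t * δ) ≤ ENNReal.ofReal (weightedDeviation ξ η θ z)}
        = {z | t * δ ≤ weightedDeviation ξ η θ z} := by
      ext z
      refine ENNReal.ofReal_le_ofReal_iff (mul_nonneg (by positivity) ?_)
      exact Finset.sum_nonneg fun σ _ =>
        mul_nonneg (Finset.prod_nonneg fun i _ => (h.pos _).le) (abs_nonneg _)
    rw [hset, ← ofReal_measureReal, ← ENNReal.ofReal_mul (by positivity),
      ENNReal.ofReal_le_ofReal_iff (by positivity), mul_comm] at this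
    exact le_of_mul_le_mul_right this (by positivity)
  calc (sampleLaw μ ν N).real {z | t * permAvg (fun x y => ξ (x, y)) z.1 z.2
        ≤ weightedDeviation ξ η θ z}
      ≤ (sampleLaw μ ν N).real ({z | permAvg (fun x y => ξ (x, y)) z.1 z.2 < δ} ∪
          {z | t * δ ≤ weightedDeviation ξ η θ z}) := by
        refine measureReal_mono fun z hz => ?_
        rcases lt_or_ge (permAvg (fun x y => ξ (x, y)) z.1 z.2) δ with hlt | hge
        · exact Or.inl hlt
        · exact Or.inr ((mul_le_mul_of_nonneg_left hge ht.le).trans hz)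
    _ ≤ _ := measureReal_union_le _ _
    _ < e := by linarith

end Comparison

/-! ### The Schrödinger density -/

section Schrodinger

variable {d : ℕ} {c : EuclideanSpace ℝ (Fin d) → EuclideanSpace ℝ (Fin d) → ℝ} {ε : ℝ}
  {ρ₀ ρ₁ : Measure (EuclideanSpace ℝ (Fin d))} {a b : EuclideanSpace ℝ (Fin d) → ℝ}

theorem measurable_schrodingerXi (hc : Continuous (Function.uncurry c)) (ha : Measurable a)
    (hb : Measurable b) : Measurable (schrodingerXi c ε a b) := by
  have h1 : Measurable fun z : EuclideanSpace ℝ (Fin d) × EuclideanSpace ℝ (Fin d) => c z.1 z.2 :=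
    hc.measurable
  unfold schrodingerXi
  fun_prop

theorem IsSchrodingerPotentials.isProbabilityMeasure [IsProbabilityMeasure ρ₀]
    (hab : IsSchrodingerPotentials c ε ρ₀ ρ₁ a b) :
    IsProbabilityMeasure (schrodingerMeasure c ε ρ₀ ρ₁ a b) := by
  refine ⟨?_⟩
  have h1 := congrArg (fun m => m Set.univ) hab.mem_couplings.1
  simpa [Measure.map_apply measurable_fst MeasurableSet.univ] using h1

theorem integral_schrodingerXi_mul (hξ : Measurable (schrodingerXi c ε a b))
    (F : EuclideanSpace ℝ (Fin d) × EuclideanSpace ℝ (Fin d) → ℝ) :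
    ∫ z, schrodingerXi c ε a b z * F z ∂(ρ₀.prod ρ₁)
      = ∫ z, F z ∂(schrodingerMeasure c ε ρ₀ ρ₁ a b) := by
  rw [schrodingerMeasure, integral_withDensity_eq_integral_toReal_smul hξ.ennreal_ofReal
    (ae_of_all _ fun z => ENNReal.ofReal_lt_top)]
  refine integral_congr_ae (ae_of_all _ fun z => ?_)
  simp only [smul_eq_mul]
  rw [ENNReal.toReal_ofReal (show 0 ≤ schrodingerXi c ε a b z from (Real.exp_pos _).le)]

theorem IsSchrodingerPotentials.isCouplingDensity (hc : Continuous (Function.uncurry c))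
    (hab : IsSchrodingerPotentials c ε ρ₀ ρ₁ a b)
    (hξ : MemLp (schrodingerXi c ε a b) 2 (ρ₀.prod ρ₁)) :
    IsCouplingDensity ρ₀ ρ₁ (schrodingerXi c ε a b) where
  measurable := measurable_schrodingerXi hc hab.measurable_left hab.measurable_right
  pos _ := Real.exp_pos _
  memLp := hξ
  left f hf := by
    rw [integral_schrodingerXi_mul
      (measurable_schrodingerXi hc hab.measurable_left hab.measurable_right) fun z => f z.1]
    conv_rhs => rw [← hab.mem_couplings.1]
    exact (integral_map measurable_fst.aemeasurable hf.aestronglyMeasurable).symm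
  right f hf := by
    rw [integral_schrodingerXi_mul
      (measurable_schrodingerXi hc hab.measurable_left hab.measurable_right) fun z => f z.2]
    conv_rhs => rw [← hab.mem_couplings.2]
    exact (integral_map measurable_snd.aemeasurable hf.aestronglyMeasurable).symm

/-- The points of norm at most `n` at which the potential is at least `-n`. -/
def sublevelBall (a : EuclideanSpace ℝ (Fin d) → ℝ) (n : ℕ) : Set (EuclideanSpace ℝ (Fin d)) :=
  {x | ‖x‖ ≤ n ∧ -(n : ℝ) ≤ a x}

theorem measurableSet_sublevelBall (ha : Measurable a) (n : ℕ) :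
    MeasurableSet (sublevelBall a n) :=
  (measurableSet_le measurable_norm measurable_const).inter (measurableSet_le measurable_const ha)

theorem monotone_sublevelBall : Monotone (sublevelBall a) := fun n m hnm x hx => by
  have : (n : ℝ) ≤ m := by exact_mod_cast hnm
  exact ⟨hx.1.trans this, (neg_le_neg this).trans hx.2⟩

theorem exists_mem_sublevelBall (x : EuclideanSpace ℝ (Fin d)) : ∃ n, x ∈ sublevelBall a n := by
  obtain ⟨n, hn⟩ := exists_nat_ge (max ‖x‖ (-a x))
  exact ⟨n, (le_max_left _ _).trans hn, by linarith [(le_max_right ‖x‖ (-a x)).trans hn]⟩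

theorem tendsto_measureReal_compl_sublevelBall [IsProbabilityMeasure ρ₀] (ha : Measurable a) :
    Tendsto (fun n => ρ₀.real (sublevelBall a n)ᶜ) atTop (𝓝 0) := by
  have h1 := tendsto_setIntegral_of_antitone (μ := ρ₀) (f := fun _ => (1 : ℝ))
    (fun n => (measurableSet_sublevelBall ha n).compl)
    (fun n m hnm => Set.compl_subset_compl.2 (monotone_sublevelBall hnm))
    ⟨0, (integrable_const _).integrableOn⟩
  have h2 : ⋂ n, (sublevelBall a n)ᶜ = ∅ := by
    rw [← Set.compl_iUnion, Set.compl_empty_iff, Set.eq_univ_iff_forall]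
    exact fun x => Set.mem_iUnion.2 (exists_mem_sublevelBall x)
  simpa [h2] using h1

theorem tendsto_setIntegral_compl_sublevelBall (ha : Measurable a) (hb : Measurable b)
    {F : EuclideanSpace ℝ (Fin d) × EuclideanSpace ℝ (Fin d) → ℝ}
    (hF : Integrable F (ρ₀.prod ρ₁)) :
    Tendsto (fun n => ∫ z in (sublevelBall a n ×ˢ sublevelBall b n)ᶜ, F z ∂(ρ₀.prod ρ₁)) atTop
      (𝓝 0) := by
  have h1 := tendsto_setIntegral_of_antitone (μ := ρ₀.prod ρ₁) (f := F)
    (fun n => ((measurableSet_sublevelBall ha n).prod (measurableSet_sublevelBall hb n)).compl)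
    (fun n m hnm => Set.compl_subset_compl.2
      (Set.prod_mono (monotone_sublevelBall hnm) (monotone_sublevelBall hnm)))
    ⟨0, hF.integrableOn⟩
  have h2 : ⋂ n, (sublevelBall a n ×ˢ sublevelBall b n)ᶜ = ∅ := by
    rw [← Set.compl_iUnion, Set.compl_empty_iff, Set.eq_univ_iff_forall]
    intro z
    obtain ⟨n, hn⟩ := exists_mem_sublevelBall (a := a) z.1
    obtain ⟨m, hm⟩ := exists_mem_sublevelBall (a := b) z.2
    exact Set.mem_iUnion.2 ⟨max n m, monotone_sublevelBall (le_max_left n m) hn,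
      monotone_sublevelBall (le_max_right n m) hm⟩
  simpa [h2] using h1

theorem IsSchrodingerPotentials.exists_hasGoodSets [IsProbabilityMeasure ρ₀]
    [IsProbabilityMeasure ρ₁] (hε : 0 < ε) (hc : Continuous (Function.uncurry c))
    (hab : IsSchrodingerPotentials c ε ρ₀ ρ₁ a b)
    (hξ : MemLp (schrodingerXi c ε a b) 2 (ρ₀.prod ρ₁)) :
    ∃ k, HasGoodSets ρ₀ ρ₁ (schrodingerXi c ε a b) k := by
  have ha := hab.measurable_left
  have hb := hab.measurable_right
  obtain ⟨n, ⟨h1, h2⟩, h3⟩ := (((tendsto_measureReal_compl_sublevelBall (ρ₀ := ρ₀) ha).eventually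
    (ge_mem_nhds (show (0 : ℝ) < 1 / 2 by norm_num))).and
    ((tendsto_measureReal_compl_sublevelBall (ρ₀ := ρ₁) hb).eventually
    (ge_mem_nhds (show (0 : ℝ) < 1 / 2 by norm_num)))).and
    ((tendsto_setIntegral_compl_sublevelBall ha hb hξ.integrable_sq).eventually
    (ge_mem_nhds (show (0 : ℝ) < 1 / 16 by norm_num))) |>.exists
  obtain ⟨K, hK⟩ := ((isCompact_closedBall (0 : EuclideanSpace ℝ (Fin d)) n).prod
    (isCompact_closedBall (0 : EuclideanSpace ℝ (Fin d)) n)).exists_bound_of_continuousOn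
    hc.continuousOn
  refine ⟨min 1 (Real.exp (-(1 / ε) * (K + 2 * n))), lt_min one_pos (Real.exp_pos _),
    min_le_left _ _, sublevelBall a n, sublevelBall b n, measurableSet_sublevelBall ha n,
    measurableSet_sublevelBall hb n, fun x hx y hy => (min_le_right _ _).trans ?_, h1, h2, h3⟩
  refine Real.exp_le_exp.2 ?_
  have hcK : c x y ≤ K := (le_abs_self _).trans (hK (x, y)
    ⟨mem_closedBall_zero_iff.2 hx.1, mem_closedBall_zero_iff.2 hy.1⟩)
  have hle : c x y - a x - b y ≤ K + 2 * n := by linarith [hx.2, hy.2]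
  have := mul_le_mul_of_nonneg_left hle (one_div_pos.2 hε).le
  simp only
  linarith

/-! ### The discrete bridge -/

variable {N : ℕ} {x y : Fin N → EuclideanSpace ℝ (Fin d)}

theorem integral_discreteBridge (hN : 0 < N)
    (η : EuclideanSpace ℝ (Fin d) × EuclideanSpace ℝ (Fin d) → ℝ) :
    ∫ z, η z ∂(discreteBridge c ε x y)
      = ∑ σ, gibbsProb c ε x y σ * ((N : ℝ)⁻¹ * ∑ i, η (x i, y (σ i))) := by
  have hd : ∀ z : EuclideanSpace ℝ (Fin d) × EuclideanSpace ℝ (Fin d),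
      Integrable η (Measure.dirac z) := fun z => integrable_dirac (by simp)
  have hN' : (N : ENNReal)⁻¹ ≠ ⊤ := ENNReal.inv_ne_top.2 (by exact_mod_cast hN.ne')
  have hs : ∀ σ : Equiv.Perm (Fin N), Integrable η ((N : ENNReal)⁻¹ •
      ∑ i, Measure.dirac (x i, y (σ i))) := fun σ =>
    (integrable_finsetSum_measure.2 fun i _ => hd _).smul_measure hN'
  rw [discreteBridge, integral_finsetSum_measure fun σ _ =>
    (hs σ).smul_measure ENNReal.ofReal_ne_top]
  refine Finset.sum_congr rfl fun σ _ => ?_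
  have hq : 0 ≤ gibbsProb c ε x y σ :=
    div_nonneg (Real.exp_pos _).le (Finset.sum_nonneg fun _ _ => (Real.exp_pos _).le)
  rw [integral_smul_measure, integral_smul_measure, integral_finsetSum_measure fun i _ => hd _,
    ENNReal.toReal_ofReal hq]
  simp

theorem gibbsProb_eq (a b : EuclideanSpace ℝ (Fin d) → ℝ) (σ : Equiv.Perm (Fin N)) :
    gibbsProb c ε x y σ = (∏ i, schrodingerXi c ε a b (x i, y (σ i))) /
      ∑ τ : Equiv.Perm (Fin N), ∏ i, schrodingerXi c ε a b (x i, y (τ i)) := by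
  set E := Real.exp (1 / ε * ((∑ i, a (x i)) + ∑ i, b (y i))) with hE
  have e : ∀ τ : Equiv.Perm (Fin N), ∏ i, schrodingerXi c ε a b (x i, y (τ i))
      = permWeight c ε x y τ * E := fun τ => by
    simp only [schrodingerXi, permWeight]
    rw [hE, ← Real.exp_sum, ← Real.exp_add, ← Finset.mul_sum, Finset.sum_sub_distrib,
      Finset.sum_sub_distrib, Equiv.sum_comp τ fun i => b (y i)]
    congr 1
    ring
  simp only [e, ← Finset.sum_mul]
  rw [gibbsProb, mul_div_mul_right _ _ (Real.exp_pos _).ne']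

theorem abs_integral_discreteBridge_sub_mul_le (hN : 0 < N) (a b : EuclideanSpace ℝ (Fin d) → ℝ)
    (η : EuclideanSpace ℝ (Fin d) × EuclideanSpace ℝ (Fin d) → ℝ) (θ : ℝ) :
    |∫ z, η z ∂(discreteBridge c ε x y) - θ|
        * permAvg (fun x y => schrodingerXi c ε a b (x, y)) x y
      ≤ weightedDeviation (schrodingerXi c ε a b) η θ (x, y) := by
  set w : Equiv.Perm (Fin N) → ℝ := fun σ => ∏ i, schrodingerXi c ε a b (x i, y (σ i)) with hw
  have hw0 : ∀ σ, 0 < w σ := fun σ => Finset.prod_pos fun i _ => Real.exp_pos _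
  set S := ∑ τ, w τ with hS
  have hS0 : 0 < S := Finset.sum_pos (fun τ _ => hw0 τ) Finset.univ_nonempty
  set A : Equiv.Perm (Fin N) → ℝ := fun σ => (N : ℝ)⁻¹ * ∑ i, η (x i, y (σ i)) with hA
  have h1 : ∫ z, η z ∂(discreteBridge c ε x y) - θ = (∑ σ, w σ * (A σ - θ)) / S := by
    rw [integral_discreteBridge hN]
    simp only [gibbsProb_eq a b, mul_sub, Finset.sum_sub_distrib, ← Finset.sum_mul]
    rw [sub_div, mul_div_cancel_left₀ _ hS0.ne', Finset.sum_div]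
    congr 1
    exact Finset.sum_congr rfl fun σ _ => by rw [div_mul_eq_mul_div]
  have h2 : |∑ σ, w σ * (A σ - θ)| ≤ ∑ σ, w σ * |A σ - θ| := by
    refine (Finset.abs_sum_le_sum_abs _ _).trans (Finset.sum_le_sum fun σ _ => ?_)
    rw [abs_mul, abs_of_pos (hw0 σ)]
  rw [h1, abs_div, abs_of_pos hS0]
  change |∑ σ, w σ * (A σ - θ)| / S * ((N.factorial : ℝ)⁻¹ * S)
    ≤ (N.factorial : ℝ)⁻¹ * ∑ σ, w σ * |A σ - θ|
  calc |∑ σ, w σ * (A σ - θ)| / S * ((N.factorial : ℝ)⁻¹ * S)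
      = (N.factorial : ℝ)⁻¹ * |∑ σ, w σ * (A σ - θ)| := by field_simp
    _ ≤ _ := by gcongr

theorem map_sample_eq_sampleLaw [IsProbabilityMeasure ρ₀] [IsProbabilityMeasure ρ₁] {Ω : Type*}
    [MeasurableSpace Ω] {P : Measure Ω} [IsProbabilityMeasure P]
    {X Y : ℕ → Ω → EuclideanSpace ℝ (Fin d)}
    (hlaw : ∀ i, HasLaw (fun ω => (X i ω, Y i ω)) (ρ₀.prod ρ₁) P)
    (hind : iIndepFun (fun i ω => (X i ω, Y i ω)) P) (N : ℕ) :
    HasLaw (fun ω => ((fun i : Fin N => X i ω), fun i : Fin N => Y i ω)) (sampleLaw ρ₀ ρ₁ N) P := by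
  have hm : ∀ i : Fin N, AEMeasurable (fun ω => (X i ω, Y i ω)) P := fun i => (hlaw i).aemeasurable
  have h1 := (iIndepFun_iff_map_fun_eq_pi_map hm).1 (hind.precomp Fin.val_injective)
  simp only [(hlaw _).map_eq] at h1
  have h2 := measurePreserving_arrowProdEquivProdArrow (EuclideanSpace ℝ (Fin d))
    (EuclideanSpace ℝ (Fin d)) (Fin N) (fun _ => ρ₀) fun _ => ρ₁
  have hm' : AEMeasurable (fun ω (i : Fin N) => (X i ω, Y i ω)) P := aemeasurable_pi_lambda _ hm
  refine ⟨h2.measurable.comp_aemeasurable hm', ?_⟩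
  rw [sampleLaw, ← h2.map_eq, ← h1, AEMeasurable.map_map_of_aemeasurable
    h2.measurable.aemeasurable hm']
  rfl

end Schrodinger

theorem theorem1 {d : ℕ} {p ε : ℝ} (hp : 1 ≤ p) (hε : 0 < ε)
    (c : EuclideanSpace ℝ (Fin d) → EuclideanSpace ℝ (Fin d) → ℝ)
    (hc : IsTransportCost p c)
    (ρ₀ ρ₁ : Measure (EuclideanSpace ℝ (Fin d)))
    [IsProbabilityMeasure ρ₀] [IsProbabilityMeasure ρ₁]
    (hρ₀ : ρ₀ ≪ volume) (hρ₁ : ρ₁ ≪ volume)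
    (hmom₀ : Integrable (fun x => ‖x‖ ^ p) ρ₀)
    (hmom₁ : Integrable (fun y => ‖y‖ ^ p) ρ₁)
    (a b : EuclideanSpace ℝ (Fin d) → ℝ)
    (hab : IsSchrodingerPotentials c ε ρ₀ ρ₁ a b)
    (ha : Integrable a ρ₀) (hb : Integrable b ρ₁)
    (hξ : MemLp (schrodingerXi c ε a b) 2 (ρ₀.prod ρ₁))
    {Ω : Type*} [MeasurableSpace Ω] (P : Measure Ω) [IsProbabilityMeasure P]
    (X Y : ℕ → Ω → EuclideanSpace ℝ (Fin d))
    (hlaw : ∀ i, HasLaw (fun ω => (X i ω, Y i ω)) (ρ₀.prod ρ₁) P)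
    (hind : iIndepFun (fun i ω => (X i ω, Y i ω)) P)
    (η : EuclideanSpace ℝ (Fin d) × EuclideanSpace ℝ (Fin d) → ℝ)
    (hη : Integrable η (schrodingerMeasure c ε ρ₀ ρ₁ a b)) :
    TendstoInMeasure P
      (fun (N : ℕ) ω => ∫ z, η z
        ∂(discreteBridge c ε (fun i : Fin N => X i ω) (fun i : Fin N => Y i ω)))
      atTop
      (fun _ => ∫ z, η z ∂(schrodingerMeasure c ε ρ₀ ρ₁ a b)) := by
  have h := hab.isCouplingDensity hc.continuous hξ
  obtain ⟨k, hk⟩ := hab.exists_hasGoodSets hε hc.continuous hξ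
  have hprob : IsProbabilityMeasure
      ((ρ₀.prod ρ₁).withDensity fun z => ENNReal.ofReal (schrodingerXi c ε a b z)) :=
    hab.isProbabilityMeasure
  obtain ⟨η', hη'm, hηη'⟩ := hη.aestronglyMeasurable
  have hη' : Integrable η' (schrodingerMeasure c ε ρ₀ ρ₁ a b) := hη.congr hηη'
  have hac : ∀ᵐ z ∂(ρ₀.prod ρ₁), η z = η' z :=
    (withDensity_absolutelyContinuous' h.measurable.ennreal_ofReal.aemeasurable
      (ae_of_all _ fun z => (ENNReal.ofReal_pos.2 (h.pos z)).ne')).ae_le hηη'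
  rw [tendstoInMeasure_iff_norm]
  intro t ht
  have hlim := h.tendsto_measureReal_deviation hk hη'm.measurable hη' rfl ht
  have hlim' := ENNReal.tendsto_ofReal hlim
  rw [ENNReal.ofReal_zero] at hlim'
  refine tendsto_of_tendsto_of_tendsto_of_le_of_le' tendsto_const_nhds hlim'
    (Eventually.of_forall fun N => zero_le) ?_
  filter_upwards [eventually_gt_atTop 0] with N hN
  have hL := map_sample_eq_sampleLaw hlaw hind N
  rw [ofReal_measureReal, ← hL.measure_eq (measurableSet_le
    ((measurable_permAvg h.measurable).const_mul t)
    (measurable_weightedDeviation h.measurable hη'm.measurable _ N))]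
  refine measure_mono_ae ?_
  have hae : ∀ᵐ z ∂(sampleLaw ρ₀ ρ₁ N), ∀ i j : Fin N, η (z.1 i, z.2 j) = η' (z.1 i, z.2 j) :=
    ae_all_iff.2 fun i => ae_all_iff.2 fun j =>
      (measurePreserving_sampleLaw i j).quasiMeasurePreserving.ae hac
  rw [← hL.map_eq] at hae
  filter_upwards [ae_of_ae_map hL.aemeasurable hae] with ω hω hmem
  have hmem' : t ≤ |∫ z, η z ∂(discreteBridge c ε (fun i : Fin N => X i ω) fun i : Fin N => Y i ω)
      - ∫ z, η z ∂(schrodingerMeasure c ε ρ₀ ρ₁ a b)| := hmem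
  rw [integral_discreteBridge hN, integral_congr_ae hηη'] at hmem'
  simp only [hω] at hmem'
  rw [← integral_discreteBridge hN] at hmem'
  have hU : 0 ≤ permAvg (fun x y => schrodingerXi c ε a b (x, y)) (fun i : Fin N => X i ω)
      fun i : Fin N => Y i ω :=
    mul_nonneg (by positivity) (Finset.sum_nonneg fun σ _ =>
      Finset.prod_nonneg fun i _ => (h.pos _).le)
  exact (mul_le_mul_of_nonneg_right hmem' hU).trans
    (abs_integral_discreteBridge_sub_mul_le hN a b η' _)
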